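/- Let $\mathbb M=\mathbb F_2[\rho,\tau]$ with $|\rho|=(-1,-1)$, $|\tau|=(0,-1)$ (topological degree, weight), and let $$\mathcal A^\vee=\mathbb M[\bar\xi_1,\bar\xi_2,\dots,\bar\tau_0,\bar\tau_1,\dots]/(\bar\tau_i^2=\tau\bar\xi_{i+1}+\rho\bar\tau_{i+1})$$ be the $\mathbb R$-motivic dual Steenrod algebra, $|\bar\xi_i|=(2^{i+1}-2,2^i-1)$, $|\bar\tau_i|=(2^{i+1}-1,2^i-1)$, a Hopf algebroid over $\mathbb M$ with $\eta_R(\rho)=\rho$, $\eta_R(\tau)=\tau+\rho\bar\tau_0$ and (with $\bar\xi_0=1$) $$\Delta\bar\xi_k=\sum_{i+j=k}\bar\xi_i\otimes\bar\xi_j^{2^i},\qquad \Delta\bar\tau_k=\sum_{i+j=k}\bar\tau_i\otimes\bar\xi_j^{2^i}+1\otimes\bar\tau_k .$$ For $n\ge 0$ let $\mathcal A(n)^\vee=\mathcal A^\vee/(\bar\xi_1^{2^n},\dots,\bar\xi_n^{2},\bar\xi_{n+1},\bar\xi_{n+2},\dots,\bar\tau_{n+1},\bar\tau_{n+2},\dots)$.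 For a left $\mathcal A(n)^\vee$-comodule $N$ let $\mathrm{Ext}_{\mathcal A(n)^\vee}(N)$ be the cohomology of its cobar complex, trigraded by $(s,f,w)$: stem $s$ (internal topological degree minus $f$), Adams filtration $f$ and weight $w$. It is a module over the ring $\mathrm{Ext}_{\mathcal A(n)^\vee}(\mathbb M)$, and $\mathrm{Ext}_{\mathcal A(1)^\vee}(\mathbb M)$ acts on $\mathrm{Ext}_{\mathcal A(0)^\vee}(N)$ through restriction. Write $\Sigma^{p,q}$ for the shift $(s,f,w)\mapsto(s+p,f,w+q)$. Let $(\mathcal A/\!\!/\mathcal A(1))^\vee\subset\mathcal A^\vee$ be the $\mathbb M$-subalgebra generated by $\bar\xi_1^2,\bar\xi_2,\bar\xi_3,\dots,\bar\tau_2,\bar\tau_3,\dots$; put $wt(\bar\xi_i)=wt(\bar\tau_i)=2^i$, extended multiplicatively to monomials ($wt(xy)=wt(x)+wt(y)$, $wt(\rho)=wt(\tau)=0$). For $k\ge0$ let $B_1^{\mathbb R}(k)$ be the $\mathbb M$-span of the monomials in these generators of weight at most $4k$, an $\mathcal A(0)^\vee$-comodule through the coproduct of $\mathcal A^\vee$.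 **Lemma.** There is an isomorphism of trigraded rings $$\mathrm{Ext}_{\mathcal A(0)^\vee}(\mathbb M)\cong \mathbb F_2[\rho,\tau^2,h_0]/(\rho h_0)$$ that carries the classes $\rho$, $\tau^2$ and $h_0=[\bar\tau_0]$ to the generators of the same names, which lie in tridegrees $(-1,0,-1)$, $(0,0,-2)$, $(0,1,0)$. For every $k\ge 0$, $\mathrm{Ext}_{\mathcal A(0)^\vee}(B_1^{\mathbb R}(k))$ has an $\mathrm{Ext}_{\mathcal A(1)^\vee}(\mathbb M)$-submodule $T$ of $v_1$-torsion classes (namely: $T$ is concentrated in Adams filtration $0$, and each of its elements is annihilated by every element of positive Adams filtration in $\mathrm{Ext}_{\mathcal A(1)^\vee}(\mathbb M)$, in particular by $h_0$, $h_1$ and the Bott class $b=v_1^4$), such that there is an isomorphism of trigraded $\mathrm{Ext}_{\mathcal A(1)^\vee}(\mathbb M)$-modules $$\mathrm{Ext}_{\mathcal A(0)^\vee}(B_1^{\mathbb R}(k))/T\;\cong\;\bigoplus_{j=0}^{k}\Sigma^{4j,2j}\,\mathbb F_2[\rho,\tau^2,h_0]/(\rho h_0),$$ where $\mathrm{Ext}_{\mathcal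 A(1)^\vee}(\mathbb M)$ acts on each summand through restriction to $\mathrm{Ext}_{\mathcal A(0)^\vee}(\mathbb M)\cong\mathbb F_2[\rho,\tau^2,h_0]/(\rho h_0)$. -/

import Mathlib

open scoped TensorProduct

namespace MotivicExt

/-- The mod 2 motivic homology of a point over the reals, `𝔽₂[ρ, τ]`, with `ρ = X 0`, `τ = X 1`. -/
abbrev M2 : Type := MvPolynomial (Fin 2) (ZMod 2)

/-- Polynomial generators of the dual motivic Steenrod algebra over `𝔽₂`, conjugates being understood:
`ρ`, `τ`, `xi i` for `ξ_{i+1}` and `ta i` for `τ_i`. -/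
inductive Gen : Type
  | rho : Gen
  | tau : Gen
  | xi (i : ℕ) : Gen
  | ta (i : ℕ) : Gen

abbrev Poly : Type := MvPolynomial Gen (ZMod 2)

/-- `ξ_i`, with the convention `ξ_0 = 1`. -/
noncomputable def xiPoly : ℕ → Poly
  | 0 => 1
  | i + 1 => MvPolynomial.X (Gen.xi i)

/-- `τ_i`. -/
noncomputable def taPoly (i : ℕ) : Poly := MvPolynomial.X (Gen.ta i)

/-- The relations `τ_i² = τ ξ_{i+1} + ρ τ_{i+1}` of the dual motivic Steenrod algebra in the conjugate
generators and, when `n` is finite, the elements `ξ_i ^ (2 ^ (n+1-i))` (`i ≤ n`), `ξ_i` and `τ_i`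
(`i ≥ n+1`) that are killed in `A(n)^∨`. Truncated subtraction gives the exponent `2 ^ 0 = 1` for
`i ≥ n+1`. For `n = ⊤` nothing more is killed. -/
def rels (n : ℕ∞) : Set Poly :=
  {p | ∃ i : ℕ, p = taPoly i ^ 2 - (MvPolynomial.X Gen.tau * xiPoly (i + 1)
        + MvPolynomial.X Gen.rho * taPoly (i + 1))} ∪
  {p | ∃ m i : ℕ, n = m ∧ 1 ≤ i ∧ p = xiPoly i ^ 2 ^ (m + 1 - i)} ∪
  {p | ∃ m i : ℕ, n = m ∧ m + 1 ≤ i ∧ p = taPoly i}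

/-- `DualA n` is `A(n)^∨` for finite `n`, and `DualA ⊤` is the whole dual motivic Steenrod algebra over
the reals. -/
def DualA (n : ℕ∞) : Type := Poly ⧸ Ideal.span (rels n)

noncomputable instance (n : ℕ∞) : CommRing (DualA n) :=
  inferInstanceAs (CommRing (Poly ⧸ Ideal.span (rels n)))

noncomputable def DualA.mk (n : ℕ∞) : Poly →+* DualA n := Ideal.Quotient.mk (Ideal.span (rels n))

variable (n : ℕ∞)
noncomputable def rho : DualA n := DualA.mk n (MvPolynomial.X Gen.rho)
noncomputable def tau : DualA n := DualA.mk n (MvPolynomial.X Gen.tau)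
noncomputable def xi (i : ℕ) : DualA n := DualA.mk n (xiPoly i)
noncomputable def ta (i : ℕ) : DualA n := DualA.mk n (taPoly i)

/-- The left unit. -/
noncomputable def etaL : M2 →+* DualA n :=
  MvPolynomial.eval₂Hom ((DualA.mk n).comp MvPolynomial.C) ![rho n, tau n]
/-- The right unit, `ρ ↦ ρ` and `τ ↦ τ + ρ τ_0`. -/
noncomputable def etaR : M2 →+* DualA n :=
  MvPolynomial.eval₂Hom ((DualA.mk n).comp MvPolynomial.C) ![rho n, tau n + rho n * ta n 0]

/-- `DualA n` is a left module over the coefficients through the left unit. -/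
noncomputable instance : Algebra M2 (DualA n) := (etaL n).toAlgebra

/-- A copy of the ring `DualA n`, a module over the coefficients through the right unit. Thus
`AR n ⊗[M2] N` is the tensor product of bimodules `A(n)^∨ ⊗ N`, for a left module `N`. -/
def AR (n : ℕ∞) : Type := DualA n
noncomputable instance : CommRing (AR n) := inferInstanceAs (CommRing (DualA n))
noncomputable instance : Algebra M2 (AR n) := (etaR n).toAlgebra
noncomputable def toAR : DualA n ≃+* AR n := RingEquiv.refl (DualA n)

/-- `A(n)^∨ ⊗ N`, as a left module over the coefficients through the left unit of `A(n)^∨`. -/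
def Ten (n : ℕ∞) (N : Type) [AddCommGroup N] [Module M2 N] : Type := AR n ⊗[M2] N

section
variable (N : Type) [AddCommGroup N] [Module M2 N]
noncomputable instance : AddCommGroup (Ten n N) := inferInstanceAs (AddCommGroup (AR n ⊗[M2] N))
noncomputable instance : Module (AR n) (Ten n N) := inferInstanceAs (Module (AR n) (AR n ⊗[M2] N))
noncomputable instance : Module M2 (Ten n N) :=
  Module.compHom _ (((toAR n : DualA n ≃+* AR n) : DualA n →+* AR n).comp (etaL n))
end

section CharTwo
variable {S : Type*} [CommRing S]

theorem sq_sum_of_two (h2 : (2 : S) = 0) {ι : Type*} (t : Finset ι) (f : ι → S) :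
    (∑ i ∈ t, f i) ^ 2 = ∑ i ∈ t, f i ^ 2 := by
  classical
  induction t using Finset.induction_on with
  | empty => simp
  | insert a t ha ih =>
    rw [Finset.sum_insert ha, Finset.sum_insert ha, ← ih]
    linear_combination (f a * ∑ i ∈ t, f i) * h2

theorem two_pow_sum_of_two (h2 : (2 : S) = 0) {ι : Type*} (t : Finset ι) (f : ι → S) (e : ℕ) :
    (∑ i ∈ t, f i) ^ 2 ^ e = ∑ i ∈ t, f i ^ 2 ^ e := by
  induction e with
  | zero => simp
  | succ e ih => simp only [pow_succ, pow_mul, ih, sq_sum_of_two h2]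
end CharTwo

theorem two_eq_zero_of_hom {S : Type*} [CommRing S] (f : ZMod 2 →+* S) : (2 : S) = 0 := by
  have h := congrArg f (show (2 : ZMod 2) = 0 from rfl)
  rwa [map_ofNat, map_zero] at h

theorem DualA.two_eq_zero : (2 : DualA n) = 0 :=
  two_eq_zero_of_hom ((etaL n).comp MvPolynomial.C)

theorem ten_two_eq_zero (m : ℕ∞) : (2 : AR m ⊗[M2] DualA n) = 0 :=
  two_eq_zero_of_hom ((algebraMap M2 _).comp MvPolynomial.C)

theorem DualA.mk_rel {p : Poly} (hp : p ∈ rels n) : DualA.mk n p = 0 :=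
  Ideal.Quotient.eq_zero_iff_mem.mpr (Ideal.subset_span hp)

theorem ta_sq (i : ℕ) : ta n i ^ 2 = tau n * xi n (i + 1) + rho n * ta n (i + 1) := by
  have h := DualA.mk_rel n (p := taPoly i ^ 2 - (MvPolynomial.X Gen.tau * xiPoly (i + 1)
        + MvPolynomial.X Gen.rho * taPoly (i + 1))) (Or.inl (Or.inl ⟨i, rfl⟩))
  simp only [map_sub, map_pow, map_add, map_mul] at h
  exact sub_eq_zero.mp h

theorem xi_pow_eq_zero (m i e : ℕ) (hi : 1 ≤ i) (he : m + 1 - i ≤ e) :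
    xi (m : ℕ∞) i ^ 2 ^ e = 0 := by
  have h := DualA.mk_rel (m : ℕ∞) (p := xiPoly i ^ 2 ^ (m + 1 - i)) (Or.inl (Or.inr ⟨m, i, rfl, hi, rfl⟩))
  rw [map_pow] at h
  obtain ⟨d, rfl⟩ := Nat.exists_eq_add_of_le he
  rw [pow_add, pow_mul]
  unfold xi
  rw [h, zero_pow (by positivity)]

theorem ta_eq_zero (m i : ℕ) (hi : m + 1 ≤ i) : ta (m : ℕ∞) i = 0 :=
  DualA.mk_rel (m : ℕ∞) (p := taPoly i) (Or.inr ⟨m, i, rfl, hi, rfl⟩)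

theorem xi_zero : xi n 0 = 1 := by simp [xi, xiPoly]

/-- The projection `A(n)^∨ → A(m)^∨` for `m ≤ n`. -/
noncomputable def proj (m n : ℕ∞) (h : m ≤ n) : DualA n →+* DualA m :=
  Ideal.Quotient.lift _ (DualA.mk m) (by
    intro a ha
    refine (Ideal.span_le (I := RingHom.ker (DualA.mk m))).mpr ?_ ha
    rintro p ((⟨i, rfl⟩ | ⟨N, i, rfl, hi, rfl⟩) | ⟨N, i, rfl, hi, rfl⟩)
    · exact DualA.mk_rel m (Or.inl (Or.inl ⟨i, rfl⟩))
    · lift m to ℕ using ne_top_of_le_ne_top (WithTop.coe_ne_top) h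
      have h' : m ≤ N := by exact_mod_cast h
      change DualA.mk _ _ = 0
      rw [map_pow]
      exact xi_pow_eq_zero m i _ hi (by omega)
    · lift m to ℕ using ne_top_of_le_ne_top (WithTop.coe_ne_top) h
      have h' : m ≤ N := by exact_mod_cast h
      exact ta_eq_zero m i (by omega))

/-- The coproduct on generators: `Δ ξ_k = ∑ ξ_i ⊗ ξ_j ^ (2 ^ i)` and
`Δ τ_k = ∑ τ_i ⊗ ξ_j ^ (2 ^ i) + 1 ⊗ τ_k`, sums over `i + j = k`. -/
noncomputable def coprodGen (m n : ℕ∞) : Gen → AR m ⊗[M2] DualA n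
  | .rho => toAR m (rho m) ⊗ₜ[M2] 1
  | .tau => toAR m (tau m) ⊗ₜ[M2] 1
  | .xi k => ∑ p ∈ Finset.HasAntidiagonal.antidiagonal (k + 1), toAR m (xi m p.1) ⊗ₜ[M2] (xi n p.2 ^ 2 ^ p.1)
  | .ta k => (∑ p ∈ Finset.HasAntidiagonal.antidiagonal k, toAR m (ta m p.1) ⊗ₜ[M2] (xi n p.2 ^ 2 ^ p.1))
      + 1 ⊗ₜ[M2] ta n k

noncomputable def coprodPoly (m n : ℕ∞) : Poly →+* AR m ⊗[M2] DualA n :=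
  MvPolynomial.eval₂Hom ((algebraMap M2 (AR m ⊗[M2] DualA n)).comp MvPolynomial.C) (coprodGen m n)

theorem coprodPoly_xi (m n : ℕ∞) (k : ℕ) : coprodPoly m n (xiPoly k) =
    ∑ p ∈ Finset.HasAntidiagonal.antidiagonal k, toAR m (xi m p.1) ⊗ₜ[M2] (xi n p.2 ^ 2 ^ p.1) := by
  cases k with
  | zero => simp [xiPoly, xi_zero, Algebra.TensorProduct.one_def]
  | succ k => simp [coprodPoly, xiPoly, coprodGen]

theorem coprodPoly_ta (m n : ℕ∞) (k : ℕ) : coprodPoly m n (taPoly k) =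
    (∑ p ∈ Finset.HasAntidiagonal.antidiagonal k, toAR m (ta m p.1) ⊗ₜ[M2] (xi n p.2 ^ 2 ^ p.1))
      + 1 ⊗ₜ[M2] ta n k := by
  simp [coprodPoly, taPoly, coprodGen]

theorem algebraMap_AR (m : ℕ∞) (r : M2) : algebraMap M2 (AR m) r = toAR m (etaR m r) := rfl
theorem algebraMap_A (m : ℕ∞) (r : M2) : algebraMap M2 (DualA m) r = etaL m r := rfl

theorem etaL_rho : etaL n (MvPolynomial.X 0) = rho n := by simp [etaL]
theorem etaL_tau : etaL n (MvPolynomial.X 1) = tau n := by simp [etaL]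
theorem etaR_rho : etaR n (MvPolynomial.X 0) = rho n := by simp [etaR]
theorem etaR_tau : etaR n (MvPolynomial.X 1) = tau n + rho n * ta n 0 := by simp [etaR]

theorem balance (m n : ℕ∞) (r : M2) (x : AR m) (y : DualA n) :
    (toAR m (etaR m r) * x) ⊗ₜ[M2] y = x ⊗ₜ[M2] (etaL n r * y) := by
  rw [← algebraMap_AR, ← algebraMap_A, ← Algebra.smul_def, ← Algebra.smul_def,
    TensorProduct.smul_tmul]

theorem coprodPoly_rel (m n : ℕ∞) (h : m ≤ n) {p : Poly} (hp : p ∈ rels n) :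
    coprodPoly m n p = 0 := by
  have h2 := ten_two_eq_zero n m
  rcases hp with ((⟨i, rfl⟩ | ⟨N, i, rfl, hi, rfl⟩) | ⟨N, i, rfl, hi, rfl⟩)
  · have hr : coprodPoly m n (MvPolynomial.X Gen.rho) = toAR m (rho m) ⊗ₜ[M2] 1 := by
      simp [coprodPoly, coprodGen]
    have ht : coprodPoly m n (MvPolynomial.X Gen.tau) = toAR m (tau m) ⊗ₜ[M2] 1 := by
      simp [coprodPoly, coprodGen]
    simp only [map_sub, map_add, map_mul, map_pow, coprodPoly_xi, coprodPoly_ta, hr, ht]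
    rw [Finset.Nat.antidiagonal_succ, Finset.sum_cons, Finset.sum_cons, Finset.sum_map,
      Finset.sum_map]
    simp only [Function.Embedding.prodMap, Function.Embedding.coeFn_mk, Prod.map,
      Function.Embedding.refl_apply, xi_zero, map_one, pow_zero, pow_one, Nat.succ_eq_add_one]
    set S := ∑ p ∈ Finset.HasAntidiagonal.antidiagonal i, toAR m (ta m p.1) ⊗ₜ[M2] (xi n p.2 ^ 2 ^ p.1) with hS
    have e1 : S ^ 2 = (toAR m (tau m) ⊗ₜ[M2] 1) * (∑ p ∈ Finset.HasAntidiagonal.antidiagonal i,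
          toAR m (xi m (p.1 + 1)) ⊗ₜ[M2] (xi n p.2 ^ 2 ^ (p.1 + 1)))
        + (toAR m (rho m) ⊗ₜ[M2] 1) * (∑ p ∈ Finset.HasAntidiagonal.antidiagonal i,
          toAR m (ta m (p.1 + 1)) ⊗ₜ[M2] (xi n p.2 ^ 2 ^ (p.1 + 1))) := by
      rw [hS, sq_sum_of_two h2, Finset.mul_sum, Finset.mul_sum, ← Finset.sum_add_distrib]
      refine Finset.sum_congr rfl fun p _ => ?_
      rw [Algebra.TensorProduct.tmul_pow, ← map_pow, ta_sq, Algebra.TensorProduct.tmul_mul_tmul,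
        Algebra.TensorProduct.tmul_mul_tmul, one_mul, ← pow_mul, ← pow_succ, map_add,
        map_mul, map_mul, TensorProduct.add_tmul]
    have e2 : ((1 : AR m) ⊗ₜ[M2] ta n i) ^ 2 = (toAR m (tau m) ⊗ₜ[M2] 1) * (1 ⊗ₜ[M2] xi n (i + 1))
        + (toAR m (rho m) ⊗ₜ[M2] 1) * (toAR m (ta m 0) ⊗ₜ[M2] xi n (i + 1))
        + (toAR m (rho m) ⊗ₜ[M2] 1) * (1 ⊗ₜ[M2] ta n (i + 1)) := by
      have b1 := balance m n (MvPolynomial.X 1) 1 (xi n (i + 1))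
      have b2 := balance m n (MvPolynomial.X 0) 1 (ta n (i + 1))
      rw [etaR_tau, etaL_tau] at b1
      rw [etaR_rho, etaL_rho] at b2
      rw [Algebra.TensorProduct.tmul_pow, one_pow, ta_sq, TensorProduct.tmul_add, ← b1, ← b2]
      simp only [Algebra.TensorProduct.tmul_mul_tmul, one_mul, mul_one, map_add, map_mul,
        TensorProduct.add_tmul]
    linear_combination e1 + e2 + (S * (1 ⊗ₜ[M2] ta n i)) * h2
  · lift m to ℕ using ne_top_of_le_ne_top (WithTop.coe_ne_top) h
    have h' : m ≤ N := by exact_mod_cast h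
    rw [map_pow, coprodPoly_xi, two_pow_sum_of_two h2]
    refine Finset.sum_eq_zero fun p hp => ?_
    rw [Finset.HasAntidiagonal.mem_antidiagonal] at hp
    rw [Algebra.TensorProduct.tmul_pow, ← map_pow, ← pow_mul, ← pow_add]
    rcases Nat.eq_zero_or_pos p.2 with h0 | h0
    · rw [xi_pow_eq_zero m p.1 _ (by omega) (by omega), map_zero, TensorProduct.zero_tmul]
    · rw [xi_pow_eq_zero N p.2 _ h0 (by omega), TensorProduct.tmul_zero]
  · lift m to ℕ using ne_top_of_le_ne_top (WithTop.coe_ne_top) h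
    have h' : m ≤ N := by exact_mod_cast h
    rw [coprodPoly_ta, ta_eq_zero N i hi, TensorProduct.tmul_zero, add_zero]
    refine Finset.sum_eq_zero fun p hp => ?_
    rw [Finset.HasAntidiagonal.mem_antidiagonal] at hp
    rcases Nat.eq_zero_or_pos p.2 with h0 | h0
    · rw [ta_eq_zero m p.1 (by omega), map_zero, TensorProduct.zero_tmul]
    · rw [xi_pow_eq_zero N p.2 _ h0 (by omega), TensorProduct.tmul_zero]

/-- The ring map `A(n)^∨ → A(m)^∨ ⊗ A(n)^∨` induced by the coproduct, for `m ≤ n`. For `m = n` it is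
the coproduct of `A(n)^∨`; for `n = ⊤` it is the coaction of `A(m)^∨` on the dual Steenrod algebra. -/
noncomputable def coprod (m n : ℕ∞) (h : m ≤ n) : DualA n →+* AR m ⊗[M2] DualA n :=
  Ideal.Quotient.lift _ (coprodPoly m n) (by
    intro a ha
    refine (Ideal.span_le (I := RingHom.ker (coprodPoly m n))).mpr ?_ ha
    exact fun p hp => coprodPoly_rel m n h hp)

theorem coprod_mk (m n : ℕ∞) (h : m ≤ n) (p : Poly) :
    coprod m n h (DualA.mk n p) = coprodPoly m n p := rfl

theorem ringHom_M2_ext {S : Type*} [CommRing S] {f g : M2 →+* S}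
    (h0 : f (MvPolynomial.X 0) = g (MvPolynomial.X 0))
    (h1 : f (MvPolynomial.X 1) = g (MvPolynomial.X 1)) : f = g := by
  apply MvPolynomial.ringHom_ext'
  · exact RingHom.ext_zmod _ _
  · intro i; fin_cases i <;> assumption

theorem coprod_etaL (m n : ℕ∞) (h : m ≤ n) (r : M2) :
    coprod m n h (etaL n r) = toAR m (etaL m r) ⊗ₜ[M2] 1 := by
  have : (coprod m n h).comp (etaL n) = (Algebra.TensorProduct.includeLeftRingHom).comp
      (((toAR m : DualA m ≃+* AR m) : DualA m →+* AR m).comp (etaL m)) := by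
    apply ringHom_M2_ext <;>
    simp [etaL_rho, etaL_tau, rho, tau, coprod_mk, coprodPoly, coprodGen]
  exact DFunLike.congr_fun this r

theorem coprod_etaR (m n : ℕ∞) (h : m ≤ n) (r : M2) :
    coprod m n h (etaR n r) = 1 ⊗ₜ[M2] etaR n r := by
  have : (coprod m n h).comp (etaR n) = 
      (Algebra.TensorProduct.includeRight (R := M2) (A := AR m) (B := DualA n)).toRingHom.comp
        (etaR n) := by
    have b1 := balance m n (MvPolynomial.X 1) 1 1
    have b2 := balance m n (MvPolynomial.X 0) 1 1
    have b3 := balance m n (MvPolynomial.X 0) 1 (ta n 0)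
    rw [etaR_tau, etaL_tau] at b1
    rw [etaR_rho, etaL_rho] at b2 b3
    have hr : coprod m n h (rho n) = toAR m (rho m) ⊗ₜ[M2] 1 := by
      simp [rho, coprod_mk, coprodPoly, coprodGen]
    have ht : coprod m n h (tau n) = toAR m (tau m) ⊗ₜ[M2] 1 := by
      simp [tau, coprod_mk, coprodPoly, coprodGen]
    have ht0 : coprod m n h (ta n 0) = toAR m (ta m 0) ⊗ₜ[M2] 1 + 1 ⊗ₜ[M2] ta n 0 := by
      simp [ta, coprod_mk, coprodPoly_ta, xi_zero]
    apply ringHom_M2_ext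
    · simp only [RingHom.comp_apply, etaR_rho, hr]
      simpa using b2
    · simp only [RingHom.comp_apply, etaR_tau, map_add, map_mul, hr, ht, ht0]
      simp only [mul_one, map_add, map_mul, TensorProduct.add_tmul] at b1 b3
      simp only [AlgHom.toRingHom_eq_coe, RingHom.coe_coe,
        Algebra.TensorProduct.includeRight_apply, mul_add, Algebra.TensorProduct.tmul_mul_tmul,
        mul_one, one_mul]
      linear_combination b1 + b3
  exact DFunLike.congr_fun this r

section Ten
variable {N N' : Type} [AddCommGroup N] [Module M2 N] [AddCommGroup N'] [Module M2 N']

noncomputable def Ten.tmul (γ : AR n) (x : N) : Ten n N := γ ⊗ₜ[M2] x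

theorem Ten.smul_tmul (r : M2) (γ : AR n) (x : N) :
    r • Ten.tmul n γ x = Ten.tmul n (toAR n (etaL n r) * γ) x := rfl

theorem Ten.mul_etaR_tmul (r : M2) (γ : AR n) (x : N) :
    Ten.tmul n (toAR n (etaR n r) * γ) x = Ten.tmul n γ (r • x) := by
  unfold Ten.tmul
  rw [← algebraMap_AR, ← Algebra.smul_def, TensorProduct.smul_tmul]

theorem Ten.tmul_add (γ : AR n) (x y : N) :
    Ten.tmul n γ (x + y) = Ten.tmul n γ x + Ten.tmul n γ y := TensorProduct.tmul_add _ _ _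

theorem Ten.add_tmul (γ γ' : AR n) (x : N) :
    Ten.tmul n (γ + γ') x = Ten.tmul n γ x + Ten.tmul n γ' x := TensorProduct.add_tmul _ _ _

theorem Ten.induction {P : Ten n N → Prop} (h0 : P 0) (ht : ∀ γ x, P (Ten.tmul n γ x))
    (ha : ∀ a b, P a → P b → P (a + b)) (z : Ten n N) : P z :=
  TensorProduct.induction_on z h0 ht ha

theorem Ten.addHom_ext {Q : Type} [AddCommGroup Q] {f g : Ten n N →+ Q}
    (h : ∀ γ x, f (Ten.tmul n γ x) = g (Ten.tmul n γ x)) : f = g := by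
  ext z
  induction z using Ten.induction with
  | h0 => simp
  | ht γ x => exact h γ x
  | ha a b iha ihb => rw [map_add, map_add, iha, ihb]

theorem proj_mk (m n : ℕ∞) (h : m ≤ n) (p : Poly) : proj m n h (DualA.mk n p) = DualA.mk m p := rfl

theorem proj_etaL (m n : ℕ∞) (h : m ≤ n) (r : M2) : proj m n h (etaL n r) = etaL m r := by
  have : (proj m n h).comp (etaL n) = etaL m := by
    apply ringHom_M2_ext <;> simp [etaL_rho, etaL_tau, rho, tau, proj_mk]
  exact DFunLike.congr_fun this r

theorem proj_etaR (m n : ℕ∞) (h : m ≤ n) (r : M2) : proj m n h (etaR n r) = etaR m r := by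
  have : (proj m n h).comp (etaR n) = etaR m := by
    apply ringHom_M2_ext <;> simp [etaR_rho, etaR_tau, rho, tau, ta, proj_mk]
  exact DFunLike.congr_fun this r

noncomputable def projR (m n : ℕ∞) (h : m ≤ n) : AR n →ₗ[M2] AR m where
  toFun γ := toAR m (proj m n h ((toAR n).symm γ))
  map_add' x y := by simp
  map_smul' r γ := by
    rw [Algebra.smul_def, Algebra.smul_def, algebraMap_AR, algebraMap_AR, map_mul, map_mul, map_mul,
      RingEquiv.symm_apply_apply, proj_etaR, RingHom.id_apply]

theorem projR_toAR (m n : ℕ∞) (h : m ≤ n) (a : DualA n) :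
    projR m n h (toAR n a) = toAR m (proj m n h a) := rfl

theorem projR_mul (m n : ℕ∞) (h : m ≤ n) (a b : AR n) :
    projR m n h (a * b) = projR m n h a * projR m n h b :=
  map_mul (proj m n h) _ _

theorem projR_self (n : ℕ∞) (γ : AR n) : projR n n le_rfl γ = γ := by
  obtain ⟨a, rfl⟩ := (toAR n).surjective γ
  obtain ⟨p, rfl⟩ := Ideal.Quotient.mk_surjective a
  rfl

noncomputable def Ten.mkLinear {Q : Type} [AddCommGroup Q] [Module M2 Q] (f : Ten n N →+ Q)
    (h : ∀ (r : M2) (γ : AR n) (x : N),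
      f (Ten.tmul n (toAR n (etaL n r) * γ) x) = r • f (Ten.tmul n γ x)) : Ten n N →ₗ[M2] Q where
  toFun := f
  map_add' := map_add f
  map_smul' r z := by
    rw [RingHom.id_apply]
    induction z using Ten.induction with
    | h0 => rw [smul_zero, map_zero, smul_zero]
    | ht γ x => exact h r γ x
    | ha a b iha ihb => rw [smul_add, map_add, iha, ihb, map_add, smul_add]

noncomputable def Ten.lift {Q : Type} [AddCommGroup Q] (g : AR n →+ N →+ Q)
    (h : ∀ (r : M2) (γ : AR n) (x : N), g (toAR n (etaR n r) * γ) x = g γ (r • x)) :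
    Ten n N →+ Q :=
  TensorProduct.liftAddHom g (by
    intro r γ x
    rw [Algebra.smul_def, algebraMap_AR, h])

theorem Ten.lift_tmul {Q : Type} [AddCommGroup Q] (g : AR n →+ N →+ Q)
    (h : ∀ (r : M2) (γ : AR n) (x : N), g (toAR n (etaR n r) * γ) x = g γ (r • x))
    (γ : AR n) (x : N) : Ten.lift n g h (Ten.tmul n γ x) = g γ x := rfl

/-- `π ⊗ f : A(n)^∨ ⊗ N → A(m)^∨ ⊗ Q`, where `π` is the projection. -/
noncomputable def Ten.map (m n : ℕ∞) (h : m ≤ n) (f : N →ₗ[M2] N') : Ten n N →ₗ[M2] Ten m N' :=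
  Ten.mkLinear n
    (TensorProduct.map (projR m n h) f : AR n ⊗[M2] N →ₗ[M2] AR m ⊗[M2] N').toAddMonoidHom (by
      intro r γ x
      change Ten.tmul m (projR m n h (toAR n (etaL n r) * γ)) (f x) =
        Ten.tmul m (toAR m (etaL m r) * projR m n h γ) (f x)
      rw [projR_mul, projR_toAR, proj_etaL])

theorem Ten.map_tmul (m n : ℕ∞) (h : m ≤ n) (f : N →ₗ[M2] N') (γ : AR n) (x : N) :
    Ten.map m n h f (Ten.tmul n γ x) = Ten.tmul m (projR m n h γ) (f x) := rfl

noncomputable def Ten.right (x : N) : DualA n →ₗ[M2] Ten n N where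
  toFun a := Ten.tmul n (toAR n a) x
  map_add' a b := by rw [map_add, Ten.add_tmul]
  map_smul' r a := by
    rw [RingHom.id_apply, Ten.smul_tmul, Algebra.smul_def, algebraMap_A, map_mul]

theorem Ten.right_apply (x : N) (a : DualA n) : Ten.right n x a = Ten.tmul n (toAR n a) x := rfl

noncomputable def Ten.deltaTmul (x : N) : AR n ⊗[M2] DualA n →+ Ten n (Ten n N) :=
  (TensorProduct.map LinearMap.id (Ten.right n x) :
    AR n ⊗[M2] DualA n →ₗ[M2] AR n ⊗[M2] Ten n N).toAddMonoidHom

theorem Ten.deltaTmul_tmul (x : N) (γ : AR n) (a : DualA n) :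
    Ten.deltaTmul n x (γ ⊗ₜ a) = Ten.tmul n γ (Ten.tmul n (toAR n a) x) := rfl

theorem Ten.deltaTmul_add (x y : N) (z : AR n ⊗[M2] DualA n) :
    Ten.deltaTmul n (x + y) z = Ten.deltaTmul n x z + Ten.deltaTmul n y z := by
  induction z using TensorProduct.induction_on with
  | zero => simp
  | tmul γ a => simp only [Ten.deltaTmul_tmul, Ten.tmul_add]
  | add a b iha ihb => rw [map_add, map_add, map_add, iha, ihb]; abel

theorem Ten.deltaTmul_etaR (r : M2) (x : N) (z : AR n ⊗[M2] DualA n) :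
    Ten.deltaTmul n x ((1 ⊗ₜ[M2] etaR n r) * z) = Ten.deltaTmul n (r • x) z := by
  induction z using TensorProduct.induction_on with
  | zero => simp
  | tmul γ a =>
    rw [Algebra.TensorProduct.tmul_mul_tmul, Ten.deltaTmul_tmul, Ten.deltaTmul_tmul, one_mul,
      map_mul, Ten.mul_etaR_tmul]
  | add a b iha ihb => rw [mul_add, map_add, map_add, iha, ihb]

theorem Ten.deltaTmul_etaL (r : M2) (x : N) (z : AR n ⊗[M2] DualA n) :
    Ten.deltaTmul n x ((toAR n (etaL n r) ⊗ₜ[M2] 1) * z) = r • Ten.deltaTmul n x z := by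
  induction z using TensorProduct.induction_on with
  | zero => simp
  | tmul γ a =>
    rw [Algebra.TensorProduct.tmul_mul_tmul, Ten.deltaTmul_tmul, Ten.deltaTmul_tmul, one_mul,
      Ten.smul_tmul]
  | add a b iha ihb => rw [mul_add, map_add, map_add, iha, ihb, smul_add]

noncomputable def coprodR (n : ℕ∞) : AR n →+* AR n ⊗[M2] DualA n :=
  (coprod n n le_rfl).comp ((toAR n).symm : AR n →+* DualA n)

theorem coprodR_toAR (a : DualA n) : coprodR n (toAR n a) = coprod n n le_rfl a := rfl

noncomputable def Ten.deltaAdd : Ten n N →+ Ten n (Ten n N) :=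
  Ten.lift n
    (AddMonoidHom.mk' (fun γ : AR n =>
      AddMonoidHom.mk' (fun x : N => Ten.deltaTmul n x (coprodR n γ))
        (fun x y => Ten.deltaTmul_add n x y _))
      (fun γ γ' => by
        ext x
        simp only [AddMonoidHom.mk'_apply, AddMonoidHom.add_apply, map_add]))
    (fun r γ x => by
      simp only [AddMonoidHom.mk'_apply]
      rw [map_mul, coprodR_toAR, coprod_etaR, Ten.deltaTmul_etaR])

theorem Ten.deltaAdd_tmul (γ : AR n) (x : N) :
    Ten.deltaAdd n (Ten.tmul n γ x) = Ten.deltaTmul n x (coprodR n γ) := rfl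

/-- `Δ ⊗ id : A(n)^∨ ⊗ N → A(n)^∨ ⊗ A(n)^∨ ⊗ N`. -/
noncomputable def Ten.delta : Ten n N →ₗ[M2] Ten n (Ten n N) :=
  Ten.mkLinear n (Ten.deltaAdd n) (fun r γ x => by
    rw [Ten.deltaAdd_tmul, Ten.deltaAdd_tmul, map_mul, coprodR_toAR, coprod_etaL,
      Ten.deltaTmul_etaL])

theorem Ten.delta_tmul (γ : AR n) (x : N) :
    Ten.delta n (Ten.tmul n γ x) = Ten.deltaTmul n x (coprodR n γ) := rfl

/-- `x ↦ 1 ⊗ x`. -/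
noncomputable def Ten.one : N →+ Ten n N :=
  AddMonoidHom.mk' (fun x => Ten.tmul n 1 x) (Ten.tmul_add n 1)

end Ten

theorem add_self_M2 {N : Type} [AddCommGroup N] [Module M2 N] (x : N) : x + x = 0 := by
  have h : (2 : M2) = 0 := two_eq_zero_of_hom MvPolynomial.C
  rw [← two_smul M2 x, h, zero_smul]

noncomputable def projAlg (m n : ℕ∞) (h : m ≤ n) : DualA n →ₐ[M2] DualA m :=
  { proj m n h with commutes' := proj_etaL m n h }

noncomputable def projRAlg (m n : ℕ∞) (h : m ≤ n) : AR n →ₐ[M2] AR m :=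
  { (((toAR m : DualA m ≃+* AR m) : DualA m →+* AR m).comp (proj m n h)).comp
      ((toAR n).symm : AR n →+* DualA n) with
    commutes' := fun r => congrArg (toAR m) (proj_etaR m n h r) }

theorem DualA.ringHom_ext {S : Type} [CommRing S] {f g : DualA n →+* S}
    (h : ∀ i, f (DualA.mk n (MvPolynomial.X i)) = g (DualA.mk n (MvPolynomial.X i))) : f = g := by
  apply Ideal.Quotient.ringHom_ext
  apply MvPolynomial.ringHom_ext'
  · exact RingHom.ext_zmod _ _
  · exact h

theorem coprod_proj (m n : ℕ∞) (h : m ≤ n) (a : DualA n) :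
    coprod m m le_rfl (proj m n h a) =
      Algebra.TensorProduct.map (projRAlg m n h) (projAlg m n h) (coprod n n le_rfl a) := by
  have : (coprod m m le_rfl).comp (proj m n h) =
      ((Algebra.TensorProduct.map (projRAlg m n h) (projAlg m n h) :
        AR n ⊗[M2] DualA n →ₐ[M2] AR m ⊗[M2] DualA m) : AR n ⊗[M2] DualA n →+* AR m ⊗[M2] DualA m).comp
      (coprod n n le_rfl) := by
    have e1 : ∀ i, projRAlg m n h (toAR n (xi n i)) = toAR m (xi m i) := fun _ => rfl
    have e2 : ∀ i, projRAlg m n h (toAR n (ta n i)) = toAR m (ta m i) := fun _ => rfl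
    have e3 : ∀ i, projAlg m n h (xi n i) = xi m i := fun _ => rfl
    have e4 : ∀ i, projAlg m n h (ta n i) = ta m i := fun _ => rfl
    have e5 : projRAlg m n h (toAR n (rho n)) = toAR m (rho m) := rfl
    have e6 : projRAlg m n h (toAR n (tau n)) = toAR m (tau m) := rfl
    apply DualA.ringHom_ext
    intro i
    simp only [RingHom.comp_apply, proj_mk, coprod_mk, RingHom.coe_coe]
    cases i <;>
      simp [coprodPoly, coprodGen, e1, e2, e3, e4, e5, e6]
  exact DFunLike.congr_fun this a

section
variable {N N' : Type} [AddCommGroup N] [Module M2 N] [AddCommGroup N'] [Module M2 N']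

theorem Ten.map_deltaTmul (m n : ℕ∞) (h : m ≤ n) (f : N →ₗ[M2] N') (x : N)
    (z : AR n ⊗[M2] DualA n) : Ten.map m n h (Ten.map m n h f) (Ten.deltaTmul n x z) =
      Ten.deltaTmul m (f x) (Algebra.TensorProduct.map (projRAlg m n h) (projAlg m n h) z) := by
  induction z using TensorProduct.induction_on with
  | zero => simp
  | tmul γ a =>
    rw [Ten.deltaTmul_tmul, Ten.map_tmul, Ten.map_tmul, Algebra.TensorProduct.map_tmul,
      Ten.deltaTmul_tmul, projR_toAR]
    rfl
  | add a b iha ihb => rw [map_add, map_add, iha, ihb, map_add, map_add]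

theorem Ten.delta_map (m n : ℕ∞) (h : m ≤ n) (f : N →ₗ[M2] N') (z : Ten n N) :
    Ten.delta m (Ten.map m n h f z) = Ten.map m n h (Ten.map m n h f) (Ten.delta n z) := by
  induction z using Ten.induction with
  | h0 => simp
  | ht γ x =>
    obtain ⟨a, rfl⟩ := (toAR n).surjective γ
    rw [Ten.map_tmul, Ten.delta_tmul, Ten.delta_tmul, Ten.map_deltaTmul, projR_toAR, coprodR_toAR,
      coprodR_toAR, coprod_proj]
  | ha a b iha ihb => rw [map_add, map_add, map_add, map_add, iha, ihb]
end

/-- A bigraded left module `X` over the coefficients with a coaction `X → A(n)^∨ ⊗ X`: the data from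
which a cobar complex is formed. It is used only for the unit comodule and the Brown-Gitler comodules
below. -/
structure GradedCoaction (n : ℕ∞) where
  X : Type
  [addCommGroup : AddCommGroup X]
  [module : Module M2 X]
  coact : X →ₗ[M2] Ten n X
  piece : ℤ × ℤ → AddSubgroup X

attribute [instance] GradedCoaction.addCommGroup GradedCoaction.module

/-- Bidegrees (topological degree, weight). -/
def degGen : Gen → ℤ × ℤ
  | .rho => (-1, -1)
  | .tau => (0, -1)
  | .xi i => (2 ^ (i + 2) - 2, 2 ^ (i + 1) - 1)
  | .ta i => (2 ^ (i + 1) - 1, 2 ^ i - 1)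

/-- The part of bidegree `c`. -/
noncomputable def DualA.piece (n : ℕ∞) (c : ℤ × ℤ) : AddSubgroup (DualA n) :=
  (MvPolynomial.weightedHomogeneousSubmodule (ZMod 2) degGen c).toAddSubgroup.map
    (DualA.mk n).toAddMonoidHom

/-- The part of bidegree `c` of the coefficients, `|ρ| = (-1,-1)`, `|τ| = (0,-1)`. -/
noncomputable def M2.piece (c : ℤ × ℤ) : AddSubgroup M2 :=
  (MvPolynomial.weightedHomogeneousSubmodule (ZMod 2)
    (![(-1, -1), (0, -1)] : Fin 2 → ℤ × ℤ) c).toAddSubgroup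

/-- The coefficients as a left comodule, `r ↦ η_L(r) ⊗ 1`. -/
noncomputable def unitCoaction (n : ℕ∞) : GradedCoaction n where
  X := M2
  coact := LinearMap.toSpanSingleton M2 (Ten n M2) (Ten.tmul n 1 1)
  piece := M2.piece

/-- The cobar complex in degree `s`: `A(n)^∨ ⊗ ⋯ ⊗ A(n)^∨ ⊗ N` with `s` factors `A(n)^∨`. -/
noncomputable def Cobar {n : ℕ∞} (N : GradedCoaction n) : ℕ → ModuleCat.{0} M2
  | 0 => ModuleCat.of M2 N.X
  | s + 1 => ModuleCat.of M2 (Ten n (Cobar N s))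

section Cobar
variable {m n : ℕ∞} {M : GradedCoaction m} {N : GradedCoaction n}

/-- The element `γ ⊗ x`. -/
noncomputable def Cobar.tmul (N : GradedCoaction n) {s : ℕ} (γ : AR n) (x : Cobar N s) :
    Cobar N (s + 1) :=
  Ten.tmul n γ x

theorem Cobar.induction {s : ℕ} {P : Cobar N (s + 1) → Prop} (h0 : P 0)
    (ht : ∀ γ x, P (Cobar.tmul N γ x)) (ha : ∀ a b, P a → P b → P (a + b))
    (z : Cobar N (s + 1)) : P z :=
  Ten.induction n h0 ht ha z

noncomputable def Cobar.one (N : GradedCoaction n) (s : ℕ) : Cobar N s →+ Cobar N (s + 1) :=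
  (Ten.one n : Cobar N s →+ Ten n (Cobar N s))

theorem Cobar.one_apply {s : ℕ} (x : Cobar N s) : Cobar.one N s x = Cobar.tmul N 1 x := rfl

noncomputable def Cobar.map (h : m ≤ n) {s t : ℕ} (f : Cobar N s →ₗ[M2] Cobar M t) :
    Cobar N (s + 1) →ₗ[M2] Cobar M (t + 1) :=
  Ten.map m n h f

theorem Cobar.map_tmul (h : m ≤ n) {s t : ℕ} (f : Cobar N s →ₗ[M2] Cobar M t) (γ : AR n)
    (x : Cobar N s) :
    Cobar.map h f (Cobar.tmul N γ x) = Cobar.tmul M (projR m n h γ) (f x) := rfl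

noncomputable def Cobar.delta (N : GradedCoaction n) (s : ℕ) :
    Cobar N (s + 1) →ₗ[M2] Cobar N (s + 2) :=
  (Ten.delta n : Ten n (Cobar N s) →ₗ[M2] Ten n (Ten n (Cobar N s)))

theorem Cobar.delta_map (h : m ≤ n) {s t : ℕ} (f : Cobar N s →ₗ[M2] Cobar M t)
    (z : Cobar N (s + 1)) :
    Cobar.delta M t (Cobar.map h f z) = Cobar.map h (Cobar.map h f) (Cobar.delta N s z) :=
  Ten.delta_map m n h f z

/-- The sum of all cofaces of the cobar complex but the first one: the coaction in degree `0`, and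
`γ ⊗ x ↦ Δ γ ⊗ x + γ ⊗ inner x` in positive degrees. -/
noncomputable def Cobar.inner (N : GradedCoaction n) : ∀ s : ℕ, Cobar N s →ₗ[M2] Cobar N (s + 1)
  | 0 => N.coact
  | s + 1 => Cobar.delta N s + Cobar.map le_rfl (Cobar.inner N s)

/-- The cobar differential (in characteristic two): `x ↦ 1 ⊗ x + inner x`. -/
noncomputable def Cobar.d (N : GradedCoaction n) (s : ℕ) : Cobar N s →+ Cobar N (s + 1) :=
  Cobar.one N s + (Cobar.inner N s).toAddMonoidHom

theorem Cobar.d_apply {s : ℕ} (x : Cobar N s) :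
    Cobar.d N s x = Cobar.one N s x + Cobar.inner N s x := rfl

theorem Cobar.inner_tmul {s : ℕ} (γ : AR n) (x : Cobar N s) :
    Cobar.inner N (s + 1) (Cobar.tmul N γ x) =
      Cobar.delta N s (Cobar.tmul N γ x) + Cobar.tmul N γ (Cobar.inner N s x) := by
  change _ + Cobar.map le_rfl (Cobar.inner N s) (Cobar.tmul N γ x) = _
  rw [Cobar.map_tmul, projR_self]

theorem Cobar.tmul_add {s : ℕ} (γ : AR n) (x y : Cobar N s) :
    Cobar.tmul N γ (x + y) = Cobar.tmul N γ x + Cobar.tmul N γ y := Ten.tmul_add n γ x y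

/-- The juxtaposition product of the cobar complexes, `(γ₁ ⊗ ⋯ ⊗ γ_s ⊗ r) · y = γ₁ ⊗ ⋯ ⊗ γ_s ⊗ r y`;
`Cobar.mul N y s x` is `x · y`. -/
noncomputable def Cobar.mul (N : GradedCoaction n) {t : ℕ} (y : Cobar N t) :
    ∀ s : ℕ, Cobar (unitCoaction n) s →ₗ[M2] Cobar N (t + s)
  | 0 => LinearMap.toSpanSingleton M2 (Cobar N t) y
  | s + 1 => Cobar.map le_rfl (Cobar.mul N y s)

theorem Cobar.mul_tmul {s t : ℕ} (y : Cobar N t) (γ : AR n) (x : Cobar (unitCoaction n) s) :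
    Cobar.mul N y (s + 1) (Cobar.tmul _ γ x) = Cobar.tmul N γ (Cobar.mul N y s x) := by
  change Cobar.map le_rfl (Cobar.mul N y s) (Cobar.tmul _ γ x) = _
  rw [Cobar.map_tmul, projR_self]

theorem Cobar.mul_add_left {t : ℕ} (y y' : Cobar N t) (s : ℕ) (x : Cobar (unitCoaction n) s) :
    Cobar.mul N (y + y') s x = Cobar.mul N y s x + Cobar.mul N y' s x := by
  induction s with
  | zero => exact smul_add (M := M2) (A := Cobar N t) x y y'
  | succ s ih =>
    induction x using Cobar.induction with
    | h0 => rw [map_zero, map_zero, map_zero, add_zero]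
    | ht γ x => rw [Cobar.mul_tmul, Cobar.mul_tmul, Cobar.mul_tmul, ih, Cobar.tmul_add]
    | ha a b iha ihb => rw [map_add, map_add, map_add, iha, ihb]; abel

noncomputable def Cobar.cast (N : GradedCoaction n) {a b : ℕ} (h : a = b) : Cobar N a →+ Cobar N b :=
  h ▸ AddMonoidHom.id _

theorem Cobar.cast_rfl {a : ℕ} (x : Cobar N a) : Cobar.cast N (rfl : a = a) x = x := rfl

theorem Cobar.cast_tmul {a b : ℕ} (h : a = b) (h' : a + 1 = b + 1) (γ : AR n) (x : Cobar N a) :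
    Cobar.cast N h' (Cobar.tmul N γ x) = Cobar.tmul N γ (Cobar.cast N h x) := by
  subst h; rfl

theorem Cobar.inner_mul {s t : ℕ} (z : Cobar N t) (x : Cobar (unitCoaction n) s)
    (h : t + s + 1 = t + 1 + s) :
    Cobar.cast N h (Cobar.inner N (t + s) (Cobar.mul N z s x)) =
      Cobar.cast N h (Cobar.mul N z (s + 1) (Cobar.inner _ s x)) +
        Cobar.mul N (Cobar.d N t z) s x := by
  induction s with
  | zero =>
    change M2 at x
    let x0 : Cobar (unitCoaction n) 0 := (1 : M2)
    have h1 : Cobar.mul N z 1 (Cobar.tmul (unitCoaction n) 1 x0) = Cobar.one N t z :=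
      (Cobar.mul_tmul z 1 x0).trans (congrArg (Cobar.tmul N 1) (one_smul M2 z))
    have h2 : Cobar.mul N z 1 (Cobar.inner (unitCoaction n) 0 x) = x • Cobar.one N t z := by
      rw [← h1]
      exact map_smul (Cobar.mul N z 1) x (Cobar.tmul (unitCoaction n) 1 x0)
    have h3 : Cobar.inner N t (x • z) = x • Cobar.inner N t z := map_smul _ _ _
    have h4 : x • (Cobar.d N t z) = x • Cobar.one N t z + x • Cobar.inner N t z :=
      smul_add x _ _
    have h5 : x • Cobar.inner N t z = x • Cobar.one N t z +
        (x • Cobar.one N t z + x • Cobar.inner N t z) := by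
      rw [← add_assoc, add_self_M2, zero_add]
    exact h3.trans (h5.trans (congrArg₂ (· + ·) h2.symm h4.symm))
  | succ s ih =>
    induction x using Cobar.induction with
    | h0 => simp only [map_zero, add_zero]
    | ht γ x =>
      have e : Cobar.delta N (t + s) (Cobar.tmul N γ (Cobar.mul N z s x)) =
          Cobar.mul N z (s + 2) (Cobar.delta _ s (Cobar.tmul _ γ x)) := by
        have := Cobar.delta_map (le_refl n) (Cobar.mul N z s) (Cobar.tmul _ γ x)
        rw [Cobar.map_tmul, projR_self] at this
        exact this
      have h1 : t + s + 1 = t + 1 + s := by omega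
      have h3 : Cobar.cast N h (Cobar.tmul N γ (Cobar.inner N (t + s) (Cobar.mul N z s x))) =
          Cobar.cast N h (Cobar.mul N z (s + 2) (Cobar.tmul _ γ (Cobar.inner _ s x))) +
            Cobar.tmul N γ (Cobar.mul N (Cobar.d N t z) s x) := by
        rw [Cobar.mul_tmul]
        refine (Cobar.cast_tmul h1 h γ _).trans ?_
        rw [ih x h1, Cobar.tmul_add]
        exact congrArg₂ (· + ·) (Cobar.cast_tmul h1 h γ _).symm rfl
      have h4 : Cobar.inner N (t + (s + 1)) (Cobar.mul N z (s + 1) (Cobar.tmul _ γ x)) =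
          Cobar.mul N z (s + 2) (Cobar.delta _ s (Cobar.tmul _ γ x)) +
            Cobar.tmul N γ (Cobar.inner N (t + s) (Cobar.mul N z s x)) := by
        rw [← e, Cobar.mul_tmul]
        exact Cobar.inner_tmul (N := N) (s := t + s) γ (Cobar.mul N z s x)
      rw [h4, map_add, h3, Cobar.inner_tmul, map_add, map_add, Cobar.mul_tmul (Cobar.d N t z)]
      exact (add_assoc _ _ _).symm
    | ha a b iha ihb =>
      simp only [map_add, iha, ihb]
      abel

theorem Cobar.d_mul {s t : ℕ} (z : Cobar N t) (x : Cobar (unitCoaction n) s)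
    (h : t + s + 1 = t + 1 + s) :
    Cobar.cast N h (Cobar.d N (t + s) (Cobar.mul N z s x)) =
      Cobar.cast N h (Cobar.mul N z (s + 1) (Cobar.d _ s x)) +
        Cobar.mul N (Cobar.d N t z) s x := by
  have h1 : Cobar.mul N z (s + 1) (Cobar.one _ s x) = Cobar.one N (t + s) (Cobar.mul N z s x) :=
    Cobar.mul_tmul z 1 x
  rw [Cobar.d_apply, Cobar.d_apply, map_add, map_add, map_add, h1, Cobar.inner_mul z x h]
  exact (add_assoc _ _ _).symm

theorem Cobar.cast_eq_zero {a b : ℕ} (h : a = b) {x : Cobar N a} (hx : Cobar.cast N h x = 0) :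
    x = 0 := by
  subst h; exact hx

theorem Cobar.cast_cast {a b : ℕ} (h : a = b) (x : Cobar N a) :
    Cobar.cast N h.symm (Cobar.cast N h x) = x := by
  subst h; rfl

/-- Cocycles. -/
noncomputable def Cobar.Z (N : GradedCoaction n) (s : ℕ) : AddSubgroup (Cobar N s) :=
  (Cobar.d N s).ker

/-- Coboundaries. -/
noncomputable def Cobar.B (N : GradedCoaction n) : ∀ s : ℕ, AddSubgroup (Cobar N s)
  | 0 => ⊥
  | s + 1 => (Cobar.d N s).range

theorem Cobar.mem_Z {s : ℕ} {x : Cobar N s} : x ∈ Cobar.Z N s ↔ Cobar.d N s x = 0 := Iff.rfl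

theorem Cobar.cast_mem_B {a b : ℕ} (h : a = b) {x : Cobar N a} (hx : x ∈ Cobar.B N a) :
    Cobar.cast N h x ∈ Cobar.B N b := by
  subst h; exact hx

theorem Cobar.d_mul_of_Z {s t : ℕ} {z : Cobar N t} (hz : z ∈ Cobar.Z N t)
    (x : Cobar (unitCoaction n) s) :
    Cobar.d N (t + s) (Cobar.mul N z s x) = Cobar.mul N z (s + 1) (Cobar.d _ s x) := by
  have h : t + s + 1 = t + 1 + s := by omega
  have h1 := Cobar.d_mul z x h
  have h0 : ∀ s x, Cobar.mul N (0 : Cobar N (t + 1)) s x = 0 := by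
    intro s x
    have := Cobar.mul_add_left (0 : Cobar N (t + 1)) 0 s x
    rw [add_zero] at this
    exact left_eq_add.mp this
  rw [Cobar.mem_Z.mp hz, h0, add_zero] at h1
  rw [← Cobar.cast_cast h (Cobar.d N (t + s) (Cobar.mul N z s x)), h1]
  exact Cobar.cast_cast h _

theorem Cobar.mul_mem_Z {s t : ℕ} {y : Cobar N t} (hy : y ∈ Cobar.Z N t)
    {x : Cobar (unitCoaction n) s} (hx : x ∈ Cobar.Z (unitCoaction n) s) :
    Cobar.mul N y s x ∈ Cobar.Z N (t + s) := by
  rw [Cobar.mem_Z, Cobar.d_mul_of_Z hy, Cobar.mem_Z.mp hx, map_zero]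

theorem Cobar.mul_mem_B_left {s t : ℕ} {y : Cobar N t} (hy : y ∈ Cobar.Z N t)
    {x : Cobar (unitCoaction n) s} (hx : x ∈ Cobar.B (unitCoaction n) s) :
    Cobar.mul N y s x ∈ Cobar.B N (t + s) := by
  cases s with
  | zero =>
    have hx' : x = 0 := hx
    rw [hx', map_zero]
    exact zero_mem _
  | succ s =>
    obtain ⟨w, rfl⟩ := hx
    exact ⟨Cobar.mul N y s w, Cobar.d_mul_of_Z hy w⟩

theorem Cobar.mul_mem_B_right {s t : ℕ} {y : Cobar N t} (hy : y ∈ Cobar.B N t)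
    {x : Cobar (unitCoaction n) s} (hx : x ∈ Cobar.Z (unitCoaction n) s) :
    Cobar.mul N y s x ∈ Cobar.B N (t + s) := by
  cases t with
  | zero =>
    have hy' : y = 0 := hy
    have := Cobar.mul_add_left (0 : Cobar N 0) 0 s x
    rw [add_zero] at this
    rw [hy', left_eq_add.mp this]
    exact zero_mem _
  | succ t =>
    obtain ⟨w, rfl⟩ := hy
    have h : t + s + 1 = t + 1 + s := by omega
    have h1 := Cobar.d_mul w x h
    rw [Cobar.mem_Z.mp hx, map_zero, map_zero, zero_add] at h1
    rw [← h1]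
    exact Cobar.cast_mem_B h ⟨_, rfl⟩

/-- `Ext^s_{A(n)^∨}(N)`, the cohomology of the cobar complex. -/
abbrev Ext (N : GradedCoaction n) (s : ℕ) : Type :=
  Cobar.Z N s ⧸ (Cobar.B N s).addSubgroupOf (Cobar.Z N s)

/-- The class of a cocycle. -/
noncomputable def Ext.mk (N : GradedCoaction n) (s : ℕ) : Cobar.Z N s →+ Ext N s :=
  QuotientAddGroup.mk' _

noncomputable def Cobar.mulZ (N : GradedCoaction n) (s t : ℕ) :
    Cobar.Z (unitCoaction n) s →+ Cobar.Z N t →+ Cobar.Z N (t + s) :=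
  AddMonoidHom.mk' (fun x => AddMonoidHom.mk'
      (fun y => ⟨Cobar.mul N y.1 s x.1, Cobar.mul_mem_Z y.2 x.2⟩)
      (fun y y' => Subtype.ext (Cobar.mul_add_left y.1 y'.1 s x.1)))
    (fun x x' => by
      ext y
      exact map_add (Cobar.mul N y.1 s) x.1 x'.1)

/-- The product `Ext^s(M2) × Ext^t(N) → Ext^{t+s}(N)`. For `N = M2` it is the Yoneda ring structure,
in general the module structure. -/
noncomputable def Ext.mul (N : GradedCoaction n) (s t : ℕ) :
    Ext (unitCoaction n) s →+ Ext N t →+ Ext N (t + s) :=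
  QuotientAddGroup.lift _
    (AddMonoidHom.mk' (fun x => QuotientAddGroup.lift _
        ((Ext.mk N (t + s)).comp (Cobar.mulZ N s t x)) (fun y hy =>
          (QuotientAddGroup.eq_zero_iff _).mpr (Cobar.mul_mem_B_right hy x.2)))
      (fun x x' => by
        ext y
        exact congrArg (Ext.mk N (t + s)) (DFunLike.congr_fun (map_add (Cobar.mulZ N s t) x x') y)))
    (fun x hx => by
      ext y
      exact (QuotientAddGroup.eq_zero_iff _).mpr (Cobar.mul_mem_B_left y.2 hx))

theorem Ext.mul_mk {s t : ℕ} (x : Cobar.Z (unitCoaction n) s) (y : Cobar.Z N t) :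
    Ext.mul N s t (Ext.mk _ s x) (Ext.mk N t y) = Ext.mk N (t + s) (Cobar.mulZ N s t x y) := rfl

noncomputable def Cobar.res (m n : ℕ∞) (h : m ≤ n) :
    ∀ s : ℕ, Cobar (unitCoaction n) s →ₗ[M2] Cobar (unitCoaction m) s
  | 0 => (LinearMap.id : M2 →ₗ[M2] M2)
  | s + 1 => Cobar.map h (Cobar.res m n h s)

theorem Cobar.res_tmul (h : m ≤ n) {s : ℕ} (γ : AR n) (x : Cobar (unitCoaction n) s) :
    Cobar.res m n h (s + 1) (Cobar.tmul _ γ x) =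
      Cobar.tmul _ (projR m n h γ) (Cobar.res m n h s x) := rfl

theorem projR_one (h : m ≤ n) : projR m n h 1 = 1 := map_one (proj m n h)

theorem Cobar.inner_res (h : m ≤ n) {s : ℕ} (x : Cobar (unitCoaction n) s) :
    Cobar.inner _ s (Cobar.res m n h s x) = Cobar.res m n h (s + 1) (Cobar.inner _ s x) := by
  induction s with
  | zero =>
    let x0 : Cobar (unitCoaction n) 0 := (1 : M2)
    let x1 : Cobar (unitCoaction m) 0 := (1 : M2)
    have h1 : Cobar.res m n h 1 (Cobar.tmul (unitCoaction n) 1 x0) =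
        Cobar.tmul (unitCoaction m) 1 x1 := by
      rw [Cobar.res_tmul, projR_one]; rfl
    change M2 at x
    exact (congrArg (fun w : Cobar (unitCoaction m) 1 => x • w) h1.symm).trans
      (map_smul (Cobar.res m n h 1) x (Cobar.tmul (unitCoaction n) 1 x0)).symm
  | succ s ih =>
    induction x using Cobar.induction with
    | h0 => simp only [map_zero]
    | ht γ x =>
      rw [Cobar.inner_tmul, map_add, Cobar.res_tmul, Cobar.inner_tmul, Cobar.res_tmul, ih]
      congr 1
      exact Cobar.delta_map h (Cobar.res m n h s) (Cobar.tmul _ γ x)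
    | ha a b iha ihb => rw [map_add, map_add, iha, ihb, map_add, map_add]

theorem Cobar.d_res (h : m ≤ n) {s : ℕ} (x : Cobar (unitCoaction n) s) :
    Cobar.d _ s (Cobar.res m n h s x) = Cobar.res m n h (s + 1) (Cobar.d _ s x) := by
  rw [Cobar.d_apply, Cobar.d_apply, map_add, Cobar.inner_res, Cobar.one_apply, Cobar.one_apply,
    Cobar.res_tmul, projR_one]

/-- Restriction of `Ext(M2)` along the projection `A(n)^∨ → A(m)^∨`. -/
noncomputable def Ext.res (m n : ℕ∞) (h : m ≤ n) (s : ℕ) :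
    Ext (unitCoaction n) s →+ Ext (unitCoaction m) s :=
  QuotientAddGroup.map _ _
    (AddMonoidHom.mk' (fun x : Cobar.Z (unitCoaction n) s =>
        (⟨Cobar.res m n h s x.1, by
          rw [Cobar.mem_Z, Cobar.d_res, Cobar.mem_Z.mp x.2, map_zero]⟩ :
            Cobar.Z (unitCoaction m) s))
      (fun x y => Subtype.ext (map_add (Cobar.res m n h s) x.1 y.1)))
    (by
      rintro ⟨x, hxZ⟩ hx
      change Cobar.res m n h s x ∈ Cobar.B _ s
      replace hx : x ∈ Cobar.B _ s := hx
      cases s with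
      | zero =>
        have hx' : x = 0 := hx
        rw [hx', map_zero]
        exact zero_mem _
      | succ s =>
        obtain ⟨w, rfl⟩ := hx
        exact ⟨Cobar.res m n h s w, Cobar.d_res h w⟩)

/-- The part of bidegree `c` of the cobar complex. -/
noncomputable def Cobar.piece (N : GradedCoaction n) :
    ∀ s : ℕ, ℤ × ℤ → AddSubgroup (Cobar N s)
  | 0, c => N.piece c
  | s + 1, c => AddSubgroup.closure {z | ∃ (a b : ℤ × ℤ) (γ : DualA n) (x : Cobar N s),
      γ ∈ DualA.piece n a ∧ x ∈ Cobar.piece N s b ∧ a + b = c ∧ z = Cobar.tmul N (toAR n γ) x}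

/-- The trigraded part `Ext^{s,f,w}`: stem `s`, Adams filtration `f`, weight `w`. The internal
topological degree is `s + f`. -/
noncomputable def Ext.piece (N : GradedCoaction n) (s : ℤ) (f : ℕ) (w : ℤ) :
    AddSubgroup (Ext N f) :=
  ((Cobar.piece N f (s + f, w)).addSubgroupOf (Cobar.Z N f)).map (Ext.mk N f)

end Cobar

section BrownGitler

/-- The algebra generators of `(A // A(n))^∨`: `ξ_i ^ (2 ^ (n+1-i))` for `i ≥ 1` (written with `i + 1`)
and `τ_i` for `i ≥ n+1`. -/
noncomputable def quotGen (n : ℕ) : ℕ ⊕ ℕ → DualA ⊤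
  | .inl i => xi ⊤ (i + 1) ^ 2 ^ (n - i)
  | .inr i => ta ⊤ (n + 1 + i)

/-- The Mahowald weights of these generators, from `wt ξ_i = wt τ_i = 2 ^ i`. -/
def quotWt (n : ℕ) : ℕ ⊕ ℕ → ℕ
  | .inl i => 2 ^ (i + 1) * 2 ^ (n - i)
  | .inr i => 2 ^ (n + 1 + i)

/-- The subalgebra `(A // A(n))^∨` of the dual Steenrod algebra. -/
noncomputable def steenrodQuot (n : ℕ) : Subalgebra M2 (DualA ⊤) :=
  Algebra.adjoin M2 (Set.range (quotGen n))

/-- The span, over the coefficients, of the monomials of weight at most `d` in `(A // A(n))^∨`. -/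
noncomputable def wtLE (n d : ℕ) : Submodule M2 (DualA ⊤) :=
  Submodule.span M2 {x | ∃ e : (ℕ ⊕ ℕ) →₀ ℕ,
    (e.sum fun g j => j * quotWt n g) ≤ d ∧ x = e.prod fun g j => quotGen n g ^ j}

/-- The Brown-Gitler comodule `B_n(k)`: the part of `(A // A(n))^∨` of weight at most `2 ^ (n+1) k`. -/
noncomputable def brownGitler (n k : ℕ) : Submodule M2 (DualA ⊤) := wtLE n (2 ^ (n + 1) * k)

theorem brownGitler_le (n k : ℕ) :
    brownGitler n k ≤ Subalgebra.toSubmodule (steenrodQuot n) := by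
  refine Submodule.span_le.mpr ?_
  rintro _ ⟨e, _, rfl⟩
  exact Subalgebra.prod_mem _ fun g _ =>
    Subalgebra.pow_mem _ (Algebra.subset_adjoin (Set.mem_range_self g)) _

/-- The coaction of `A(0)^∨` on the dual Steenrod algebra: the coproduct followed by the projection. -/
noncomputable def coactA : DualA ⊤ →ₗ[M2] Ten 0 (DualA ⊤) where
  toFun a := (coprod 0 ⊤ le_top a : AR 0 ⊗[M2] DualA ⊤)
  map_add' a b := map_add (coprod 0 ⊤ le_top) a b
  map_smul' r a := by
    rw [Algebra.smul_def, algebraMap_A, map_mul, coprod_etaL, RingHom.id_apply]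
    generalize coprod 0 ⊤ le_top a = z
    induction z using TensorProduct.induction_on with
    | zero => rw [mul_zero]; exact (smul_zero (A := Ten 0 (DualA ⊤)) r).symm
    | tmul γ a => rw [Algebra.TensorProduct.tmul_mul_tmul, one_mul]; rfl
    | add a b iha ihb =>
      rw [mul_add, iha, ihb]
      exact (smul_add (A := Ten 0 (DualA ⊤)) r _ _).symm

theorem xi0_eq_zero (i : ℕ) : xi 0 (i + 1) = 0 := by
  have h := xi_pow_eq_zero 0 (i + 1) 0 (by omega) (by omega)
  rw [pow_zero, pow_one] at h
  exact h

theorem ta0_eq_zero (i : ℕ) : ta 0 (i + 1) = 0 := by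
  exact ta_eq_zero 0 (i + 1) (by omega)

theorem coprod0_xi (k : ℕ) : coprod 0 ⊤ le_top (xi ⊤ k) = 1 ⊗ₜ[M2] xi ⊤ k := by
  rw [xi, coprod_mk, coprodPoly_xi]
  rw [Finset.sum_eq_single (0, k)]
  · rw [xi_zero, map_one, pow_zero, pow_one]; rfl
  · rintro ⟨i, j⟩ hp hne
    rw [Finset.HasAntidiagonal.mem_antidiagonal] at hp
    cases i with
    | zero => exact absurd (by simpa using hp) (by simpa using hne)
    | succ i => rw [xi0_eq_zero, map_zero, TensorProduct.zero_tmul]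
  · simp

theorem coprod0_ta (k : ℕ) : coprod 0 ⊤ le_top (ta ⊤ k) =
    toAR 0 (ta 0 0) ⊗ₜ[M2] xi ⊤ k + 1 ⊗ₜ[M2] ta ⊤ k := by
  rw [ta, coprod_mk, coprodPoly_ta]
  rw [Finset.sum_eq_single (0, k)]
  · simp [ta]
  · rintro ⟨i, j⟩ hp hne
    rw [Finset.HasAntidiagonal.mem_antidiagonal] at hp
    cases i with
    | zero => exact absurd (by simpa using hp) (by simpa using hne)
    | succ i => rw [ta0_eq_zero, map_zero, TensorProduct.zero_tmul]
  · simp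

/-- An auxiliary map, used to show that `A(0)^∨` is free of rank two along the right unit. -/
noncomputable def dualNumberGen : Gen → DualNumber M2
  | .rho => algebraMap M2 _ (MvPolynomial.X 0)
  | .tau => algebraMap M2 _ (MvPolynomial.X 1) + algebraMap M2 _ (MvPolynomial.X 0) * DualNumber.eps
  | .xi _ => 0
  | .ta 0 => DualNumber.eps
  | .ta (_ + 1) => 0

noncomputable def toDualNumber : DualA 0 →+* DualNumber M2 :=
  Ideal.Quotient.lift _ (MvPolynomial.eval₂Hom
      ((algebraMap M2 (DualNumber M2)).comp MvPolynomial.C) dualNumberGen) (by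
    intro a ha
    refine (Ideal.span_le (I := RingHom.ker (MvPolynomial.eval₂Hom
      ((algebraMap M2 (DualNumber M2)).comp MvPolynomial.C) dualNumberGen))).mpr ?_ ha
    rintro p ((⟨i, rfl⟩ | ⟨N, i, hN, hi, rfl⟩) | ⟨N, i, hN, hi, rfl⟩)
    · rcases i with _ | i <;>
      simp [taPoly, xiPoly, dualNumberGen, pow_two]
    · obtain ⟨i, rfl⟩ := Nat.exists_eq_add_of_le' hi
      simp [xiPoly, dualNumberGen]
    · obtain ⟨i, rfl⟩ := Nat.exists_eq_add_of_le' (le_trans (Nat.le_add_left 1 N) hi)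
      simp [taPoly, dualNumberGen])

theorem toDualNumber_mk (p : Poly) : toDualNumber (DualA.mk 0 p) = MvPolynomial.eval₂Hom
      ((algebraMap M2 (DualNumber M2)).comp MvPolynomial.C) dualNumberGen p := rfl

theorem toDualNumber_etaR (r : M2) : toDualNumber (etaR 0 r) = algebraMap M2 _ r := by
  have : toDualNumber.comp (etaR 0) = algebraMap M2 (DualNumber M2) := by
    have h2 : (2 : DualNumber M2) = 0 :=
      two_eq_zero_of_hom ((algebraMap M2 _).comp MvPolynomial.C)
    apply ringHom_M2_ext
    · rw [RingHom.comp_apply, etaR_rho]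
      simp [rho, toDualNumber_mk, dualNumberGen]
    · rw [RingHom.comp_apply, etaR_tau]
      simp only [rho, tau, ta, taPoly, map_add, map_mul, toDualNumber_mk, MvPolynomial.coe_eval₂Hom,
        MvPolynomial.eval₂_X, dualNumberGen]
      linear_combination (algebraMap M2 (DualNumber M2) (MvPolynomial.X 0) * DualNumber.eps) * h2
  exact DFunLike.congr_fun this r

noncomputable def toDualNumberAlg : AR 0 →ₐ[M2] DualNumber M2 :=
  { toDualNumber.comp ((toAR 0).symm : AR 0 →+* DualA 0) with
    commutes' := toDualNumber_etaR }

theorem ta00_sq : toAR 0 (ta 0 0) * toAR 0 (ta 0 0) = 0 := by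
  rw [← map_mul, ← pow_two, ta_sq, xi0_eq_zero, ta0_eq_zero]; simp

noncomputable def ofDualNumberAlg : DualNumber M2 →ₐ[M2] AR 0 :=
  DualNumber.lift ⟨(Algebra.ofId M2 (AR 0), toAR 0 (ta 0 0)), ta00_sq,
    fun _ => mul_comm _ _⟩

theorem ofDualNumber_toDualNumber (γ : AR 0) : ofDualNumberAlg (toDualNumberAlg γ) = γ := by
  have key : (((toAR 0).symm : AR 0 →+* DualA 0).comp ((ofDualNumberAlg : DualNumber M2 →+* AR 0))).comp
      toDualNumber = RingHom.id (DualA 0) := by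
    have h0 : (toAR 0).symm (ofDualNumberAlg DualNumber.eps) = ta 0 0 := by
      rw [ofDualNumberAlg, DualNumber.lift_apply_eps, RingEquiv.symm_apply_apply]
    have h1 : ∀ r, (toAR 0).symm (ofDualNumberAlg (algebraMap M2 _ r)) = etaR 0 r := by
      intro r
      rw [AlgHom.commutes, algebraMap_AR, RingEquiv.symm_apply_apply]
    have h2 : (2 : DualA 0) = 0 := DualA.two_eq_zero 0
    apply DualA.ringHom_ext
    intro i
    simp only [RingHom.comp_apply, toDualNumber_mk, MvPolynomial.coe_eval₂Hom,
      MvPolynomial.eval₂_X, RingHom.id_apply, RingHom.coe_coe]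
    rcases i with _ | _ | i | i
    · simp only [dualNumberGen, h1, etaR_rho]; rfl
    · simp only [dualNumberGen, map_add, map_mul, h1, h0, etaR_rho, etaR_tau]
      have : DualA.mk 0 (MvPolynomial.X Gen.tau) = tau 0 := rfl
      rw [this]
      linear_combination (rho 0 * ta 0 0) * h2
    · simp only [dualNumberGen, map_zero]
      exact (xi0_eq_zero i).symm
    · rcases i with _ | i
      · simp only [dualNumberGen, h0]; rfl
      · simp only [dualNumberGen, map_zero]
        exact (ta0_eq_zero i).symm
  exact congrArg (toAR 0) (DFunLike.congr_fun key ((toAR 0).symm γ))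

theorem toDualNumber_ofDualNumber (z : DualNumber M2) :
    toDualNumberAlg (ofDualNumberAlg z) = z := by
  have : toDualNumberAlg.comp ofDualNumberAlg = AlgHom.id M2 (DualNumber M2) := by
    apply DualNumber.algHom_ext
    change toDualNumberAlg (ofDualNumberAlg DualNumber.eps) = DualNumber.eps
    rw [ofDualNumberAlg, DualNumber.lift_apply_eps]
    change toDualNumber (DualA.mk 0 (taPoly 0)) = _
    simp [toDualNumber_mk, taPoly, dualNumberGen]
  exact DFunLike.congr_fun this z

noncomputable def dualNumberEquiv : AR 0 ≃ₐ[M2] DualNumber M2 :=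
  AlgEquiv.ofAlgHom toDualNumberAlg ofDualNumberAlg
    (AlgHom.ext toDualNumber_ofDualNumber) (AlgHom.ext ofDualNumber_toDualNumber)

instance : Module.Flat M2 (AR 0) :=
  haveI : Module.Flat M2 (DualNumber M2) := inferInstanceAs (Module.Flat M2 (M2 × M2))
  Module.Flat.of_linearEquiv dualNumberEquiv.toLinearEquiv

theorem Ten.map_injective {N N' : Type} [AddCommGroup N] [Module M2 N] [AddCommGroup N']
    [Module M2 N'] (f : N →ₗ[M2] N') (hf : Function.Injective f) :
    Function.Injective (Ten.map 0 0 le_rfl f) := by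
  have h := Module.Flat.lTensor_preserves_injective_linearMap (M := AR 0) f hf
  intro x y hxy
  apply h
  have e : projR 0 0 le_rfl = LinearMap.id := LinearMap.ext (projR_self 0)
  change TensorProduct.map (projR 0 0 le_rfl) f x = TensorProduct.map (projR 0 0 le_rfl) f y at hxy
  rwa [e] at hxy

theorem wtLE_mul {n d d' : ℕ} {x y : DualA ⊤} (hx : x ∈ wtLE n d) (hy : y ∈ wtLE n d') :
    x * y ∈ wtLE n (d + d') := by
  have : wtLE n d * wtLE n d' ≤ wtLE n (d + d') := by
    unfold wtLE
    rw [Submodule.span_mul_span]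
    refine Submodule.span_mono ?_
    rintro _ ⟨_, ⟨e, he, rfl⟩, _, ⟨e', he', rfl⟩, rfl⟩
    refine ⟨e + e', ?_, ?_⟩
    · rw [Finsupp.sum_add_index' (by simp) (by intros; ring)]
      exact add_le_add he he'
    · exact (Finsupp.prod_add_index' (by simp) (by intros; rw [pow_add])).symm
  exact this (Submodule.mul_mem_mul hx hy)

/-- The image of `A(0) ⊗ N` in `A(0) ⊗ A`, for `N` the part of weight at most `d`. -/
noncomputable def tenWtLE (n d : ℕ) : Submodule M2 (Ten 0 (DualA ⊤)) :=
  LinearMap.range (Ten.map 0 0 le_rfl (wtLE n d).subtype)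

theorem tmul_mem_tenWtLE {n d : ℕ} (γ : AR 0) {x : DualA ⊤} (hx : x ∈ wtLE n d) :
    Ten.tmul 0 γ x ∈ tenWtLE n d :=
  ⟨Ten.tmul 0 γ ⟨x, hx⟩, by rw [Ten.map_tmul, projR_self]; rfl⟩

theorem tenWtLE_induction {n d : ℕ} {P : Ten 0 (DualA ⊤) → Prop} (h0 : P 0)
    (ht : ∀ γ, ∀ x ∈ wtLE n d, P (Ten.tmul 0 γ x)) (ha : ∀ a b, P a → P b → P (a + b))
    {z : Ten 0 (DualA ⊤)} (hz : z ∈ tenWtLE n d) : P z := by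
  obtain ⟨z, rfl⟩ := hz
  induction z using Ten.induction with
  | h0 => rw [map_zero]; exact h0
  | ht γ x => rw [Ten.map_tmul, projR_self]; exact ht γ x.1 x.2
  | ha a b iha ihb => rw [map_add]; exact ha _ _ iha ihb

/-- The multiplication of the tensor product ring `A(0) ⊗ A`. -/
noncomputable def tenMul : Ten 0 (DualA ⊤) →+ Ten 0 (DualA ⊤) →+ Ten 0 (DualA ⊤) :=
  AddMonoidHom.mul (R := AR 0 ⊗[M2] DualA ⊤)

theorem tenMul_tmul (γ γ' : AR 0) (x y : DualA ⊤) : tenMul (Ten.tmul 0 γ x) (Ten.tmul 0 γ' y) =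
    Ten.tmul 0 (γ * γ') (x * y) :=
  Algebra.TensorProduct.tmul_mul_tmul (R := M2) γ γ' x y

theorem coactA_mul (x y : DualA ⊤) : coactA (x * y) = tenMul (coactA x) (coactA y) :=
  map_mul (coprod 0 ⊤ le_top) x y

theorem coactA_mul_mem {n d d' : ℕ} {x y : DualA ⊤} (hx : coactA x ∈ tenWtLE n d)
    (hy : coactA y ∈ tenWtLE n d') : coactA (x * y) ∈ tenWtLE n (d + d') := by
  rw [coactA_mul]
  refine tenWtLE_induction (P := fun z => tenMul z (coactA y) ∈ tenWtLE n (d + d')) ?_ ?_ ?_ hx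
  · rw [map_zero]; exact zero_mem _
  · intro γ x hx
    refine tenWtLE_induction (P := fun w => tenMul (Ten.tmul 0 γ x) w ∈ tenWtLE n (d + d'))
      ?_ ?_ ?_ hy
    · rw [map_zero]; exact zero_mem _
    · intro γ' y hy
      rw [tenMul_tmul]
      exact tmul_mem_tenWtLE _ (wtLE_mul hx hy)
    · intro a b ha hb
      rw [map_add]
      exact add_mem ha hb
  · intro a b ha hb
    rw [map_add]
    exact add_mem ha hb

theorem quotGen_mem (n : ℕ) (g : ℕ ⊕ ℕ) : quotGen n g ∈ wtLE n (quotWt n g) :=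
  Submodule.subset_span ⟨Finsupp.single g 1, by simp, by simp⟩

theorem one_mem_wtLE (n d : ℕ) : (1 : DualA ⊤) ∈ wtLE n d :=
  Submodule.subset_span ⟨0, by simp, by simp⟩

theorem coactA_gen_mem (n : ℕ) (g : ℕ ⊕ ℕ) : coactA (quotGen n g) ∈ tenWtLE n (quotWt n g) := by
  rcases g with i | i
  · have e : coactA (quotGen n (.inl i)) = Ten.tmul 0 1 (quotGen n (.inl i)) := by
      change (coprod 0 ⊤ le_top (xi ⊤ (i + 1) ^ 2 ^ (n - i)) : AR 0 ⊗[M2] DualA ⊤) =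
        1 ⊗ₜ[M2] (xi ⊤ (i + 1) ^ 2 ^ (n - i))
      rw [map_pow, coprod0_xi, Algebra.TensorProduct.tmul_pow, one_pow]
    rw [e]
    exact tmul_mem_tenWtLE _ (quotGen_mem n _)
  · have e : coactA (quotGen n (.inr i)) = Ten.tmul 0 (toAR 0 (ta 0 0)) (xi ⊤ (n + 1 + i)) +
        Ten.tmul 0 1 (quotGen n (.inr i)) := coprod0_ta _
    rw [e]
    refine add_mem (tmul_mem_tenWtLE _ ?_) (tmul_mem_tenWtLE _ (quotGen_mem n _))
    have h := quotGen_mem n (.inl (n + i))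
    have h1 : n - (n + i) = 0 := by omega
    have h2 : n + i + 1 = n + 1 + i := by omega
    simpa only [quotGen, quotWt, h1, h2, pow_zero, pow_one, mul_one] using h

theorem coactA_mem (n d : ℕ) {x : DualA ⊤} (hx : x ∈ wtLE n d) : coactA x ∈ tenWtLE n d := by
  have hone : ∀ d, coactA 1 ∈ tenWtLE n d := by
    intro d
    have e : coactA 1 = Ten.tmul 0 1 1 := map_one (coprod 0 ⊤ le_top)
    rw [e]
    exact tmul_mem_tenWtLE _ (one_mem_wtLE n d)
  have hmono : ∀ {d d'}, d ≤ d' → ∀ {z}, z ∈ tenWtLE n d → z ∈ tenWtLE n d' := by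
    intro d d' h z hz
    have hle : wtLE n d ≤ wtLE n d' :=
      Submodule.span_mono fun x ⟨e, he, hx⟩ => ⟨e, he.trans h, hx⟩
    exact tenWtLE_induction (zero_mem _) (fun γ x hx => tmul_mem_tenWtLE γ (hle hx))
      (fun a b ha hb => add_mem ha hb) hz
  have hpow : ∀ g j, coactA (quotGen n g ^ j) ∈ tenWtLE n (j * quotWt n g) := by
    intro g j
    induction j with
    | zero => rw [pow_zero]; exact hone _
    | succ j ih =>
      rw [pow_succ, add_mul, one_mul]
      exact coactA_mul_mem ih (coactA_gen_mem n g)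
  unfold wtLE at hx
  induction hx using Submodule.span_induction with
  | mem x hx =>
    obtain ⟨e, he, rfl⟩ := hx
    refine hmono he ?_
    unfold Finsupp.prod Finsupp.sum
    induction e.support using Finset.induction_on with
    | empty => simpa using hone _
    | insert g t hg ih =>
      rw [Finset.prod_insert hg, Finset.sum_insert hg]
      exact coactA_mul_mem (hpow g _) ih
  | zero => rw [map_zero]; exact zero_mem _
  | add x y _ _ hx hy => rw [map_add]; exact add_mem hx hy
  | smul r x _ hx => rw [map_smul]; exact Submodule.smul_mem _ r hx

/-- The restriction of the `A(0)^∨`-coaction to `B_n(k)`; it is characterised by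
`map_brownGitlerCoact` below. -/
noncomputable def brownGitlerCoact (n k : ℕ) :
    brownGitler n k →ₗ[M2] Ten 0 (brownGitler n k) :=
  (LinearEquiv.ofInjective (Ten.map 0 0 le_rfl (brownGitler n k).subtype)
      (Ten.map_injective _ (Submodule.subtype_injective _))).symm.toLinearMap ∘ₗ
    (coactA ∘ₗ (brownGitler n k).subtype).codRestrict _ (fun x => coactA_mem n _ x.2)

theorem map_brownGitlerCoact (n k : ℕ) (x : brownGitler n k) :
    Ten.map 0 0 le_rfl (brownGitler n k).subtype (brownGitlerCoact n k x) = coactA x := by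
  let E := LinearEquiv.ofInjective (Ten.map 0 0 le_rfl (brownGitler n k).subtype)
      (Ten.map_injective _ (Submodule.subtype_injective _))
  have h := E.apply_symm_apply ((coactA ∘ₗ (brownGitler n k).subtype).codRestrict _
    (fun x => coactA_mem n _ x.2) x)
  exact congrArg Subtype.val h

/-- `B_n(k)` as a bigraded left `A(0)^∨`-comodule. -/
noncomputable def brownGitlerCoaction (n k : ℕ) : GradedCoaction 0 where
  X := brownGitler n k
  coact := brownGitlerCoact n k
  piece c := (DualA.piece ⊤ c).comap (brownGitler n k).subtype.toAddMonoidHom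

end BrownGitler

section Statement

theorem unit_d_zero (r : M2) : Cobar.d (unitCoaction 0) 0 r =
    Ten.tmul 0 (toAR 0 (etaR 0 r) + toAR 0 (etaL 0 r)) (1 : M2) := by
  have h1 : Cobar.d (unitCoaction 0) 0 r =
      Ten.tmul 0 1 r + Ten.tmul 0 (toAR 0 (etaL 0 r) * 1) (1 : M2) := rfl
  have h2 := Ten.mul_etaR_tmul 0 r 1 (1 : M2)
  rw [h1, Ten.add_tmul, mul_one]
  rw [mul_one, smul_eq_mul, mul_one] at h2
  rw [h2]

theorem unit_mem_Z (r : M2) (h : etaR 0 r = etaL 0 r) : r ∈ Cobar.Z (unitCoaction 0) 0 := by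
  change Cobar.d (unitCoaction 0) 0 r = 0
  rw [unit_d_zero, h, ← map_add, ← two_mul, DualA.two_eq_zero, zero_mul, map_zero]
  exact TensorProduct.zero_tmul _ _

/-- The class `ρ` in `Ext^0_{A(0)^∨}(M2)`. -/
noncomputable def rhoClass : Ext (unitCoaction 0) 0 :=
  Ext.mk _ 0 ⟨(MvPolynomial.X 0 : M2), unit_mem_Z _ (by rw [etaR_rho, etaL_rho])⟩

/-- The class `τ²` in `Ext^0_{A(0)^∨}(M2)`. -/
noncomputable def tauSqClass : Ext (unitCoaction 0) 0 :=
  Ext.mk _ 0 ⟨(MvPolynomial.X 1 ^ 2 : M2), unit_mem_Z _ (by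
    have h0 : ta 0 0 ^ 2 = 0 := by rw [ta_sq, xi0_eq_zero, ta0_eq_zero]; simp
    rw [map_pow, map_pow, etaR_tau, etaL_tau]
    linear_combination (rho 0 ^ 2) * h0 + (tau 0 * rho 0 * ta 0 0) * DualA.two_eq_zero 0)⟩

theorem hZero_mem : (Cobar.tmul (unitCoaction 0) (s := 0) (toAR 0 (ta 0 0)) (1 : M2)) ∈
    Cobar.Z (unitCoaction 0) 1 := by
  have h1 : coprodR 0 (toAR 0 (ta 0 0)) = toAR 0 (ta 0 0) ⊗ₜ[M2] 1 + 1 ⊗ₜ[M2] ta 0 0 := by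
    rw [coprodR_toAR, ta, coprod_mk, coprodPoly_ta]
    simp [xi_zero, ta]
  have h2 : Cobar.delta (unitCoaction 0) 0
      (Cobar.tmul (unitCoaction 0) (s := 0) (toAR 0 (ta 0 0)) (1 : M2)) =
      Ten.tmul 0 (toAR 0 (ta 0 0)) (Ten.tmul 0 1 (1 : M2)) +
        Ten.tmul 0 1 (Ten.tmul 0 (toAR 0 (ta 0 0)) (1 : M2)) := by
    change Ten.delta 0 (Ten.tmul 0 (toAR 0 (ta 0 0)) (1 : M2)) = _
    rw [Ten.delta_tmul, h1, map_add, Ten.deltaTmul_tmul, Ten.deltaTmul_tmul, map_one]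
  have h3 : Cobar.inner (unitCoaction 0) 0 (1 : M2) = Ten.tmul 0 1 (1 : M2) :=
    one_smul M2 (Ten.tmul 0 1 (1 : M2))
  have h4 := (Cobar.inner_tmul (N := unitCoaction 0) (s := 0) (toAR 0 (ta 0 0)) (1 : M2)).trans
    (congrArg₂ (· + ·) h2 (congrArg (Ten.tmul 0 (toAR 0 (ta 0 0))) h3))
  refine (congrArg (fun w => Cobar.one (unitCoaction 0) 1
    (Cobar.tmul (unitCoaction 0) (s := 0) (toAR 0 (ta 0 0)) (1 : M2)) + w) h4).trans ?_
  change Ten.tmul 0 1 (Ten.tmul 0 (toAR 0 (ta 0 0)) (1 : M2)) +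
    (Ten.tmul 0 (toAR 0 (ta 0 0)) (Ten.tmul 0 1 (1 : M2)) +
      Ten.tmul 0 1 (Ten.tmul 0 (toAR 0 (ta 0 0)) (1 : M2)) +
      Ten.tmul 0 (toAR 0 (ta 0 0)) (Ten.tmul 0 1 (1 : M2))) = 0
  generalize Ten.tmul 0 1 (Ten.tmul 0 (toAR 0 (ta 0 0)) (1 : M2)) = a
  generalize Ten.tmul 0 (toAR 0 (ta 0 0)) (Ten.tmul 0 1 (1 : M2)) = b
  have e : a + (b + a + b) = (a + a) + (b + b) := by abel
  rw [e, add_self_M2, add_self_M2, add_zero]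

/-- The class `h_0 = [τ_0]` in `Ext^1_{A(0)^∨}(M2)`. -/
noncomputable def hZero : Ext (unitCoaction 0) 1 :=
  Ext.mk _ 1 ⟨Cobar.tmul (unitCoaction 0) (s := 0) (toAR 0 (ta 0 0)) (1 : M2), hZero_mem⟩

/-- The action of `Ext_{A(1)^∨}(M2)` on `Ext_{A(0)^∨}(N)`, through restriction. -/
noncomputable def Ext.act (N : GradedCoaction 0) (s t : ℕ) (x : Ext (unitCoaction 1) s)
    (y : Ext N t) : Ext N (t + s) :=
  Ext.mul N s t (Ext.res 0 1 zero_le_one s x) y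

/-- The ring `𝔽₂[ρ, τ², h_0] / (ρ h_0)`, with generators `ρ = X 0`, `τ² = X 1`, `h_0 = X 2`. -/
abbrev HRing : Type :=
  MvPolynomial (Fin 3) (ZMod 2) ⧸
    Ideal.span {(MvPolynomial.X 0 * MvPolynomial.X 2 : MvPolynomial (Fin 3) (ZMod 2))}

/-- The three generators. -/
noncomputable def HRing.gen (i : Fin 3) : HRing := Ideal.Quotient.mk _ (MvPolynomial.X i)

/-- The part of tridegree `(s, f, w)`, with `|ρ| = (-1,0,-1)`, `|τ²| = (0,0,-2)`, `|h_0| = (0,1,0)`. -/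
noncomputable def HRing.piece (s f w : ℤ) : AddSubgroup HRing :=
  (MvPolynomial.weightedHomogeneousSubmodule (ZMod 2)
    (![(-1, 0, -1), (0, 0, -2), (0, 1, 0)] : Fin 3 → ℤ × ℤ × ℤ) (s, f, w)).toAddSubgroup.map
    (Ideal.Quotient.mk (Ideal.span {(MvPolynomial.X 0 * MvPolynomial.X 2 :
      MvPolynomial (Fin 3) (ZMod 2))})).toAddMonoidHom

/-- The total `Ext` group, the direct sum over all Adams filtrations. -/
abbrev TotalExt {n : ℕ∞} (N : GradedCoaction n) : Type := DirectSum ℕ (Ext N)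

/-- The inclusion of `Ext^f` into the total `Ext` group. -/
noncomputable def Ext.of {n : ℕ∞} (N : GradedCoaction n) (f : ℕ) : Ext N f →+ TotalExt N :=
  DirectSum.of (Ext N) f

end Statement

end MotivicExt

open MotivicExt

/-! The quotient A(0)^∨ is exterior on the primitive class `τ_0`, free over the coefficients on 1
and `τ_0` along the right unit. A counital coaction therefore has the form x ↦ 1 ⊗ x + τ_0 ⊗ βx,
with β twisted by the derivation ρ ↦ 0, τ ↦ ρ (`bockstein`): β(rx) = bockstein(r)x + rβx. Every
cobar cocycle is cohomologous to some τ_0 ⊗ ⋯ ⊗ τ_0 ⊗ y with βy = 0. Hence Ext^0 is ker β, and in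
each positive filtration Ext is the group of cycles of β modulo those that are boundaries
(`Cobar.exists_of_mem_Z`, `Ext.ofKer_surjective`, `Ext.ofKer_succ_eq_zero`). Juxtaposition of such
cocycles multiplies the last entries (`Ext.mul_ofKer`).

For the coefficients, ker β = 𝔽₂[ρ, τ²] and im β = ρ 𝔽₂[ρ, τ²]. So filtration 0 is 𝔽₂[ρ, τ²], each
positive filtration is 𝔽₂[τ²] h_0^f, and the total is 𝔽₂[ρ, τ², h_0]/(ρ h_0).

On the dual Steenrod algebra β is a derivation with βτ_i = ξ_i and βξ_i = 0. On the Brown-Gitler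
comodule the pairs (ξ_j, τ_j) with j ≥ 2 form Koszul-type pairs: replacing one ξ_j by τ_j, for the
least such j that occurs, contracts everything except the span of 1, ξ_1², …, ξ_1^{2k} (`homotopy`).
These k+1 cycles have bidegrees (4j, 2j) and generate copies of the coefficients; the complement is
β-acyclic. It contributes only its cycles in filtration 0, and these form T: a product of such a
class with a class of positive filtration lies where the acyclic part contributes nothing, so it
vanishes. The structure `Splitting` isolates what this argument needs.

Two points require work. The contraction is defined on monomials, so the monomials squarefree in the
τ_i must be a basis (`linearIndependent_mon`); after inverting ρ each τ_i becomes a polynomial of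
degree 2^i in τ_0, and binary expansion separates the products. The projections to the powers of
ξ_1² must be linear, homogeneous and compatible with β; they are read off from a ring map to 𝔽₂[ρ,
√τ][√ξ_1] (`red`, `xiCoeff`). -/

namespace MotivicExt

/-! ### The derivation β on 𝔽₂[ρ, τ], its kernel and its image. -/

section Coefficients

open MvPolynomial

/-- An additive map sends weighted homogeneous polynomials into `P` if it does so for monomials. -/
theorem map_mem_of_isWeightedHomogeneous {ι Γ A R : Type*} [CommSemiring R] [AddCommMonoid Γ]
    [AddCommGroup A] {w : ι → Γ} {c : Γ} (P : AddSubgroup A) (F : MvPolynomial ι R →+ A)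
    (hF : ∀ d : ι →₀ ℕ, Finsupp.weight w d = c → ∀ a, F (monomial d a) ∈ P)
    {p : MvPolynomial ι R} (hp : IsWeightedHomogeneous w p c) : F p ∈ P := by
  rw [p.as_sum, map_sum]
  exact sum_mem fun d hd => hF d (hp (mem_support_iff.mp hd)) _

theorem M2_two_eq_zero : (2 : M2) = 0 := two_eq_zero_of_hom C

/-- The derivation `ρ ↦ 0`, `τ ↦ ρ` that measures the failure of `η_R` to agree with `η_L`. -/
noncomputable def bockstein : Derivation (ZMod 2) M2 M2 :=
  mkDerivation (ZMod 2) ![0, X 0]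

theorem bockstein_rho : bockstein (X 0) = 0 := by simp [bockstein]
theorem bockstein_tau : bockstein (X 1) = X 0 := by simp [bockstein]

/-- The ring map `ρ ↦ ρ`, `τ ↦ τ²`. -/
noncomputable def tauSq : M2 →ₐ[ZMod 2] M2 := aeval ![X 0, X 1 ^ 2]

theorem tauSq_rho : tauSq (X 0) = X 0 := by simp [tauSq]
theorem tauSq_tau : tauSq (X 1) = X 1 ^ 2 := by simp [tauSq]

theorem bockstein_tauSq (r : M2) : bockstein (tauSq r) = 0 := by
  induction r using MvPolynomial.induction_on with
  | C a => simp [tauSq]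
  | add p q hp hq => rw [map_add, map_add, hp, hq, add_zero]
  | mul_X p i hp =>
    rw [map_mul, Derivation.leibniz, hp]
    fin_cases i
    · simp [tauSq_rho, bockstein_rho]
    · have h := M2_two_eq_zero
      simp only [Fin.mk_one, tauSq_tau, pow_two, Derivation.leibniz, bockstein_tau, smul_eq_mul]
      linear_combination (tauSq p * X 1 * X 0) * h

/-- The exponent `(a, b)` as a finitely supported function. -/
noncomputable def expo (a b : ℕ) : Fin 2 →₀ ℕ := Finsupp.single 0 a + Finsupp.single 1 b

theorem expo_zero (a b : ℕ) : expo a b 0 = a := by simp [expo]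
theorem expo_one (a b : ℕ) : expo a b 1 = b := by simp [expo]

theorem expo_eta (d : Fin 2 →₀ ℕ) : expo (d 0) (d 1) = d := by
  ext i
  fin_cases i
  · exact expo_zero _ _
  · exact expo_one _ _

theorem monomial_expo (a b : ℕ) (c : ZMod 2) :
    (monomial (expo a b) c : M2) = C c * (X 0 ^ a * X 1 ^ b) := by
  rw [monomial_eq, expo, Finsupp.prod_add_index' (by simp) (by intros; rw [pow_add])]
  simp

/-- The linear map `ρ^a τ^{2b} ↦ ρ^a τ^b`, zero on odd powers of `τ`. -/
noncomputable def evenPart : M2 →ₗ[ZMod 2] M2 :=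
  (basisMonomials (Fin 2) (ZMod 2)).constr (ZMod 2) fun d =>
    if Even (d 1) then monomial (expo (d 0) (d 1 / 2)) 1 else 0

theorem evenPart_monomial (a b : ℕ) (c : ZMod 2) : evenPart (monomial (expo a b) c) =
    if Even b then monomial (expo a (b / 2)) c else 0 := by
  have h : (monomial (expo a b) c : M2) = c • basisMonomials (Fin 2) (ZMod 2) (expo a b) := by
    simp [smul_monomial]
  rw [h, map_smul, evenPart, Module.Basis.constr_basis, expo_zero, expo_one]
  split_ifs <;> simp [smul_monomial]

theorem evenPart_rho_mul (r : M2) : evenPart (X 0 * r) = X 0 * evenPart r := by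
  induction r using MvPolynomial.induction_on' with
  | add p q hp hq => rw [mul_add, map_add, hp, hq, map_add, mul_add]
  | monomial d c =>
    rw [← expo_eta d]
    have e : ∀ a b, (X 0 * monomial (expo a b) c : M2) = monomial (expo (a + 1) b) c := by
      intro a b; rw [monomial_expo, monomial_expo]; ring
    rw [e, evenPart_monomial, evenPart_monomial]
    split_ifs
    · rw [e]
    · rw [mul_zero]

theorem evenPart_tau_sq_mul (r : M2) : evenPart (X 1 ^ 2 * r) = X 1 * evenPart r := by
  induction r using MvPolynomial.induction_on' with
  | add p q hp hq => rw [mul_add, map_add, hp, hq, map_add, mul_add]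
  | monomial d c =>
    rw [← expo_eta d]
    have e : ∀ a b, (X 1 ^ 2 * monomial (expo a b) c : M2) = monomial (expo a (b + 2)) c := by
      intro a b; rw [monomial_expo, monomial_expo]; ring
    have e' : ∀ a b, (X 1 * monomial (expo a b) c : M2) = monomial (expo a (b + 1)) c := by
      intro a b; rw [monomial_expo, monomial_expo]; ring
    rw [e, evenPart_monomial, evenPart_monomial, Nat.add_div_right _ two_pos]
    have : Even (d 1 + 2) ↔ Even (d 1) := by simp [Nat.even_add]
    simp only [this]
    split_ifs
    · rw [e']
    · rw [mul_zero]

/-- Linearity over the subring 𝔽₂[ρ, τ²], which `tauSq` identifies with `M2`. It makes `evenPart` a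
retraction of `tauSq`, and later makes the coefficient maps on the dual Steenrod algebra linear. -/
theorem evenPart_tauSq_mul (a r : M2) : evenPart (tauSq a * r) = a * evenPart r := by
  induction a using MvPolynomial.induction_on generalizing r with
  | C c => rw [tauSq, aeval_C, algebraMap_eq, ← smul_eq_C_mul, ← smul_eq_C_mul, map_smul]
  | add p q hp hq => rw [map_add, add_mul, map_add, hp, hq, add_mul]
  | mul_X p i hp =>
    have e : tauSq (p * X i) = tauSq p * tauSq (X i) := map_mul _ _ _
    rw [e, mul_assoc, hp, mul_assoc]
    fin_cases i
    · exact congrArg (p * ·) ((congrArg (fun x => evenPart (x * r)) tauSq_rho).trans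
        (evenPart_rho_mul r))
    · exact congrArg (p * ·) ((congrArg (fun x => evenPart (x * r)) tauSq_tau).trans
        (evenPart_tau_sq_mul r))

theorem evenPart_one : evenPart 1 = 1 := by
  have h := evenPart_monomial 0 0 1
  simpa [monomial_expo] using h

theorem evenPart_tauSq (a : M2) : evenPart (tauSq a) = a := by
  have h := evenPart_tauSq_mul a 1
  rwa [mul_one, evenPart_one, mul_one] at h

/-- The elements 1 and τ generate the coefficients over 𝔽₂[ρ, τ²]; in these terms β sends 1 to 0 and
τ to ρ, which gives its kernel and image at once. -/
theorem exists_tauSq_add (y : M2) : ∃ a b, y = tauSq a + X 1 * tauSq b := by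
  induction y using MvPolynomial.induction_on with
  | C c => exact ⟨C c, 0, by simp [tauSq]⟩
  | add p q hp hq =>
    obtain ⟨a, b, rfl⟩ := hp
    obtain ⟨a', b', rfl⟩ := hq
    exact ⟨a + a', b + b', by rw [map_add, map_add]; ring⟩
  | mul_X p i hp =>
    obtain ⟨a, b, rfl⟩ := hp
    fin_cases i
    · exact ⟨a * X 0, b * X 0, by simp only [map_mul, tauSq_rho, Fin.zero_eta]; ring⟩
    · exact ⟨b * X 1, a, by simp only [map_mul, tauSq_tau, Fin.mk_one]; ring⟩

theorem bockstein_tau_mul_tauSq (b : M2) : bockstein (X 1 * tauSq b) = X 0 * tauSq b := by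
  rw [Derivation.leibniz, bockstein_tauSq, bockstein_tau, smul_zero, zero_add, smul_eq_mul, mul_comm]

/-- The kernel of β is no larger than 𝔽₂[ρ, τ²]: the τ-component of y is carried to ρ times itself,
and ρ is not a zero divisor. -/
theorem tauSq_evenPart {y : M2} (hy : bockstein y = 0) : tauSq (evenPart y) = y := by
  obtain ⟨a, b, rfl⟩ := exists_tauSq_add y
  rw [map_add, bockstein_tauSq, bockstein_tau_mul_tauSq, zero_add] at hy
  have h : tauSq b = 0 := (mul_eq_zero.mp hy).resolve_left (X_ne_zero 0)
  rw [h, mul_zero, add_zero, evenPart_tauSq]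

/-- With the next lemma: among cycles, the boundaries are exactly the multiples of ρ in 𝔽₂[ρ, τ²].
This is the source of the relation ρ h_0 = 0. -/
theorem evenPart_bockstein (y : M2) : ∃ z, evenPart (bockstein y) = X 0 * z := by
  obtain ⟨a, b, rfl⟩ := exists_tauSq_add y
  rw [map_add, bockstein_tauSq, bockstein_tau_mul_tauSq, zero_add, evenPart_rho_mul]
  exact ⟨_, rfl⟩

theorem exists_bockstein_of_evenPart {y z : M2} (hy : bockstein y = 0)
    (h : evenPart y = X 0 * z) : ∃ r, bockstein r = y := by
  -- A primitive of ρ z(ρ, τ²) is τ z(ρ, τ²), because βτ = ρ.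
  refine ⟨X 1 * tauSq z, ?_⟩
  rw [← tauSq_evenPart hy, h, bockstein_tau_mul_tauSq, map_mul, tauSq_rho]

/-- One factor has to be a cycle: `evenPart` is not multiplicative on odd powers of τ, as τ · τ
shows. -/
theorem evenPart_mul {x y : M2} (hx : bockstein x = 0) :
    evenPart (x * y) = evenPart x * evenPart y := by
  conv_lhs => rw [← tauSq_evenPart hx]
  exact evenPart_tauSq_mul _ _

theorem mul_mem_M2_piece {a b : ℤ × ℤ} {r s : M2} (hr : r ∈ M2.piece a) (hs : s ∈ M2.piece b) :
    r * s ∈ M2.piece (a + b) :=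
  IsWeightedHomogeneous.mul hr hs

end Coefficients

/-! ### The ring 𝔽₂[ρ, τ², h_0]/(ρ h_0): maps that detect its elements, and its grading. -/

section HRing

open MvPolynomial

theorem HRing.rho_mul_h : HRing.gen 0 * HRing.gen 2 = 0 := by
  rw [HRing.gen, HRing.gen, ← map_mul]
  exact Ideal.Quotient.eq_zero_iff_mem.mpr (Ideal.subset_span rfl)

/-- The inclusion of `𝔽₂[ρ, τ²]`, written as `ρ ↦ ρ`, `τ ↦ τ²`. -/
noncomputable def HRing.incl : M2 →+* HRing :=
  (Ideal.Quotient.mk _).comp (aeval (R := ZMod 2) ![X 0, X 1] : M2 →ₐ[ZMod 2] MvPolynomial (Fin 3) (ZMod 2)).toRingHom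

theorem HRing.incl_rho : HRing.incl (X 0) = HRing.gen 0 := by simp [incl, gen]
theorem HRing.incl_tau : HRing.incl (X 1) = HRing.gen 1 := by simp [incl, gen]

/-- The map `y ↦ y h_0^f`, for `y` in `𝔽₂[ρ, τ²]`, zero on odd powers of `τ`. -/
noncomputable def hMul (f : ℕ) : M2 →+ HRing :=
  (AddMonoidHom.mulRight (HRing.gen 2 ^ f)).comp
    (HRing.incl.toAddMonoidHom.comp evenPart.toAddMonoidHom)

theorem hMul_apply (f : ℕ) (y : M2) : hMul f y = HRing.incl (evenPart y) * HRing.gen 2 ^ f := rfl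

theorem hMul_mul (a b : ℕ) {x y : M2} (hx : bockstein x = 0) :
    hMul (b + a) (x * y) = hMul a x * hMul b y := by
  rw [hMul_apply, hMul_apply, hMul_apply, evenPart_mul hx, map_mul, pow_add]
  ring

/-- Boundaries are multiples of ρ and ρ h_0 = 0, so `hMul` descends to Ext in positive filtration.
In filtration 0 the statement would fail, but there nothing is divided out. -/
theorem hMul_bockstein (f : ℕ) (y : M2) : hMul (f + 1) (bockstein y) = 0 := by
  obtain ⟨z, hz⟩ := evenPart_bockstein y
  rw [hMul_apply, hz, map_mul, HRing.incl_rho, pow_succ]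
  linear_combination (HRing.incl z * HRing.gen 2 ^ f) * HRing.rho_mul_h

/-- Reduction modulo `h_0`. -/
noncomputable def HRing.modH : HRing →+* M2 :=
  Ideal.Quotient.lift _ (aeval (R := ZMod 2) ![X 0, X 1, 0] : MvPolynomial (Fin 3) (ZMod 2) →ₐ[ZMod 2] M2).toRingHom (by
    intro a ha
    refine (Ideal.span_le (I := RingHom.ker _)).mpr ?_ ha
    rintro _ rfl
    simp [RingHom.mem_ker])

theorem HRing.modH_gen_two : HRing.modH (HRing.gen 2) = 0 := by
  change aeval (R := ZMod 2) (![X 0, X 1, 0] : Fin 3 → M2) (X 2) = 0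
  simp

theorem HRing.modH_incl (y : M2) : HRing.modH (HRing.incl y) = y := by
  have : HRing.modH.comp HRing.incl = RingHom.id M2 := by
    apply ringHom_M2_ext
    · rw [RingHom.comp_apply, HRing.incl_rho]
      change aeval (R := ZMod 2) (![X 0, X 1, 0] : Fin 3 → M2) (X 0) = _
      simp
    · rw [RingHom.comp_apply, HRing.incl_tau]
      change aeval (R := ZMod 2) (![X 0, X 1, 0] : Fin 3 → M2) (X 1) = _
      simp
  exact DFunLike.congr_fun this y

/-- The coefficients modulo `ρ`. -/
abbrev M2ModRho : Type := M2 ⧸ Ideal.span {(X 0 : M2)}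

noncomputable def M2ModRho.mk : M2 →+* M2ModRho := Ideal.Quotient.mk _

theorem M2ModRho.mk_rho : M2ModRho.mk (X 0) = 0 :=
  Ideal.Quotient.eq_zero_iff_mem.mpr (Ideal.subset_span rfl)

/-- Reduction modulo `ρ`. -/
noncomputable def HRing.modRho : HRing →+* Polynomial M2ModRho :=
  Ideal.Quotient.lift _ (aeval (R := ZMod 2)
    ![0, Polynomial.C (M2ModRho.mk (X 1)), Polynomial.X] :
      MvPolynomial (Fin 3) (ZMod 2) →ₐ[ZMod 2] Polynomial M2ModRho).toRingHom (by
    intro a ha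
    refine (Ideal.span_le (I := RingHom.ker _)).mpr ?_ ha
    rintro _ rfl
    simp [RingHom.mem_ker])

theorem HRing.modRho_gen_two : HRing.modRho (HRing.gen 2) = Polynomial.X := by
  change aeval (R := ZMod 2) (![0, Polynomial.C (M2ModRho.mk (X 1)), Polynomial.X] :
    Fin 3 → Polynomial M2ModRho) (X 2) = _
  simp

theorem HRing.modRho_incl (y : M2) :
    HRing.modRho (HRing.incl y) = Polynomial.C (M2ModRho.mk y) := by
  have : HRing.modRho.comp HRing.incl = Polynomial.C.comp M2ModRho.mk := by
    refine ringHom_M2_ext (S := Polynomial M2ModRho) ?_ ?_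
    · rw [RingHom.comp_apply, HRing.incl_rho]
      change aeval (R := ZMod 2) (![0, Polynomial.C (M2ModRho.mk (X 1)), Polynomial.X] :
        Fin 3 → Polynomial M2ModRho) (X 0) = _
      rw [RingHom.comp_apply, M2ModRho.mk_rho]
      simp
    · rw [RingHom.comp_apply, HRing.incl_tau]
      change aeval (R := ZMod 2) (![0, Polynomial.C (M2ModRho.mk (X 1)), Polynomial.X] :
        Fin 3 → Polynomial M2ModRho) (X 1) = _
      simp
  exact DFunLike.congr_fun this y

/-- The reduction modulo `ρ` of the coefficient of `h_0^f`. -/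
noncomputable def hCoeff (f : ℕ) : HRing →+ M2ModRho :=
  (Polynomial.lcoeff M2ModRho f).toAddMonoidHom.comp HRing.modRho.toAddMonoidHom

/-- Modulo ρ the ring is polynomial in h_0, so filtrations separate. Nothing is lost for f > 0,
where coefficients only matter modulo ρ; filtration 0 is detected by reduction modulo h_0 instead.
-/
theorem hCoeff_hMul (f g : ℕ) (y : M2) :
    hCoeff f (hMul g y) = if f = g then M2ModRho.mk (evenPart y) else 0 := by
  change (HRing.modRho (hMul g y)).coeff f = _
  rw [hMul_apply, map_mul, map_pow, HRing.modRho_incl, HRing.modRho_gen_two,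
    Polynomial.coeff_C_mul_X_pow]

theorem modH_hMul_zero (y : M2) : HRing.modH (hMul 0 y) = evenPart y := by
  rw [hMul_apply, pow_zero, mul_one, HRing.modH_incl]

theorem modH_hMul_succ (f : ℕ) (y : M2) : HRing.modH (hMul (f + 1) y) = 0 := by
  rw [hMul_apply, map_mul, map_pow, HRing.modH_gen_two, zero_pow (by omega), mul_zero]

theorem exists_bockstein_of_hCoeff {f : ℕ} {y : M2} (hy : bockstein y = 0)
    (h : hCoeff f (hMul f y) = 0) : ∃ r, bockstein r = y := by
  rw [hCoeff_hMul, if_pos rfl, M2ModRho.mk, Ideal.Quotient.eq_zero_iff_mem, Ideal.mem_span_singleton] at h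
  obtain ⟨z, hz⟩ := h
  exact exists_bockstein_of_evenPart hy hz

theorem C_mul_prod_fin_three (d : Fin 3 →₀ ℕ) (c : ZMod 2) :
    (monomial d c : MvPolynomial (Fin 3) (ZMod 2)) =
      C c * (X 0 ^ d 0 * X 1 ^ d 1 * X 2 ^ d 2) := by
  rw [monomial_eq, Finsupp.prod_fintype _ _ (by simp), Fin.prod_univ_three]

theorem hRing_weight (d : Fin 3 →₀ ℕ) :
    Finsupp.weight (![(-1, 0, -1), (0, 0, -2), (0, 1, 0)] : Fin 3 → ℤ × ℤ × ℤ) d =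
      (-(d 0 : ℤ), (d 2 : ℤ), -(d 0 : ℤ) - 2 * d 1) := by
  rw [Finsupp.weight_apply, Finsupp.sum_fintype _ _ (by simp), Fin.sum_univ_three]
  ext <;> (simp; try ring)

theorem m2_weight (d : Fin 2 →₀ ℕ) :
    Finsupp.weight (![(-1, -1), (0, -1)] : Fin 2 → ℤ × ℤ) d =
      (-(d 0 : ℤ), -(d 0 : ℤ) - d 1) := by
  rw [Finsupp.weight_apply, Finsupp.sum_fintype _ _ (by simp), Fin.sum_univ_two]
  ext <;> (simp; try ring)

theorem monomial_mem_M2_piece {a b : ℕ} {c : ℤ × ℤ} (h : (-(a : ℤ), -(a : ℤ) - b) = c)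
    (z : ZMod 2) : monomial (expo a b) z ∈ M2.piece c := by
  refine isWeightedHomogeneous_monomial _ _ _ ?_
  rw [m2_weight, expo_zero, expo_one, h]

/-- The variable `X 1` is τ in `M2` but τ² in `HRing`, hence the halved exponent on the right. -/
theorem hMul_monomial (f a b : ℕ) (c : ZMod 2) : hMul f (monomial (expo a (2 * b)) c) =
    Ideal.Quotient.mk _ (C c * (X 0 ^ a * X 1 ^ b * X 2 ^ f)) := by
  rw [hMul_apply, evenPart_monomial, if_pos (even_two_mul b), Nat.mul_div_cancel_left _ two_pos,
    monomial_expo]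
  simp [HRing.incl, HRing.gen, mul_assoc]

theorem mk_monomial_mem_hRing_piece {a b f : ℕ} {s w : ℤ} (hs : -(a : ℤ) = s)
    (hw : -(a : ℤ) - 2 * b = w) (c : ZMod 2) :
    (Ideal.Quotient.mk _ (C c * (X 0 ^ a * X 1 ^ b * X 2 ^ f)) : HRing) ∈ HRing.piece s f w := by
  refine ⟨_, ?_, rfl⟩
  have h := C_mul_prod_fin_three (Finsupp.equivFunOnFinite.symm ![a, b, f]) c
  simp only [Finsupp.coe_equivFunOnFinite_symm, Matrix.cons_val_zero, Matrix.cons_val_one,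
    Matrix.cons_val_two, Matrix.head_cons, Matrix.tail_cons] at h
  rw [← h]
  refine isWeightedHomogeneous_monomial _ _ _ ?_
  rw [hRing_weight]
  simp [← hs, ← hw]

theorem hMul_mem_piece {c : ℤ × ℤ} (f : ℕ) {y : M2} (hy : y ∈ M2.piece c) :
    hMul f y ∈ HRing.piece c.1 f c.2 := by
  refine map_mem_of_isWeightedHomogeneous _ (hMul f) (fun d hd a => ?_) hy
  rw [m2_weight] at hd
  rw [← expo_eta d]
  rcases Nat.even_or_odd (d 1) with h | h
  · obtain ⟨b, hb⟩ := h
    rw [hb, ← two_mul, hMul_monomial]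
    refine mk_monomial_mem_hRing_piece ?_ ?_ _ <;> rw [← hd]
    simp [hb]; ring
  · rw [hMul_apply, evenPart_monomial, if_neg (Nat.not_even_iff_odd.mpr h), map_zero, zero_mul]
    exact zero_mem _

theorem bockstein_monomial_even (a b : ℕ) (c : ZMod 2) :
    bockstein (monomial (expo a (2 * b)) c) = 0 := by
  have h : (monomial (expo a (2 * b)) c : M2) = tauSq (monomial (expo a b) c) := by
    rw [monomial_expo, monomial_expo]
    simp [tauSq, pow_mul]
  rw [h, bockstein_tauSq]

/-- Homogeneous elements lift to homogeneous cycles. Since h_0 has tridegree (0, 1, 0), the stem and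
weight of the lift are those of x, whatever f is. -/
theorem exists_of_mem_hRing_piece {s w : ℤ} {f : ℕ} {x : HRing} (hx : x ∈ HRing.piece s f w) :
    ∃ y ∈ M2.piece (s, w), bockstein y = 0 ∧ hMul f y = x := by
  obtain ⟨p, hp, rfl⟩ := hx
  let P : AddSubgroup HRing := (M2.piece (s, w) ⊓ bockstein.toLinearMap.toAddMonoidHom.ker).map (hMul f)
  have h : (Ideal.Quotient.mk _ : _ →+* HRing).toAddMonoidHom p ∈ P := by
    refine map_mem_of_isWeightedHomogeneous P _ (fun d hd a => ?_) hp
    rw [hRing_weight] at hd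
    simp only [Prod.mk.injEq, Nat.cast_inj] at hd
    refine ⟨monomial (expo (d 0) (2 * d 1)) a, ⟨monomial_mem_M2_piece ?_ a,
      bockstein_monomial_even _ _ _⟩, ?_⟩
    · rw [← hd.1, ← hd.2.2]; push_cast; rfl
    · rw [hMul_monomial, C_mul_prod_fin_three, hd.2.1]; rfl
  obtain ⟨y, ⟨hy, hy'⟩, hy''⟩ := h
  exact ⟨y, hy, hy', hy''⟩

/-- `𝔽₂[ρ, τ², h_0] / (ρ h_0)` is spanned by the products `y h_0^f`, for `y` in `𝔽₂[ρ, τ²]`. -/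
theorem hRing_induction {P : AddSubgroup HRing}
    (h : ∀ f y, bockstein y = 0 → hMul f y ∈ P) (x : HRing) : x ∈ P := by
  obtain ⟨p, rfl⟩ := Ideal.Quotient.mk_surjective x
  induction p using MvPolynomial.induction_on' with
  | add p q hp hq => rw [map_add]; exact add_mem hp hq
  | monomial d c =>
    rw [C_mul_prod_fin_three, ← hMul_monomial]
    exact h _ _ (bockstein_monomial_even _ _ _)

end HRing

/-! ### Coordinates on A(0)^∨ ⊗ N along the basis 1, τ_0. -/

section Coordinates

/-- The exterior generator of `A(0)^∨`. -/
noncomputable def tZero : AR 0 := toAR 0 (ta 0 0)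

theorem tZero_mul_self : tZero * tZero = 0 := ta00_sq

/-- The left unit expanded in the right-unit basis. Both sides are multiplicative in r, as τ_0² = 0
turns the second summand into a derivation, so the generators suffice; for τ this is η_R(τ) = τ +
ρτ_0 in characteristic two. -/
theorem etaL_eq (r : M2) :
    toAR 0 (etaL 0 r) = toAR 0 (etaR 0 r) + tZero * toAR 0 (etaR 0 (bockstein r)) := by
  have h2 : (2 : AR 0) = 0 := DualA.two_eq_zero 0
  have ht := tZero_mul_self
  induction r using MvPolynomial.induction_on with
  | C a =>
    have : etaL 0 (MvPolynomial.C a) = etaR 0 (MvPolynomial.C a) := by simp [etaL, etaR]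
    rw [this, MvPolynomial.derivation_C, map_zero, map_zero, mul_zero, add_zero]
  | add p q hp hq => simp only [map_add, hp, hq]; ring
  | mul_X p i hp =>
    have hX : toAR 0 (etaL 0 (MvPolynomial.X i)) = toAR 0 (etaR 0 (MvPolynomial.X i)) +
        tZero * toAR 0 (etaR 0 (bockstein (MvPolynomial.X i))) := by
      fin_cases i
      · simp [etaL_rho, etaR_rho, bockstein_rho]
      · simp only [Fin.mk_one, etaL_tau, etaR_tau, bockstein_tau, etaR_rho, map_add, map_mul, tZero]
        linear_combination -(toAR 0 (rho 0) * toAR 0 (ta 0 0)) * h2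
    rw [Derivation.leibniz]
    simp only [map_mul, map_add, hp, hX, smul_eq_mul]
    linear_combination (toAR 0 (etaR 0 (bockstein p)) *
      toAR 0 (etaR 0 (bockstein (MvPolynomial.X i)))) * ht

variable {N : Type} [AddCommGroup N] [Module M2 N]

/-- The coefficient of `1` in `A(0)^∨ ⊗ N`. -/
noncomputable def Ten.coordOne (N : Type) [AddCommGroup N] [Module M2 N] : Ten 0 N →+ N :=
  (TensorProduct.lift ((LinearMap.lsmul M2 N : M2 →ₗ[M2] N →ₗ[M2] N) ∘ₗ
    (TrivSqZeroExt.fstHom M2 M2 M2).toLinearMap ∘ₗ toDualNumberAlg.toLinearMap) :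
      AR 0 ⊗[M2] N →ₗ[M2] N).toAddMonoidHom

/-- The coefficient of `τ_0` in `A(0)^∨ ⊗ N`. -/
noncomputable def Ten.coordT (N : Type) [AddCommGroup N] [Module M2 N] : Ten 0 N →+ N :=
  (TensorProduct.lift ((LinearMap.lsmul M2 N : M2 →ₗ[M2] N →ₗ[M2] N) ∘ₗ
    TrivSqZeroExt.sndHom M2 M2 ∘ₗ toDualNumberAlg.toLinearMap) :
      AR 0 ⊗[M2] N →ₗ[M2] N).toAddMonoidHom

theorem Ten.coordOne_tmul (γ : AR 0) (x : N) :
    Ten.coordOne N (Ten.tmul 0 γ x) = (toDualNumberAlg γ).fst • x := rfl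

theorem Ten.coordT_tmul (γ : AR 0) (x : N) :
    Ten.coordT N (Ten.tmul 0 γ x) = (toDualNumberAlg γ).snd • x := rfl

theorem toDualNumberAlg_tZero : toDualNumberAlg tZero = DualNumber.eps := by
  change toDualNumber (DualA.mk 0 (taPoly 0)) = _
  simp [toDualNumber_mk, taPoly, dualNumberGen]

theorem Ten.coordOne_one (x : N) : Ten.coordOne N (Ten.tmul 0 1 x) = x := by
  rw [Ten.coordOne_tmul, map_one, TrivSqZeroExt.fst_one, one_smul]

theorem Ten.coordT_one (x : N) : Ten.coordT N (Ten.tmul 0 1 x) = 0 := by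
  rw [Ten.coordT_tmul, map_one, TrivSqZeroExt.snd_one, zero_smul]

theorem Ten.coordOne_t (x : N) : Ten.coordOne N (Ten.tmul 0 tZero x) = 0 := by
  rw [Ten.coordOne_tmul, toDualNumberAlg_tZero, DualNumber.fst_eps, zero_smul]

theorem Ten.coordT_t (x : N) : Ten.coordT N (Ten.tmul 0 tZero x) = x := by
  rw [Ten.coordT_tmul, toDualNumberAlg_tZero, DualNumber.snd_eps, one_smul]

theorem Ten.etaR_tmul (r : M2) (γ : AR 0) (x : N) :
    Ten.tmul 0 (γ * toAR 0 (etaR 0 r)) x = Ten.tmul 0 γ (r • x) := by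
  rw [mul_comm, Ten.mul_etaR_tmul]

theorem AR_eq (γ : AR 0) : γ = toAR 0 (etaR 0 (toDualNumberAlg γ).fst) +
    tZero * toAR 0 (etaR 0 (toDualNumberAlg γ).snd) := by
  have h := ofDualNumber_toDualNumber γ
  generalize toDualNumberAlg γ = z at h
  have e : z = algebraMap M2 _ z.fst + DualNumber.eps * algebraMap M2 _ z.snd := by
    refine TrivSqZeroExt.ext ?_ ?_ <;> simp [TrivSqZeroExt.algebraMap_eq_inl]
  have ht : ofDualNumberAlg DualNumber.eps = tZero := by
    rw [ofDualNumberAlg, DualNumber.lift_apply_eps, tZero]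
  rw [← h]
  conv_lhs => rw [e]
  rw [map_add, map_mul, ht, AlgHom.commutes, AlgHom.commutes, algebraMap_AR, algebraMap_AR]

theorem Ten.tmul_zero (γ : AR 0) : Ten.tmul 0 γ (0 : N) = 0 := TensorProduct.tmul_zero _ _

theorem Ten.tmul_eq (γ : AR 0) (x : N) : Ten.tmul 0 γ x =
    Ten.tmul 0 1 ((toDualNumberAlg γ).fst • x) + Ten.tmul 0 tZero ((toDualNumberAlg γ).snd • x) := by
  conv_lhs => rw [AR_eq γ]
  rw [Ten.add_tmul, Ten.etaR_tmul, ← Ten.etaR_tmul _ 1, one_mul]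

/-- With `Ten.add_inj`, this makes A(0)^∨ ⊗ N two copies of N and reduces all cobar computations to
pairs of coordinates. -/
theorem Ten.eq_add (z : Ten 0 N) :
    z = Ten.tmul 0 1 (Ten.coordOne N z) + Ten.tmul 0 tZero (Ten.coordT N z) := by
  induction z using Ten.induction with
  | h0 => rw [map_zero, map_zero, Ten.tmul_zero, Ten.tmul_zero, add_zero]
  | ht γ x => exact Ten.tmul_eq γ x
  | ha a b iha ihb =>
    conv_lhs => rw [iha, ihb]
    rw [map_add, map_add, Ten.tmul_add, Ten.tmul_add]
    abel

theorem Ten.add_inj {x y x' y' : N}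
    (h : Ten.tmul 0 1 x + Ten.tmul 0 tZero y = Ten.tmul 0 1 x' + Ten.tmul 0 tZero y') :
    x = x' ∧ y = y' := by
  constructor
  · have := congrArg (Ten.coordOne N) h
    simpa only [map_add, Ten.coordOne_one, Ten.coordOne_t, add_zero] using this
  · have := congrArg (Ten.coordT N) h
    simpa only [map_add, Ten.coordT_one, Ten.coordT_t, zero_add] using this

/-- The scalar acts through the left unit and must cross the tensor sign through the right unit; the
discrepancy is the derivation. On τ_0 ⊗ x the discrepancy carries a factor τ_0² = 0, so there is no
correction in `Ten.smul_t`. -/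
theorem Ten.smul_one (r : M2) (x : N) : r • Ten.tmul 0 1 x =
    Ten.tmul 0 1 (r • x) + Ten.tmul 0 tZero (bockstein r • x) := by
  rw [Ten.smul_tmul, mul_one, etaL_eq, Ten.add_tmul, Ten.etaR_tmul, ← Ten.etaR_tmul r 1, one_mul]

theorem Ten.smul_t (r : M2) (x : N) : r • Ten.tmul 0 tZero x = Ten.tmul 0 tZero (r • x) := by
  have h : toAR 0 (etaL 0 r) * tZero = tZero * toAR 0 (etaR 0 r) := by
    rw [etaL_eq]
    linear_combination toAR 0 (etaR 0 (bockstein r)) * tZero_mul_self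
  rw [Ten.smul_tmul, h, Ten.etaR_tmul]

theorem coprodR_tZero : coprodR 0 tZero = tZero ⊗ₜ[M2] 1 + 1 ⊗ₜ[M2] ta 0 0 := by
  rw [tZero, coprodR_toAR, ta, coprod_mk, coprodPoly_ta]
  simp [xi_zero, ta]

theorem Ten.delta_one (x : N) : Ten.delta 0 (Ten.tmul 0 1 x) = Ten.tmul 0 1 (Ten.tmul 0 1 x) := by
  rw [Ten.delta_tmul, map_one, Algebra.TensorProduct.one_def, Ten.deltaTmul_tmul, map_one]

theorem Ten.delta_t (x : N) : Ten.delta 0 (Ten.tmul 0 tZero x) =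
    Ten.tmul 0 tZero (Ten.tmul 0 1 x) + Ten.tmul 0 1 (Ten.tmul 0 tZero x) := by
  rw [Ten.delta_tmul, coprodR_tZero, map_add, Ten.deltaTmul_tmul, Ten.deltaTmul_tmul, map_one]
  rfl

end Coordinates

/-! ### Ext over A(0)^∨ as the homology of the operator β. -/

section Cobar

variable {N : GradedCoaction 0}

/-- `1 ⊗ x`, in the cobar complex. -/
noncomputable def Cobar.consOne (N : GradedCoaction 0) (s : ℕ) : Cobar N s →+ Cobar N (s + 1) :=
  AddMonoidHom.mk' (fun x => Cobar.tmul N 1 x) (Cobar.tmul_add 1)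

/-- `τ_0 ⊗ x`, in the cobar complex. -/
noncomputable def Cobar.consT (N : GradedCoaction 0) (s : ℕ) : Cobar N s →+ Cobar N (s + 1) :=
  AddMonoidHom.mk' (fun x => Cobar.tmul N tZero x) (Cobar.tmul_add tZero)

noncomputable def Cobar.coordOne (N : GradedCoaction 0) (s : ℕ) : Cobar N (s + 1) →+ Cobar N s :=
  Ten.coordOne (Cobar N s)

noncomputable def Cobar.coordT (N : GradedCoaction 0) (s : ℕ) : Cobar N (s + 1) →+ Cobar N s :=
  Ten.coordT (Cobar N s)

theorem Cobar.eq_add {s : ℕ} (z : Cobar N (s + 1)) :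
    z = Cobar.consOne N s (Cobar.coordOne N s z) + Cobar.consT N s (Cobar.coordT N s z) :=
  Ten.eq_add (N := Cobar N s) z

theorem Cobar.add_inj {s : ℕ} {x y x' y' : Cobar N s}
    (h : Cobar.consOne N s x + Cobar.consT N s y = Cobar.consOne N s x' + Cobar.consT N s y') :
    x = x' ∧ y = y' :=
  Ten.add_inj (N := Cobar N s) h

theorem Cobar.add_eq_zero {s : ℕ} {x y : Cobar N s}
    (h : Cobar.consOne N s x + Cobar.consT N s y = 0) : x = 0 ∧ y = 0 :=
  Cobar.add_inj (by rw [h, map_zero, map_zero, add_zero])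

theorem Cobar.d_eq {s : ℕ} (x : Cobar N s) :
    Cobar.d N s x = Cobar.consOne N s x + Cobar.inner N s x := rfl

theorem Cobar.add_self {s : ℕ} (x : Cobar N s) : x + x = 0 := add_self_M2 x

theorem Cobar.inner_eq {s : ℕ} (x : Cobar N s) :
    Cobar.inner N s x = Cobar.consOne N s x + Cobar.d N s x := by
  rw [Cobar.d_eq, ← add_assoc, Cobar.add_self, zero_add]

theorem Cobar.inner_consOne {s : ℕ} (x : Cobar N s) :
    Cobar.inner N (s + 1) (Cobar.consOne N s x) = Cobar.consOne N (s + 1) (Cobar.d N s x) := by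
  have h : Cobar.delta N s (Cobar.tmul N 1 x) = Cobar.consOne N (s + 1) (Cobar.consOne N s x) :=
    Ten.delta_one (N := Cobar N s) x
  rw [Cobar.d_eq, map_add, ← h]
  exact Cobar.inner_tmul 1 x

theorem Cobar.inner_consT {s : ℕ} (x : Cobar N s) : Cobar.inner N (s + 1) (Cobar.consT N s x) =
    Cobar.consOne N (s + 1) (Cobar.consT N s x) + Cobar.consT N (s + 1) (Cobar.d N s x) := by
  have h : Cobar.delta N s (Cobar.tmul N tZero x) =
      Cobar.consT N (s + 1) (Cobar.consOne N s x) + Cobar.consOne N (s + 1) (Cobar.consT N s x) :=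
    Ten.delta_t (N := Cobar N s) x
  have h' : Cobar.inner N (s + 1) (Cobar.consT N s x) = Cobar.delta N s (Cobar.tmul N tZero x) +
      Cobar.consT N (s + 1) (Cobar.inner N s x) := Cobar.inner_tmul tZero x
  rw [h', h, Cobar.d_eq, map_add]
  abel

/-- The first coface gives 1 ⊗ 1 ⊗ x and the others 1 ⊗ dx; the terms 1 ⊗ 1 ⊗ x cancel. Prefixing 1
thus turns d into `Cobar.inner`, while prefixing τ_0 commutes with d. -/
theorem Cobar.d_consOne {s : ℕ} (x : Cobar N s) :
    Cobar.d N (s + 1) (Cobar.consOne N s x) = Cobar.consOne N (s + 1) (Cobar.inner N s x) := by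
  rw [Cobar.d_eq, Cobar.inner_consOne, Cobar.inner_eq, map_add]

theorem Cobar.d_consT {s : ℕ} (x : Cobar N s) :
    Cobar.d N (s + 1) (Cobar.consT N s x) = Cobar.consT N (s + 1) (Cobar.d N s x) := by
  rw [Cobar.d_eq, Cobar.inner_consT, ← add_assoc, Cobar.add_self, zero_add]

/-- Without its first coface the cobar complex is acyclic. For z = 1 ⊗ x + τ_0 ⊗ y the 1-coordinate
of `inner z` is dx + τ_0 ⊗ y; its vanishing gives z = 1 ⊗ x + dx, which is `inner x`. -/
theorem Cobar.inner_eq_zero {s : ℕ} {z : Cobar N (s + 1)} (h : Cobar.inner N (s + 1) z = 0) :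
    z = Cobar.inner N s (Cobar.coordOne N s z) := by
  have hz := Cobar.eq_add z
  set x := Cobar.coordOne N s z
  set y := Cobar.coordT N s z
  rw [hz, map_add, Cobar.inner_consOne, Cobar.inner_consT, ← add_assoc, ← map_add] at h
  have h1 := (Cobar.add_eq_zero h).1
  rw [hz, Cobar.inner_eq]
  congr 1
  rw [← add_zero (Cobar.consT N s y), ← h1, add_comm (Cobar.d N s x), ← add_assoc,
    Cobar.add_self, zero_add]

/-- The part of the coaction of `A(0)^∨` along `τ_0`. -/
noncomputable def GradedCoaction.bock (N : GradedCoaction 0) : N.X →+ N.X :=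
  (Ten.coordT N.X).comp N.coact.toAddMonoidHom

/-- The coaction of `A(0)^∨` is counital. -/
def GradedCoaction.Counital (N : GradedCoaction 0) : Prop :=
  ∀ x, Ten.coordOne N.X (N.coact x) = x

theorem GradedCoaction.Counital.coact_eq (hN : N.Counital) (x : N.X) :
    N.coact x = Ten.tmul 0 1 x + Ten.tmul 0 tZero (N.bock x) := by
  have h := Ten.eq_add (N.coact x)
  rwa [hN x] at h

/-- The coaction is linear for the left unit, so comparing τ_0-coordinates with `Ten.smul_one`
produces the twist. -/
theorem GradedCoaction.Counital.bock_smul (hN : N.Counital) (r : M2) (x : N.X) :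
    N.bock (r • x) = bockstein r • x + r • N.bock x := by
  have h : N.coact (r • x) = r • N.coact x := map_smul _ _ _
  rw [hN.coact_eq, hN.coact_eq, smul_add, Ten.smul_one, Ten.smul_t, add_assoc, ← Ten.tmul_add] at h
  exact (Ten.add_inj h).2

/-- The map `GradedCoaction.bock` on the cobar complex in degree zero. -/
noncomputable def Cobar.bock (N : GradedCoaction 0) : Cobar N 0 →+ Cobar N 0 := N.bock

theorem Cobar.d_zero (hN : N.Counital) (x : Cobar N 0) :
    Cobar.d N 0 x = Cobar.consT N 0 (Cobar.bock N x) := by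
  have h : Cobar.inner N 0 x = Cobar.consOne N 0 x + Cobar.consT N 0 (Cobar.bock N x) :=
    hN.coact_eq x
  rw [Cobar.d_eq, h, ← add_assoc, Cobar.add_self]
  exact zero_add _

theorem Cobar.inner_zero_eq_zero (hN : N.Counital) {x : Cobar N 0} (h : Cobar.inner N 0 x = 0) :
    x = 0 := by
  have h' : Ten.coordOne N.X (N.coact x) = 0 := by
    have : N.coact x = 0 := h
    rw [this, map_zero]
  rw [hN x] at h'
  exact h'

/-- The inductive step of the computation of Ext. For a cocycle 1 ⊗ x + τ_0 ⊗ y the two coordinates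
of the differential give `inner x = 0` and dy = 0. Acyclicity writes x as `inner w`, or x = 0 in the
lowest degree by the counit, so 1 ⊗ x = d(1 ⊗ w) is a coboundary. -/
theorem Cobar.exists_of_mem_Z (hN : N.Counital) {s : ℕ} {z : Cobar N (s + 1)}
    (hz : z ∈ Cobar.Z N (s + 1)) : Cobar.coordT N s z ∈ Cobar.Z N s ∧
      z - Cobar.consT N s (Cobar.coordT N s z) ∈ Cobar.B N (s + 1) := by
  have hz' := Cobar.eq_add z
  set x := Cobar.coordOne N s z
  set y := Cobar.coordT N s z
  have h : Cobar.d N (s + 1) z = 0 := hz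
  rw [hz', map_add, Cobar.d_consOne, Cobar.d_consT] at h
  obtain ⟨h1, h2⟩ := Cobar.add_eq_zero h
  refine ⟨h2, ?_⟩
  have e : z - Cobar.consT N s y = Cobar.consOne N s x := by rw [hz']; abel
  rw [e]
  cases s with
  | zero =>
    rw [Cobar.inner_zero_eq_zero hN h1, map_zero]
    exact zero_mem _
  | succ s =>
    rw [Cobar.inner_eq_zero h1, ← Cobar.d_consOne]
    exact ⟨_, rfl⟩

theorem Cobar.consT_mem_B {s : ℕ} {y : Cobar N (s + 1)} :
    Cobar.consT N (s + 1) y ∈ Cobar.B N (s + 2) ↔ y ∈ Cobar.B N (s + 1) := by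
  constructor
  · rintro ⟨w, hw⟩
    rw [Cobar.eq_add w, map_add, Cobar.d_consOne, Cobar.d_consT,
      ← zero_add (Cobar.consT N (s + 1) y), ← map_zero (Cobar.consOne N (s + 1))] at hw
    exact ⟨_, (Cobar.add_inj hw).2⟩
  · rintro ⟨w, rfl⟩
    exact ⟨_, Cobar.d_consT w⟩

/-- The one place where coboundaries depend on N: d in degree 0 is τ_0 ⊗ β. Higher degrees reduce to
this by stripping factors τ_0. -/
theorem Cobar.consT_zero_mem_B (hN : N.Counital) {y : Cobar N 0} :
    Cobar.consT N 0 y ∈ Cobar.B N 1 ↔ ∃ w, Cobar.bock N w = y := by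
  constructor
  · rintro ⟨w, hw⟩
    rw [Cobar.d_zero hN, ← zero_add (Cobar.consT N 0 y),
      ← zero_add (Cobar.consT N 0 (Cobar.bock N w)), ← map_zero (Cobar.consOne N 0)] at hw
    exact ⟨w, (Cobar.add_inj hw).2⟩
  · rintro ⟨w, rfl⟩
    exact ⟨w, Cobar.d_zero hN w⟩

/-- `τ_0 ⊗ ⋯ ⊗ τ_0 ⊗ y`. -/
noncomputable def Cobar.consTPow (N : GradedCoaction 0) : ∀ f : ℕ, N.X →+ Cobar N f
  | 0 => AddMonoidHom.id N.X
  | f + 1 => (Cobar.consT N f).comp (Cobar.consTPow N f)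

theorem Cobar.consTPow_succ (f : ℕ) (y : N.X) :
    Cobar.consTPow N (f + 1) y = Cobar.consT N f (Cobar.consTPow N f y) := rfl

theorem Cobar.consTPow_mem_Z (hN : N.Counital) (f : ℕ) {y : N.X} (hy : N.bock y = 0) :
    Cobar.consTPow N f y ∈ Cobar.Z N f := by
  induction f with
  | zero =>
    exact (Cobar.d_zero hN y).trans ((congrArg (Cobar.consT N 0) hy).trans (map_zero _))
  | succ f ih =>
    rw [Cobar.mem_Z, Cobar.consTPow_succ, Cobar.d_consT, Cobar.mem_Z.mp ih, map_zero]

theorem Cobar.consTPow_mem_B (hN : N.Counital) (f : ℕ) {y : N.X} :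
    Cobar.consTPow N (f + 1) y ∈ Cobar.B N (f + 1) ↔ ∃ w, N.bock w = y := by
  induction f with
  | zero => exact Cobar.consT_zero_mem_B hN
  | succ f ih => rw [Cobar.consTPow_succ, Cobar.consT_mem_B, ih]

/-- The iterated coefficient of `τ_0 ⊗ ⋯ ⊗ τ_0`. -/
noncomputable def Cobar.coordTPow (N : GradedCoaction 0) : ∀ f : ℕ, Cobar N f →+ N.X
  | 0 => AddMonoidHom.id N.X
  | f + 1 => (Cobar.coordTPow N f).comp (Cobar.coordT N f)

theorem Cobar.exists_of_mem_Z_pow (hN : N.Counital) {f : ℕ} {z : Cobar N f}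
    (hz : z ∈ Cobar.Z N f) : N.bock (Cobar.coordTPow N f z) = 0 ∧
      z - Cobar.consTPow N f (Cobar.coordTPow N f z) ∈ Cobar.B N f := by
  induction f with
  | zero =>
    refine ⟨?_, ?_⟩
    · have h : Cobar.d N 0 z = 0 := hz
      rw [Cobar.d_zero hN] at h
      refine (Cobar.add_eq_zero (N := N) (s := 0) (x := 0) (y := Cobar.bock N z) ?_).2
      rw [h, map_zero, add_zero]
    · change z - z ∈ _
      rw [sub_self]
      exact zero_mem _
  | succ f ih =>
    obtain ⟨h1, h2⟩ := Cobar.exists_of_mem_Z hN hz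
    obtain ⟨h3, h4⟩ := ih h1
    refine ⟨h3, ?_⟩
    have h5 : Cobar.consT N f (Cobar.coordT N f z -
        Cobar.consTPow N f (Cobar.coordTPow N f (Cobar.coordT N f z))) ∈ Cobar.B N (f + 1) := by
      -- In degree 0 there are no coboundaries, so the inductive hypothesis is an equality; in
      -- higher degrees prefixing τ_0 preserves coboundaries.
      cases f with
      | zero =>
        have : Cobar.coordT N 0 z - Cobar.consTPow N 0 (Cobar.coordTPow N 0 (Cobar.coordT N 0 z)) = 0 :=
          h4
        rw [this, map_zero]
        exact zero_mem _
      | succ f => exact Cobar.consT_mem_B.mpr h4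
    have h6 := add_mem h2 h5
    rwa [map_sub, sub_add_sub_cancel] at h6

/-- The class of `τ_0 ⊗ ⋯ ⊗ τ_0 ⊗ y`. -/
noncomputable def Ext.ofKer (hN : N.Counital) (f : ℕ) : N.bock.ker →+ Ext N f :=
  (Ext.mk N f).comp (((Cobar.consTPow N f).comp N.bock.ker.subtype).codRestrict _
    fun y => Cobar.consTPow_mem_Z hN f y.2)

theorem Ext.mk_eq_mk {f : ℕ} {x y : Cobar.Z N f} (h : (x : Cobar N f) - y ∈ Cobar.B N f) :
    Ext.mk N f x = Ext.mk N f y := by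
  rw [← sub_eq_zero, ← map_sub]
  exact (QuotientAddGroup.eq_zero_iff _).mpr h

theorem Ext.mk_eq_ofKer (hN : N.Counital) {f : ℕ} (z : Cobar.Z N f) : Ext.mk N f z =
    Ext.ofKer hN f ⟨Cobar.coordTPow N f z, (Cobar.exists_of_mem_Z_pow hN z.2).1⟩ :=
  Ext.mk_eq_mk (Cobar.exists_of_mem_Z_pow hN z.2).2

theorem Ext.ofKer_surjective (hN : N.Counital) (f : ℕ) : Function.Surjective (Ext.ofKer hN f) := by
  intro x
  obtain ⟨z, rfl⟩ := QuotientAddGroup.mk'_surjective _ x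
  exact ⟨_, (Ext.mk_eq_ofKer hN z).symm⟩

theorem Ext.ofKer_eq_zero_iff (hN : N.Counital) (f : ℕ) (y : N.bock.ker) :
    Ext.ofKer hN f y = 0 ↔ Cobar.consTPow N f y ∈ Cobar.B N f :=
  QuotientAddGroup.eq_zero_iff _

theorem Ext.ofKer_zero_eq_zero (hN : N.Counital) {y : N.bock.ker} (h : Ext.ofKer hN 0 y = 0) :
    y = 0 :=
  Subtype.ext ((Ext.ofKer_eq_zero_iff hN 0 y).mp h)

/-- Positive filtrations are all the homology of β, whereas filtration 0 is the whole kernel by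
`Ext.ofKer_zero_eq_zero`. The identity β² = 0 is not part of the data, so only boundaries that are
cycles are compared. -/
theorem Ext.ofKer_succ_eq_zero (hN : N.Counital) {f : ℕ} {y : N.bock.ker} :
    Ext.ofKer hN (f + 1) y = 0 ↔ ∃ w, N.bock w = y := by
  rw [Ext.ofKer_eq_zero_iff, Cobar.consTPow_mem_B hN]

theorem unit_coact (r : M2) : (unitCoaction 0).coact r = r • Ten.tmul 0 1 (1 : M2) := rfl

theorem unit_coact_eq (r : M2) : (unitCoaction 0).coact r =
    Ten.tmul 0 1 r + Ten.tmul 0 tZero (bockstein r) := by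
  rw [unit_coact, Ten.smul_one, smul_eq_mul, smul_eq_mul, mul_one, mul_one]

theorem unit_counital : (unitCoaction 0).Counital := by
  intro r
  refine (congrArg (Ten.coordOne M2) (unit_coact_eq r)).trans ?_
  exact (map_add _ _ _).trans ((congrArg₂ (· + ·) (Ten.coordOne_one (N := M2) r)
    (Ten.coordOne_t (N := M2) _)).trans (add_zero r))

theorem unit_bock (r : M2) : (unitCoaction 0).bock r = bockstein r := by
  change Ten.coordT M2 ((unitCoaction 0).coact r) = _
  rw [unit_coact_eq]
  exact (map_add _ _ _).trans ((congrArg₂ (· + ·) (Ten.coordT_one (N := M2) r)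
    (Ten.coordT_t (N := M2) _)).trans (zero_add _))

theorem Cobar.smul_consTPow (f : ℕ) (r : M2) (y : N.X) :
    r • Cobar.consTPow N f y = Cobar.consTPow N f (r • y) := by
  induction f with
  | zero => rfl
  | succ f ih =>
    rw [Cobar.consTPow_succ, Cobar.consTPow_succ, ← ih]
    exact Ten.smul_t (N := Cobar N f) r _

/-- Scalars pass through factors τ_0 without correction (`Cobar.smul_consTPow`), so juxtaposition
concatenates the strings of τ_0 and multiplies the last entries. -/
theorem Cobar.mul_consTPow (a b : ℕ) (r : M2) (y : N.X) :
    Cobar.mul N (Cobar.consTPow N b y) a (Cobar.consTPow (unitCoaction 0) a r) =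
      Cobar.consTPow N (b + a) (r • y) := by
  induction a with
  | zero => exact Cobar.smul_consTPow b r y
  | succ a ih =>
    exact (Cobar.mul_tmul _ tZero _).trans (congrArg (Cobar.tmul N tZero) ih)

theorem smul_mem_ker (hN : N.Counital) {r : M2} (hr : bockstein r = 0) {y : N.X}
    (hy : N.bock y = 0) : N.bock (r • y) = 0 := by
  rw [hN.bock_smul, hr, hy, zero_smul, smul_zero, add_zero]

theorem Ext.mul_ofKer (hN : N.Counital) (a b : ℕ) {r : M2} (hr : bockstein r = 0) {y : N.X}
    (hy : N.bock y = 0) :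
    Ext.mul N a b (Ext.ofKer unit_counital a ⟨r, (unit_bock r).trans hr⟩) (Ext.ofKer hN b ⟨y, hy⟩) =
      Ext.ofKer hN (b + a) ⟨r • y, smul_mem_ker hN hr hy⟩ :=
  congrArg (Ext.mk N (b + a)) (Subtype.ext (Cobar.mul_consTPow a b r y))

end Cobar

/-! ### The gradings: homogeneous Ext classes come from homogeneous cycles. -/

section Pieces

/-- A ring map that sends the variables to homogeneous elements sends weighted homogeneous
polynomials to homogeneous elements. -/
theorem map_mem_of_graded {ι Γ S : Type*} [AddCommMonoid Γ] [CommRing S] {w : ι → Γ}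
    (P : Γ → AddSubgroup S) (hone : 1 ∈ P 0)
    (hmul : ∀ a b x y, x ∈ P a → y ∈ P b → x * y ∈ P (a + b))
    (F : MvPolynomial ι (ZMod 2) →+* S) (hF : ∀ i, F (MvPolynomial.X i) ∈ P (w i))
    {c : Γ} {p : MvPolynomial ι (ZMod 2)} (hp : MvPolynomial.IsWeightedHomogeneous w p c) :
    F p ∈ P c := by
  have key : ∀ d : ι →₀ ℕ, F (MvPolynomial.monomial d 1) ∈ P (Finsupp.weight w d) := by
    intro d
    induction d using Finsupp.induction_linear with
    | zero => rw [map_zero, MvPolynomial.monomial_zero', map_one, map_one]; exact hone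
    | add d d' h h' =>
      rw [map_add, ← one_mul (1 : ZMod 2), ← MvPolynomial.monomial_mul, map_mul]
      exact hmul _ _ _ _ h h'
    | single i n =>
      rw [← MvPolynomial.X_pow_eq_monomial, map_pow, Finsupp.weight_single]
      induction n with
      | zero => rw [pow_zero, zero_smul]; exact hone
      | succ n ih => rw [pow_succ, succ_nsmul]; exact hmul _ _ _ _ ih (hF i)
  refine map_mem_of_isWeightedHomogeneous (P c) F.toAddMonoidHom (fun d hd a => ?_) hp
  obtain rfl | rfl : a = 0 ∨ a = 1 := by revert a; decide
  · rw [MvPolynomial.monomial_zero, map_zero]; exact zero_mem _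
  · rw [← hd]; exact key d

theorem one_mem_M2_piece : (1 : M2) ∈ M2.piece 0 := MvPolynomial.isWeightedHomogeneous_one _ _

theorem rho_mem_M2_piece : (MvPolynomial.X 0 : M2) ∈ M2.piece (-1, -1) :=
  MvPolynomial.isWeightedHomogeneous_X _ _ _

theorem tau_mem_M2_piece : (MvPolynomial.X 1 : M2) ∈ M2.piece (0, -1) :=
  MvPolynomial.isWeightedHomogeneous_X _ _ _

theorem DualA.mk_X_mem_piece (n : ℕ∞) (g : Gen) :
    DualA.mk n (MvPolynomial.X g) ∈ DualA.piece n (degGen g) :=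
  ⟨MvPolynomial.X g, MvPolynomial.isWeightedHomogeneous_X _ _ _, rfl⟩

theorem DualA.one_mem_piece (n : ℕ∞) : 1 ∈ DualA.piece n 0 :=
  ⟨1, MvPolynomial.isWeightedHomogeneous_one _ _, map_one (DualA.mk n)⟩

theorem DualA.mul_mem_piece (n : ℕ∞) (a b : ℤ × ℤ) (x y : DualA n) (hx : x ∈ DualA.piece n a)
    (hy : y ∈ DualA.piece n b) : x * y ∈ DualA.piece n (a + b) := by
  obtain ⟨p, hp, rfl⟩ := hx
  obtain ⟨q, hq, rfl⟩ := hy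
  exact ⟨p * q, MvPolynomial.IsWeightedHomogeneous.mul hp hq, map_mul (DualA.mk n) _ _⟩

theorem etaL_mem_piece (n : ℕ∞) {a : ℤ × ℤ} {r : M2} (hr : r ∈ M2.piece a) :
    etaL n r ∈ DualA.piece n a := by
  refine map_mem_of_graded (DualA.piece n) (DualA.one_mem_piece n) (DualA.mul_mem_piece n)
    (etaL n) (fun i => ?_) hr
  fin_cases i
  · exact (etaL_rho n) ▸ DualA.mk_X_mem_piece n Gen.rho
  · exact (etaL_tau n) ▸ DualA.mk_X_mem_piece n Gen.tau

/-- The homogeneous elements of degree `c` in `M2[ε]`, with `ε` in degree `(1, 0)`. -/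
noncomputable def dualNumberPiece (c : ℤ × ℤ) : AddSubgroup (DualNumber M2) :=
  (M2.piece c).comap (TrivSqZeroExt.fstHom M2 M2 M2).toLinearMap.toAddMonoidHom ⊓
    (M2.piece (c - (1, 0))).comap (TrivSqZeroExt.sndHom M2 M2).toAddMonoidHom

/-- The coefficients in `M2` of homogeneous elements of `A(0)^∨` are homogeneous. -/
theorem toDualNumber_mem {a : ℤ × ℤ} {γ : DualA 0} (hγ : γ ∈ DualA.piece 0 a) :
    toDualNumber γ ∈ dualNumberPiece a := by
  obtain ⟨p, hp, rfl⟩ := hγ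
  have h1 : (1 : DualNumber M2) ∈ dualNumberPiece 0 := ⟨one_mem_M2_piece, zero_mem (M2.piece _)⟩
  have heps : (DualNumber.eps : DualNumber M2) ∈ dualNumberPiece (1, 0) := by
    refine ⟨zero_mem (M2.piece _), ?_⟩
    change (1 : M2) ∈ M2.piece _
    rw [sub_self]
    exact one_mem_M2_piece
  have hinl : ∀ {c : ℤ × ℤ} {r : M2}, r ∈ M2.piece c →
      algebraMap M2 (DualNumber M2) r ∈ dualNumberPiece c := fun hr => ⟨hr, zero_mem (M2.piece _)⟩
  have hmul : ∀ a b x y, x ∈ dualNumberPiece a → y ∈ dualNumberPiece b →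
      x * y ∈ dualNumberPiece (a + b) := by
    rintro a b x y ⟨hx, hx'⟩ ⟨hy, hy'⟩
    refine ⟨mul_mem_M2_piece hx hy, ?_⟩
    have e1 : a + b - (1, 0) = a + (b - (1, 0)) := by abel
    have e2 : a + b - (1, 0) = b + (a - (1, 0)) := by abel
    change x.fst • y.snd + MulOpposite.op y.fst • x.snd ∈ M2.piece _
    refine add_mem ?_ ?_
    · rw [e1]; exact mul_mem_M2_piece hx hy'
    · rw [e2, op_smul_eq_smul]; exact mul_mem_M2_piece hy hx'
  refine map_mem_of_graded dualNumberPiece h1 hmul (toDualNumber.comp (DualA.mk 0)) (fun g => ?_) hp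
  rw [RingHom.comp_apply, toDualNumber_mk, MvPolynomial.coe_eval₂Hom, MvPolynomial.eval₂_X]
  rcases g with _ | _ | i | i
  · exact hinl rho_mem_M2_piece
  · refine add_mem (hinl tau_mem_M2_piece) ?_
    have := hmul _ _ _ _ (hinl rho_mem_M2_piece) heps
    simpa [degGen] using this
  · exact zero_mem _
  · rcases i with _ | i
    · exact heps
    · exact zero_mem _

variable {N : GradedCoaction 0}

/-- The grading of `N` is compatible with that of the coefficients. -/
def GradedCoaction.GradedModule (N : GradedCoaction 0) : Prop :=
  ∀ (a b : ℤ × ℤ) (r : M2) (x : N.X), r ∈ M2.piece a → x ∈ N.piece b → r • x ∈ N.piece (a + b)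

theorem Cobar.tmul_mem_piece {s : ℕ} {a b : ℤ × ℤ} {γ : DualA 0} {x : Cobar N s}
    (hγ : γ ∈ DualA.piece 0 a) (hx : x ∈ Cobar.piece N s b) :
    Cobar.tmul N (toAR 0 γ) x ∈ Cobar.piece N (s + 1) (a + b) :=
  AddSubgroup.subset_closure ⟨a, b, γ, x, hγ, hx, rfl, rfl⟩

theorem Cobar.smul_mem_piece (hN : N.GradedModule) {s : ℕ} {a b : ℤ × ℤ} {r : M2} {x : Cobar N s}
    (hr : r ∈ M2.piece a) (hx : x ∈ Cobar.piece N s b) : r • x ∈ Cobar.piece N s (a + b) := by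
  cases s with
  | zero => exact hN _ _ _ _ hr hx
  | succ s =>
    induction hx using AddSubgroup.closure_induction with
    | mem z hz =>
      obtain ⟨c, d, γ, x, hγ, hx, rfl, rfl⟩ := hz
      have e : r • Cobar.tmul N (toAR 0 γ) x = Cobar.tmul N (toAR 0 (etaL 0 r * γ)) x := by
        rw [map_mul]; exact Ten.smul_tmul (N := Cobar N s) 0 r _ _
      rw [e, ← add_assoc]
      exact Cobar.tmul_mem_piece (DualA.mul_mem_piece 0 _ _ _ _ (etaL_mem_piece 0 hr) hγ) hx
    | zero => rw [smul_zero]; exact zero_mem _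
    | add x y _ _ hx hy => rw [smul_add]; exact add_mem hx hy
    | neg x _ hx => rw [smul_neg]; exact neg_mem hx

/-- Each factor τ_0 has bidegree (1, 0), so removing it lowers the internal degree by one along with
the filtration. Hence the stem and weight of a class are the bidegree of its cycle. -/
theorem Cobar.coordT_mem_piece (hN : N.GradedModule) {s : ℕ} {c : ℤ × ℤ} {z : Cobar N (s + 1)}
    (hz : z ∈ Cobar.piece N (s + 1) c) : Cobar.coordT N s z ∈ Cobar.piece N s (c - (1, 0)) := by
  induction hz using AddSubgroup.closure_induction with
  | mem z hz =>
    obtain ⟨a, b, γ, x, hγ, hx, rfl, rfl⟩ := hz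
    have e : a + b - (1, 0) = a - (1, 0) + b := by abel
    rw [e]
    exact Cobar.smul_mem_piece hN (toDualNumber_mem hγ).2 hx
  | zero => rw [map_zero]; exact zero_mem _
  | add x y _ _ hx hy => rw [map_add]; exact add_mem hx hy
  | neg x _ hx => rw [map_neg]; exact neg_mem hx

theorem Cobar.coordTPow_mem_piece (hN : N.GradedModule) {f : ℕ} {s w : ℤ} {z : Cobar N f}
    (hz : z ∈ Cobar.piece N f (s + f, w)) : Cobar.coordTPow N f z ∈ N.piece (s, w) := by
  induction f with
  | zero =>
    have e : (s + (0 : ℕ), w) = (s, w) := by simp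
    rw [e] at hz
    exact hz
  | succ f ih =>
    have h := Cobar.coordT_mem_piece hN hz
    have e : ((s + (f + 1 : ℕ), w) : ℤ × ℤ) - (1, 0) = (s + f, w) := by
      ext <;> (simp; try ring)
    rw [e] at h
    exact ih h

theorem Cobar.consTPow_mem_piece {f : ℕ} {s w : ℤ} {y : N.X} (hy : y ∈ N.piece (s, w)) :
    Cobar.consTPow N f y ∈ Cobar.piece N f (s + f, w) := by
  induction f with
  | zero =>
    have e : (s + (0 : ℕ), w) = (s, w) := by simp
    rw [e]
    exact hy
  | succ f ih =>
    have e : ((s + (f + 1 : ℕ), w) : ℤ × ℤ) = (1, 0) + (s + f, w) := by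
      ext <;> simp; ring
    rw [e]
    exact Cobar.tmul_mem_piece (DualA.mk_X_mem_piece 0 (Gen.ta 0)) ih

theorem Ext.mem_piece_iff (hN : N.Counital) (hN' : N.GradedModule) {f : ℕ} {s w : ℤ} {x : Ext N f} :
    x ∈ Ext.piece N s f w ↔ ∃ y : N.bock.ker, (y : N.X) ∈ N.piece (s, w) ∧ Ext.ofKer hN f y = x := by
  constructor
  · rintro ⟨z, hz, rfl⟩
    exact ⟨_, Cobar.coordTPow_mem_piece hN' hz, (Ext.mk_eq_ofKer hN z).symm⟩
  · rintro ⟨y, hy, rfl⟩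
    exact ⟨⟨_, Cobar.consTPow_mem_Z hN f y.2⟩, Cobar.consTPow_mem_piece hy, rfl⟩

end Pieces

/-! ### Comodules that are copies of the coefficients up to an acyclic summand. -/

section Splitting

theorem bockstein_one : bockstein (1 : M2) = 0 := bockstein.map_one_eq_zero

/-- A comodule over `A(0)^∨` that splits, up to an acyclic summand, as a sum of shifted copies of the
coefficients. -/
structure Splitting (N : GradedCoaction 0) (ι : Type) [Fintype ι] [DecidableEq ι] where
  counital : N.Counital
  gradedModule : N.GradedModule
  proj : ι → N.X →ₗ[M2] M2
  gen : ι → N.X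
  deg : ι → ℤ × ℤ
  proj_gen : ∀ i j, proj i (gen j) = if i = j then 1 else 0
  bock_gen : ∀ i, N.bock (gen i) = 0
  proj_bock : ∀ i x, proj i (N.bock x) = bockstein (proj i x)
  exact : ∀ x, N.bock x = 0 → (∀ i, proj i x = 0) → ∃ w, N.bock w = x
  proj_mem : ∀ i c x, x ∈ N.piece c → proj i x ∈ M2.piece (c - deg i)
  gen_mem : ∀ i, gen i ∈ N.piece (deg i)

namespace Splitting

variable {N : GradedCoaction 0} {ι : Type} [Fintype ι] [DecidableEq ι] (S : Splitting N ι)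

/-- The element with given projections. -/
noncomputable def comb (r : ι → M2) : N.X := ∑ i, r i • S.gen i

theorem proj_comb (r : ι → M2) (i : ι) : S.proj i (S.comb r) = r i := by
  simp [comb, S.proj_gen]

theorem bock_comb (r : ι → M2) : N.bock (S.comb r) = S.comb fun i => bockstein (r i) := by
  rw [comb, map_sum]
  refine Finset.sum_congr rfl fun i _ => ?_
  rw [S.counital.bock_smul, S.bock_gen, smul_zero, add_zero]

theorem bock_comb_eq_zero {r : ι → M2} (hr : ∀ i, bockstein (r i) = 0) :
    N.bock (S.comb r) = 0 := by
  rw [S.bock_comb]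
  exact Finset.sum_eq_zero fun i _ => by simp only [hr, zero_smul]

theorem comb_mem {c : ℤ × ℤ} {r : ι → M2} (hr : ∀ i, r i ∈ M2.piece (c - S.deg i)) :
    S.comb r ∈ N.piece c := by
  refine sum_mem fun i _ => ?_
  have h := S.gradedModule _ _ _ _ (hr i) (S.gen_mem i)
  rwa [sub_add_cancel] at h

theorem bockstein_proj {y : N.X} (hy : N.bock y = 0) (i : ι) : bockstein (S.proj i y) = 0 := by
  rw [← S.proj_bock, hy, map_zero]

/-- A cycle is a boundary as soon as its coordinates are: subtracting β of the combination of their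
primitives leaves a cycle with zero coordinates, to which acyclicity applies. -/
theorem exists_bock {y : N.X} (hy : N.bock y = 0)
    (h : ∀ i, ∃ r, bockstein r = S.proj i y) : ∃ w, N.bock w = y := by
  choose r hr using h
  obtain ⟨w, hw⟩ := S.exact (y - N.bock (S.comb r))
    (by
      have e : N.bock (N.bock (S.comb r)) = 0 := by
        rw [S.bock_comb]
        exact S.bock_comb_eq_zero fun i => by rw [hr, S.bockstein_proj hy]
      rw [map_sub, hy, e, sub_zero])
    (fun i => by rw [map_sub, S.bock_comb, S.proj_comb, hr, sub_self])
  exact ⟨w + S.comb r, by rw [map_add, hw, sub_add_cancel]⟩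

noncomputable def kerToRing (f : ℕ) : N.bock.ker →+ (ι → HRing) :=
  AddMonoidHom.mk' (fun y i => hMul f (S.proj i y)) (fun x y => by
    funext i
    simp [map_add])

/-- The map `Ext^f(N) → ⨁ 𝔽₂[ρ, τ², h_0] / (ρ h_0)`. -/
noncomputable def extToRing (f : ℕ) : Ext N f →+ (ι → HRing) :=
  (Ext.ofKer S.counital f).liftOfSurjective (Ext.ofKer_surjective S.counital f) ⟨S.kerToRing f, by
    intro y hy
    rw [AddMonoidHom.mem_ker] at hy ⊢
    cases f with
    | zero => rw [Ext.ofKer_zero_eq_zero S.counital hy, map_zero]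
    | succ f =>
      obtain ⟨w, hw⟩ := (Ext.ofKer_succ_eq_zero S.counital).mp hy
      funext i
      change hMul (f + 1) (S.proj i y) = 0
      rw [← hw, S.proj_bock, hMul_bockstein]⟩

theorem extToRing_ofKer (f : ℕ) (y : N.bock.ker) (i : ι) :
    S.extToRing f (Ext.ofKer S.counital f y) i = hMul f (S.proj i y) :=
  congrFun (AddMonoidHom.liftOfRightInverse_comp_apply _ _ _ _ y) i

/-- The map `Ext(N) → ⨁ 𝔽₂[ρ, τ², h_0] / (ρ h_0)`. -/
noncomputable def toRing : TotalExt N →+ (ι → HRing) := DirectSum.toAddMonoid S.extToRing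

theorem toRing_of (f : ℕ) (x : Ext N f) : S.toRing (Ext.of N f x) = S.extToRing f x :=
  DirectSum.toAddMonoid_of _ _ _

/-- Both Ext classes are represented by cycles, whose product is the scalar action; the projections
are linear and `hMul` is multiplicative when one factor is a cycle. -/
theorem extToRing_mul (a b : ℕ) (x : Ext (unitCoaction 0) a) (y : Ext N b)
    (U : Splitting (unitCoaction 0) Unit) (hU : ∀ r, U.proj () r = r) (i : ι) :
    S.extToRing (b + a) (Ext.mul N a b x y) i = U.extToRing a x () * S.extToRing b y i := by
  obtain ⟨⟨r', hr⟩, rfl⟩ := Ext.ofKer_surjective unit_counital a x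
  obtain ⟨⟨y, hy⟩, rfl⟩ := Ext.ofKer_surjective S.counital b y
  let r : M2 := r'
  have hr' : bockstein r = 0 := (unit_bock r).symm.trans hr
  have h1 : U.extToRing a (Ext.ofKer unit_counital a ⟨r, hr⟩) () = hMul a r :=
    (U.extToRing_ofKer a ⟨r, hr⟩ ()).trans (congrArg (hMul a) (hU r))
  have h2 := Ext.mul_ofKer S.counital a b hr' hy
  have h3 : S.proj i (r • y) = r • S.proj i y := map_smul _ _ _
  rw [h1, S.extToRing_ofKer]
  refine (congrFun (congrArg (S.extToRing (b + a)) h2) i).trans ?_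
  rw [S.extToRing_ofKer, h3, smul_eq_mul, hMul_mul a b hr']

/-- The ring is spanned by the elements y h_0^f with y a cycle, and each copy of such an element is
hit by y times the corresponding generator. -/
theorem toRing_surjective : Function.Surjective S.toRing := by
  have key : ∀ i (x : HRing), (Pi.single i x : ι → HRing) ∈ S.toRing.range := by
    intro i x
    refine hRing_induction (P := S.toRing.range.comap (AddMonoidHom.single (fun _ => HRing) i))
      (fun f y hy => ?_) x
    have hz : N.bock (S.comb (Pi.single i y)) = 0 := by
      refine S.bock_comb_eq_zero fun j => ?_
      rcases eq_or_ne j i with rfl | h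
      · rw [Pi.single_eq_same, hy]
      · rw [Pi.single_eq_of_ne h, map_zero]
    refine ⟨Ext.of N f (Ext.ofKer S.counital f ⟨_, hz⟩), ?_⟩
    rw [S.toRing_of]
    funext j
    rw [S.extToRing_ofKer, S.proj_comb]
    exact (Pi.apply_single (fun _ => hMul f) (fun _ => map_zero _) i y j)
  intro v
  rw [← AddMonoidHom.mem_range, ← Finset.univ_sum_single v]
  exact sum_mem fun i _ => key i _

theorem hCoeff_toRing (z : TotalExt N) (f : ℕ) (i : ι) :
    hCoeff f (S.toRing z i) = hCoeff f (S.extToRing f (z f) i) := by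
  induction z using DirectSum.induction_on with
  | zero => simp only [map_zero, DirectSum.zero_apply]
  | of g x =>
    have e : S.toRing (DirectSum.of (Ext N) g x) = S.extToRing g x := S.toRing_of g x
    rw [e]
    rcases eq_or_ne g f with rfl | h
    · rw [DirectSum.of_eq_same]
    · rw [DirectSum.of_eq_of_ne _ _ _ h.symm, map_zero, Pi.zero_apply, map_zero]
      obtain ⟨y, rfl⟩ := Ext.ofKer_surjective S.counital g x
      rw [S.extToRing_ofKer, hCoeff_hMul, if_neg h.symm]
  | add x y hx hy => simp only [map_add, Pi.add_apply, DirectSum.add_apply, hx, hy]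

theorem modH_toRing (z : TotalExt N) (i : ι) :
    HRing.modH (S.toRing z i) = HRing.modH (S.extToRing 0 (z 0) i) := by
  induction z using DirectSum.induction_on with
  | zero => simp only [map_zero, DirectSum.zero_apply]
  | of g x =>
    have e : S.toRing (DirectSum.of (Ext N) g x) = S.extToRing g x := S.toRing_of g x
    rw [e]
    cases g with
    | zero => rw [DirectSum.of_eq_same]
    | succ g =>
      rw [DirectSum.of_eq_of_ne _ _ _ (Nat.succ_ne_zero g).symm, map_zero, Pi.zero_apply, map_zero]
      obtain ⟨y, rfl⟩ := Ext.ofKer_surjective S.counital (g + 1) x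
      rw [S.extToRing_ofKer, modH_hMul_succ]
  | add x y hx hy => simp only [map_add, Pi.add_apply, DirectSum.add_apply, hx, hy]

/-- Vanishing modulo ρ makes every coordinate of the representing cycle a boundary. In positive
filtration the acyclic complement contributes nothing further. -/
theorem eq_zero_of_hCoeff {f : ℕ} {x : Ext N (f + 1)}
    (h : ∀ i, hCoeff (f + 1) (S.extToRing (f + 1) x i) = 0) : x = 0 := by
  obtain ⟨⟨y, hy⟩, rfl⟩ := Ext.ofKer_surjective S.counital (f + 1) x
  refine (Ext.ofKer_succ_eq_zero S.counital).mpr (S.exists_bock hy fun i => ?_)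
  have hi := h i
  rw [S.extToRing_ofKer] at hi
  exact exists_bockstein_of_hCoeff (S.bockstein_proj hy i) hi

theorem extToRing_eq_zero {f : ℕ} (hf : 0 < f) {x : Ext N f} (h : S.extToRing f x = 0) : x = 0 := by
  obtain ⟨f, rfl⟩ := Nat.exists_eq_succ_of_ne_zero hf.ne'
  exact S.eq_zero_of_hCoeff fun i => by rw [h, Pi.zero_apply, map_zero]

/-- The kernel is concentrated in filtration 0: this is why T consists of filtration-0 classes. -/
theorem eq_of_of_toRing_eq_zero {z : TotalExt N} (h : S.toRing z = 0) :
    z = Ext.of N 0 (z 0) := by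
  refine DFinsupp.ext fun f => ?_
  change z f = (DirectSum.of (Ext N) 0 (z 0)) f
  cases f with
  | zero => rw [DirectSum.of_eq_same]
  | succ f =>
    rw [DirectSum.of_eq_of_ne _ _ _ (Nat.succ_ne_zero f)]
    exact S.eq_zero_of_hCoeff fun i => by
      rw [← S.hCoeff_toRing, h, Pi.zero_apply, map_zero]

/-- Only the filtration-0 component remains. Reduction modulo h_0 determines the coordinates of its
cycle, and `hS` says that there is no acyclic complement to hide in. -/
theorem toRing_injective (hS : ∀ x, (∀ i, S.proj i x = 0) → x = 0) :
    Function.Injective S.toRing := by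
  rw [injective_iff_map_eq_zero]
  intro z hz
  rw [S.eq_of_of_toRing_eq_zero hz]
  suffices h : z 0 = 0 by rw [h, map_zero]
  have hi : ∀ i, HRing.modH (S.extToRing 0 (z 0) i) = 0 := fun i => by
    rw [← S.modH_toRing, hz, Pi.zero_apply, map_zero]
  generalize z 0 = x at hi
  obtain ⟨⟨y, hy⟩, rfl⟩ := Ext.ofKer_surjective S.counital 0 x
  have : y = 0 := hS y fun i => by
    have h := hi i
    rw [S.extToRing_ofKer, modH_hMul_zero] at h
    rw [← tauSq_evenPart (S.bockstein_proj hy i), h, map_zero]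
  subst this
  exact map_zero _

/-- The harder inclusion chooses a homogeneous cycle for each coordinate and combines them along the
homogeneous generators; no homogeneity of the acyclic part is needed. -/
theorem map_piece (s : ℤ) (f : ℕ) (w : ℤ) :
    (Ext.piece N s f w).map (S.extToRing f) =
      AddSubgroup.pi Set.univ fun i => HRing.piece (s - (S.deg i).1) f (w - (S.deg i).2) := by
  apply le_antisymm
  · rintro _ ⟨x, hx, rfl⟩ i -
    obtain ⟨y, hy, rfl⟩ := (Ext.mem_piece_iff S.counital S.gradedModule).mp hx
    change S.extToRing f _ i ∈ _
    rw [S.extToRing_ofKer]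
    exact hMul_mem_piece f (S.proj_mem i _ _ hy)
  · intro v hv
    have h : ∀ i, ∃ y ∈ M2.piece ((s, w) - S.deg i), bockstein y = 0 ∧ hMul f y = v i :=
      fun i => exists_of_mem_hRing_piece (hv i trivial)
    choose r hr hr' hv' using h
    have hz : N.bock (S.comb r) = 0 := S.bock_comb_eq_zero hr'
    refine ⟨Ext.ofKer S.counital f ⟨_, hz⟩,
      (Ext.mem_piece_iff S.counital S.gradedModule).mpr ⟨_, S.comb_mem hr, rfl⟩, ?_⟩
    funext i
    rw [S.extToRing_ofKer, S.proj_comb, hv']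

end Splitting

/-- The identity of the coefficients. -/
noncomputable def unitProj : (unitCoaction 0).X →ₗ[M2] M2 where
  toFun x := x
  map_add' _ _ := rfl
  map_smul' _ _ := rfl

/-- The coefficients split. -/
noncomputable def unitSplitting : Splitting (unitCoaction 0) Unit where
  counital := unit_counital
  gradedModule := fun _ _ _ _ hr hx => mul_mem_M2_piece hr hx
  proj := fun _ => unitProj
  gen := fun _ => (1 : M2)
  deg := fun _ => 0
  proj_gen := fun _ _ => (if_pos rfl).symm
  bock_gen := fun _ => (unit_bock 1).trans bockstein_one
  proj_bock := fun _ x => unit_bock x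
  exact := fun x _ h => ⟨0, (map_zero _).trans (h ()).symm⟩
  proj_mem := fun _ c x hx => by
    rw [sub_zero]
    exact hx
  gen_mem := fun _ => one_mem_M2_piece

end Splitting

/-! ### The Ext ring of the coefficients. -/

section Final

/-- The isomorphism of the total `Ext` ring with `𝔽₂[ρ, τ², h_0] / (ρ h_0)`. -/
noncomputable def unitEquiv : TotalExt (unitCoaction 0) ≃+ HRing :=
  AddEquiv.ofBijective ((Pi.evalAddMonoidHom (fun _ : Unit => HRing) ()).comp unitSplitting.toRing) (by
    refine ⟨fun x y h => ?_, fun v => ?_⟩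
    · refine unitSplitting.toRing_injective (fun x hx => hx ()) (funext fun _ => h)
    · obtain ⟨x, hx⟩ := unitSplitting.toRing_surjective (fun _ => v)
      exact ⟨x, congrFun hx ()⟩)

theorem unitEquiv_of (f : ℕ) (x : Ext (unitCoaction 0) f) :
    unitEquiv (Ext.of _ f x) = unitSplitting.extToRing f x () :=
  congrFun (unitSplitting.toRing_of f x) ()

theorem unitEquiv_ofKer (f : ℕ) (r : M2) (hr : (unitCoaction 0).bock r = 0) :
    unitEquiv (Ext.of _ f (Ext.ofKer unit_counital f ⟨r, hr⟩)) = hMul f r := by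
  rw [unitEquiv_of]
  exact unitSplitting.extToRing_ofKer f ⟨r, hr⟩ ()

theorem unitEquiv_mk_zero (r : M2) (hr : bockstein r = 0)
    (hr' : r ∈ Cobar.Z (unitCoaction 0) 0) :
    unitEquiv (Ext.of _ 0 (Ext.mk _ 0 ⟨r, hr'⟩)) = hMul 0 r :=
  unitEquiv_ofKer 0 r ((unit_bock r).trans hr)

theorem unitEquiv_rho : unitEquiv (Ext.of _ 0 rhoClass) = HRing.gen 0 := by
  refine (unitEquiv_mk_zero (MvPolynomial.X 0) bockstein_rho _).trans ?_
  -- The class is rewritten as a value of `tauSq`, on which `evenPart` is the inverse.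
  rw [hMul_apply, pow_zero, mul_one, ← tauSq_rho, evenPart_tauSq, HRing.incl_rho]

theorem unitEquiv_tauSq : unitEquiv (Ext.of _ 0 tauSqClass) = HRing.gen 1 := by
  refine (unitEquiv_mk_zero (MvPolynomial.X 1 ^ 2)
    (by rw [← tauSq_tau, bockstein_tauSq]) _).trans ?_
  rw [hMul_apply, pow_zero, mul_one, ← tauSq_tau, evenPart_tauSq, HRing.incl_tau]

theorem unitEquiv_hZero : unitEquiv (Ext.of _ 1 hZero) = HRing.gen 2 := by
  refine (unitEquiv_ofKer 1 1 ((unit_bock 1).trans bockstein_one)).trans ?_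
  rw [hMul_apply, pow_one, evenPart_one, map_one, one_mul]

theorem unitEquiv_mul (a b : ℕ) (x : Ext (unitCoaction 0) a) (y : Ext (unitCoaction 0) b) :
    unitEquiv (Ext.of _ (b + a) (Ext.mul _ a b x y)) =
      unitEquiv (Ext.of _ a x) * unitEquiv (Ext.of _ b y) := by
  rw [unitEquiv_of, unitEquiv_of, unitEquiv_of]
  exact unitSplitting.extToRing_mul a b x y unitSplitting (fun _ => rfl) ()

theorem unitEquiv_map_piece (s : ℤ) (f : ℕ) (w : ℤ) :
    (Ext.piece (unitCoaction 0) s f w).map (unitEquiv.toAddMonoidHom.comp (Ext.of _ f)) =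
      HRing.piece s f w := by
  have e : unitEquiv.toAddMonoidHom.comp (Ext.of _ f) =
      (Pi.evalAddMonoidHom (fun _ : Unit => HRing) ()).comp (unitSplitting.extToRing f) :=
    AddMonoidHom.ext fun x => unitEquiv_of f x
  rw [e, ← AddSubgroup.map_map, unitSplitting.map_piece]
  ext v
  constructor
  · rintro ⟨u, hu, rfl⟩
    simpa [unitSplitting] using hu () trivial
  · intro hv
    refine ⟨fun _ => v, fun i _ => ?_, rfl⟩
    simpa [unitSplitting] using hv

end Final

/-! ### A monomial basis of the dual Steenrod algebra, compatible with the weight filtration. -/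

section MonomialBasis

/-- The fraction field of the coefficients. -/
abbrev FracM2 : Type := FractionRing M2

/-- The polynomial ring in the `ξ_{i+1}` over the fraction field of the coefficients. -/
abbrev FracXi : Type := MvPolynomial ℕ FracM2

noncomputable def fracRho : FracXi := algebraMap M2 FracXi (MvPolynomial.X 0)
noncomputable def fracTau : FracXi := algebraMap M2 FracXi (MvPolynomial.X 1)
noncomputable def fracRhoInv : FracXi :=
  MvPolynomial.C (algebraMap M2 FracM2 (MvPolynomial.X 0))⁻¹

theorem fracRho_mul_inv : fracRho * fracRhoInv = 1 := by
  have h : algebraMap M2 FracM2 (MvPolynomial.X 0) ≠ 0 := by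
    rw [Ne, map_eq_zero_iff _ (IsFractionRing.injective M2 FracM2)]
    exact MvPolynomial.X_ne_zero 0
  rw [fracRho, fracRhoInv, IsScalarTower.algebraMap_apply M2 FracM2 FracXi, MvPolynomial.algebraMap_eq,
    ← map_mul, mul_inv_cancel₀ h, map_one]

/-- The image of `τ_i` after inverting `ρ`, as a polynomial in `τ_0`. -/
noncomputable def fracTa : ℕ → Polynomial FracXi
  | 0 => Polynomial.X
  | i + 1 => Polynomial.C fracRhoInv *
      (fracTa i ^ 2 - Polynomial.C (fracTau * MvPolynomial.X i))

theorem fracTa_sq (i : ℕ) : fracTa i ^ 2 = Polynomial.C (fracTau * MvPolynomial.X i) +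
    Polynomial.C fracRho * fracTa (i + 1) := by
  rw [fracTa, ← mul_assoc, ← map_mul, fracRho_mul_inv, map_one, one_mul]
  ring

theorem degree_fracTa (i : ℕ) : (fracTa i).degree = (2 ^ i : ℕ) := by
  induction i with
  | zero => simp [fracTa]
  | succ i ih =>
    have h0 : fracRhoInv ≠ 0 := fun h => by
      have := fracRho_mul_inv
      rw [h, mul_zero] at this
      exact zero_ne_one this
    have h1 : (fracTa i ^ 2).degree = (2 ^ (i + 1) : ℕ) := by
      rw [Polynomial.degree_pow, ih, pow_succ, ← Nat.cast_ofNat, nsmul_eq_mul]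
      norm_cast
      ring
    rw [fracTa, Polynomial.degree_mul, Polynomial.degree_C h0, zero_add,
      Polynomial.degree_sub_eq_left_of_degree_lt, h1]
    rw [h1]
    refine lt_of_le_of_lt Polynomial.degree_C_le ?_
    exact_mod_cast Nat.two_pow_pos (i + 1)

/-- The product over s has degree ∑ 2^i for i in s. Distinct finite sets have distinct sums by
uniqueness of binary expansion, and polynomials of distinct degrees over a domain are independent.
-/
theorem linearIndependent_fracTa :
    LinearIndependent FracXi fun s : Finset ℕ => ∏ i ∈ s, fracTa i := by
  have hd : ∀ s : Finset ℕ, (∏ i ∈ s, fracTa i).degree = (∑ i ∈ s, 2 ^ i : ℕ) := by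
    intro s
    rw [Polynomial.degree_prod]
    push_cast
    exact Finset.sum_congr rfl fun i _ => by rw [degree_fracTa]; norm_cast
  let S : Polynomial.Sequence FracXi :=
    -- The member of degree n is the product over the binary digits of n.
    { elems' := fun n => ∏ i ∈ n.bitIndices.toFinset, fracTa i
      degree_eq' := fun n => by rw [hd, Finset.sum_toFinset_bitIndices_two_pow] }
  have h := S.linearIndependent.comp (fun s : Finset ℕ => ∑ i ∈ s, 2 ^ i)
    (Finset.geomSum_injective le_rfl)
  have e : (fun s : Finset ℕ => ∏ i ∈ s, fracTa i) = S ∘ fun s : Finset ℕ => ∑ i ∈ s, 2 ^ i := by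
    funext s
    change _ = ∏ i ∈ (∑ i ∈ s, 2 ^ i).bitIndices.toFinset, fracTa i
    rw [Finset.toFinset_bitIndices_sum_two_pow]
  rw [e]
  exact h

/-- The images of the generators after inverting `ρ`. -/
noncomputable def fracGen : Gen → Polynomial FracXi
  | .rho => Polynomial.C fracRho
  | .tau => Polynomial.C fracTau
  | .xi i => Polynomial.C (MvPolynomial.X i)
  | .ta i => fracTa i

/-- The map from the dual Steenrod algebra to a polynomial ring, inverting `ρ`. -/
noncomputable def toFrac : DualA ⊤ →+* Polynomial FracXi :=
  Ideal.Quotient.lift _ (MvPolynomial.aeval (R := ZMod 2) fracGen :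
      Poly →ₐ[ZMod 2] Polynomial FracXi).toRingHom (by
    intro a ha
    refine (Ideal.span_le (I := RingHom.ker _)).mpr ?_ ha
    rintro p ((⟨i, rfl⟩ | ⟨N, i, hN, hi, rfl⟩) | ⟨N, i, hN, hi, rfl⟩)
    · simp [RingHom.mem_ker, taPoly, xiPoly, fracGen, fracTa_sq]
    · exact absurd hN (WithTop.top_ne_coe)
    · exact absurd hN (WithTop.top_ne_coe))

theorem toFrac_mk (p : Poly) : toFrac (DualA.mk ⊤ p) = MvPolynomial.aeval (R := ZMod 2) fracGen p :=
  rfl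

theorem toFrac_xi (i : ℕ) : toFrac (xi ⊤ (i + 1)) = Polynomial.C (MvPolynomial.X i) := by
  simp [xi, toFrac_mk, xiPoly, fracGen]

theorem toFrac_ta (i : ℕ) : toFrac (ta ⊤ i) = fracTa i := by
  simp [ta, toFrac_mk, taPoly, fracGen]

theorem toFrac_etaL (r : M2) : toFrac (etaL ⊤ r) = algebraMap M2 (Polynomial FracXi) r := by
  have : toFrac.comp (etaL ⊤) = algebraMap M2 (Polynomial FracXi) := by
    refine ringHom_M2_ext (S := Polynomial FracXi) ?_ ?_
    · rw [RingHom.comp_apply, etaL_rho, rho, toFrac_mk, MvPolynomial.aeval_X]; rfl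
    · rw [RingHom.comp_apply, etaL_tau, tau, toFrac_mk, MvPolynomial.aeval_X]; rfl
  exact DFunLike.congr_fun this r

noncomputable def toFracLinear : DualA ⊤ →ₗ[M2] Polynomial FracXi where
  toFun := toFrac
  map_add' := map_add toFrac
  map_smul' r x := by
    rw [Algebra.smul_def, algebraMap_A, map_mul, toFrac_etaL, ← Algebra.smul_def, RingHom.id_apply]

/-- Indices for the monomials `∏ ξ_{i+1} ^ a_i ∏_{i ∈ e} τ_i`. -/
abbrev MonIdx : Type := (ℕ →₀ ℕ) × Finset ℕ

/-- The monomial `∏ ξ_{i+1} ^ a_i ∏_{i ∈ e} τ_i`. -/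
noncomputable def mon (p : MonIdx) : DualA ⊤ :=
  (p.1.prod fun i n => xi ⊤ (i + 1) ^ n) * ∏ i ∈ p.2, ta ⊤ i

/-- It suffices to check independence after inverting ρ and passing to the fraction field of the
coefficients. There the ξ-monomials are a basis of the coefficient ring of the polynomials in τ_0,
over which the products of the τ_i are independent. -/
theorem linearIndependent_mon : LinearIndependent M2 mon := by
  have h1 : LinearIndependent FracM2 fun a : ℕ →₀ ℕ => (MvPolynomial.monomial a 1 : FracXi) := by
    have := (MvPolynomial.basisMonomials ℕ FracM2).linearIndependent
    rwa [MvPolynomial.coe_basisMonomials] at this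
  have h2 := linearIndependent_smul h1 linearIndependent_fracTa
  have h3 := LinearIndependent.restrict_scalars (R := M2) (K := FracM2) (by
    intro r s hrs
    simp only [Algebra.smul_def, mul_one] at hrs
    exact IsFractionRing.injective M2 FracM2 hrs) h2
  refine LinearIndependent.of_comp toFracLinear ?_
  convert h3 using 1
  funext p
  change toFrac (mon p) = _
  rw [mon, map_mul, map_finsuppProd, map_prod, Polynomial.smul_eq_C_mul, MvPolynomial.monomial_eq,
    map_one, one_mul, map_finsuppProd]
  simp only [map_pow, toFrac_xi, toFrac_ta]

/-- The Mahowald weight of a monomial. -/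
def monWt (p : MonIdx) : ℕ := (p.1.sum fun i n => n * 2 ^ (i + 1)) + ∑ i ∈ p.2, 2 ^ i

/-- The condition that a monomial involves only `ξ_1²` and `ξ_i`, `τ_i` for `i > m`; no condition
for `m = 0`. -/
def Adm (m : ℕ) (p : MonIdx) : Prop :=
  m = 0 ∨ (Even (p.1 0) ∧ (∀ i ∈ p.2, m + 1 ≤ i) ∧ ∀ i, p.1 i ≠ 0 → i = 0 ∨ m ≤ i)

/-- The span of the monomials of weight at most `d` that involve only `ξ_1²` and `ξ_i`, `τ_i` for
`i > m`. -/
noncomputable def monSpan (m d : ℕ) : Submodule M2 (DualA ⊤) :=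
  Submodule.span M2 {x | ∃ p, Adm m p ∧ monWt p ≤ d ∧ x = mon p}

theorem mon_mem {m d : ℕ} {p : MonIdx} (h : Adm m p) (hd : monWt p ≤ d) : mon p ∈ monSpan m d :=
  Submodule.subset_span ⟨p, h, hd, rfl⟩

theorem monSpan_mono {m d d' : ℕ} (h : d ≤ d') : monSpan m d ≤ monSpan m d' :=
  Submodule.span_mono fun _ ⟨p, hp, hd, hx⟩ => ⟨p, hp, hd.trans h, hx⟩

theorem mon_add_single (a : ℕ →₀ ℕ) (e : Finset ℕ) (j n : ℕ) :
    mon (a + Finsupp.single j n, e) = xi ⊤ (j + 1) ^ n * mon (a, e) := by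
  simp only [mon]
  rw [Finsupp.prod_add_index' (by simp) (by intros; rw [pow_add]),
    Finsupp.prod_single_index (by simp)]
  ring

theorem monWt_add_single (a : ℕ →₀ ℕ) (e : Finset ℕ) (j n : ℕ) :
    monWt (a + Finsupp.single j n, e) = monWt (a, e) + n * 2 ^ (j + 1) := by
  simp only [monWt]
  rw [Finsupp.sum_add_index' (by simp) (by intros; ring), Finsupp.sum_single_index (by simp)]
  ring

theorem mon_insert (a : ℕ →₀ ℕ) {e : Finset ℕ} {i : ℕ} (h : i ∉ e) :
    mon (a, insert i e) = ta ⊤ i * mon (a, e) := by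
  simp only [mon, Finset.prod_insert h]
  ring

theorem monWt_insert (a : ℕ →₀ ℕ) {e : Finset ℕ} {i : ℕ} (h : i ∉ e) :
    monWt (a, insert i e) = monWt (a, e) + 2 ^ i := by
  simp only [monWt, Finset.sum_insert h]
  ring

theorem adm_add_single {m j n : ℕ} {a : ℕ →₀ ℕ} {e : Finset ℕ} (h : Adm m (a, e))
    (hj : m = 0 ∨ (m ≤ j ∧ j ≠ 0) ∨ (j = 0 ∧ Even n)) : Adm m (a + Finsupp.single j n, e) := by
  rcases h with h | ⟨h1, h2, h3⟩
  · exact Or.inl h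
  rcases hj with hj | hj | hj
  · exact Or.inl hj
  · refine Or.inr ⟨?_, h2, fun i hi => ?_⟩
    · simpa [Finsupp.single_apply, hj.2] using h1
    · rcases eq_or_ne j i with rfl | hji
      · exact Or.inr hj.1
      · exact h3 i (by simpa [Finsupp.single_apply, hji] using hi)
  · obtain ⟨rfl, hn⟩ := hj
    refine Or.inr ⟨?_, h2, fun i hi => ?_⟩
    · simpa using h1.add hn
    · rcases eq_or_ne 0 i with rfl | hji
      · exact Or.inl rfl
      · exact h3 i (by simpa [Finsupp.single_apply, hji] using hi)

theorem adm_insert {m i : ℕ} {a : ℕ →₀ ℕ} {e : Finset ℕ} (h : Adm m (a, e))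
    (hi : m = 0 ∨ m + 1 ≤ i) : Adm m (a, insert i e) := by
  rcases h with h | ⟨h1, h2, h3⟩
  · exact Or.inl h
  rcases hi with hi | hi
  · exact Or.inl hi
  · refine Or.inr ⟨h1, fun j hj => ?_, h3⟩
    rcases Finset.mem_insert.mp hj with rfl | hj
    · exact hi
    · exact h2 j hj

theorem adm_erase {m i : ℕ} {a : ℕ →₀ ℕ} {e : Finset ℕ} (h : Adm m (a, e)) :
    Adm m (a, e.erase i) := by
  rcases h with h | ⟨h1, h2, h3⟩
  · exact Or.inl h
  · exact Or.inr ⟨h1, fun j hj => h2 j (Finset.mem_of_mem_erase hj), h3⟩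

theorem mul_mem_monSpan {m d c : ℕ} {y : DualA ⊤}
    (h : ∀ p, Adm m p → y * mon p ∈ monSpan m (monWt p + c)) {x : DualA ⊤}
    (hx : x ∈ monSpan m d) : y * x ∈ monSpan m (d + c) := by
  unfold monSpan at hx
  induction hx using Submodule.span_induction with
  | mem x hx =>
    obtain ⟨p, hp, hd, rfl⟩ := hx
    exact monSpan_mono (by omega) (h p hp)
  | zero => rw [mul_zero]; exact zero_mem _
  | add x y _ _ hx hy => rw [mul_add]; exact add_mem hx hy
  | smul r x _ hx => rw [mul_smul_comm]; exact Submodule.smul_mem _ r hx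

theorem xi_pow_mul_mem_monSpan {m d j n : ℕ} {x : DualA ⊤} (hx : x ∈ monSpan m d)
    (hj : m = 0 ∨ (m ≤ j ∧ j ≠ 0) ∨ (j = 0 ∧ Even n)) :
    xi ⊤ (j + 1) ^ n * x ∈ monSpan m (d + n * 2 ^ (j + 1)) := by
  refine mul_mem_monSpan (fun p hp => ?_) hx
  rw [← mon_add_single]
  exact mon_mem (adm_add_single hp hj) (monWt_add_single _ _ _ _).le

theorem xi_mul_mem_monSpan {m d j : ℕ} {x : DualA ⊤} (hx : x ∈ monSpan m d)
    (hj : m = 0 ∨ (m ≤ j ∧ j ≠ 0)) : xi ⊤ (j + 1) * x ∈ monSpan m (d + 2 ^ (j + 1)) := by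
  have h := xi_pow_mul_mem_monSpan (n := 1) hx (hj.imp_right Or.inl)
  rwa [pow_one, one_mul] at h

/-- If τ_i already occurs, τ_i² = τξ_{i+1} + ρτ_{i+1} acts like a carry in binary addition. The new
factor τ_{i+1} may collide again, so the induction is on the number of τ's with i arbitrary. Weights
match since 2 · 2^i = 2^{i+1}. -/
theorem ta_mul_mon_mem {m i : ℕ} (hi : m = 0 ∨ m + 1 ≤ i) {p : MonIdx} (hp : Adm m p) :
    ta ⊤ i * mon p ∈ monSpan m (monWt p + 2 ^ i) := by
  obtain ⟨a, e⟩ := p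
  induction hn : e.card generalizing i e with
  | zero =>
    rw [Finset.card_eq_zero] at hn
    subst hn
    rw [← mon_insert a (Finset.notMem_empty i)]
    exact mon_mem (adm_insert hp hi) (monWt_insert a (Finset.notMem_empty i)).le
  | succ n ih =>
    by_cases h : i ∈ e
    · have hc : (e.erase i).card = n := by rw [Finset.card_erase_of_mem h, hn]; rfl
      have hi' : m = 0 ∨ m + 1 ≤ i + 1 := by omega
      have hx : m = 0 ∨ (m ≤ i ∧ i ≠ 0) := by omega
      have h1 := ih hi' (e.erase i) (adm_erase hp) hc
      have h2 := xi_mul_mem_monSpan (mon_mem (adm_erase (i := i) hp) le_rfl) hx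
      have hm : mon (a, e) = ta ⊤ i * mon (a, e.erase i) := by
        rw [← mon_insert a (Finset.notMem_erase i e), Finset.insert_erase h]
      have hw : monWt (a, e) = monWt (a, e.erase i) + 2 ^ i := by
        rw [← monWt_insert a (Finset.notMem_erase i e), Finset.insert_erase h]
      have e1 : ta ⊤ i * mon (a, e) = (MvPolynomial.X 1 : M2) • (xi ⊤ (i + 1) * mon (a, e.erase i)) +
          (MvPolynomial.X 0 : M2) • (ta ⊤ (i + 1) * mon (a, e.erase i)) := by
        rw [Algebra.smul_def, Algebra.smul_def, algebraMap_A, algebraMap_A, etaL_rho, etaL_tau, hm]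
        linear_combination mon (a, e.erase i) * ta_sq ⊤ i
      have e2 : monWt (a, e) + 2 ^ i = monWt (a, e.erase i) + 2 ^ (i + 1) := by
        rw [hw, pow_succ]; ring
      rw [e1, e2]
      exact add_mem (Submodule.smul_mem _ _ h2) (Submodule.smul_mem _ _ h1)
    · rw [← mon_insert a h]
      exact mon_mem (adm_insert hp hi) (monWt_insert a h).le

theorem ta_mul_mem_monSpan {m d i : ℕ} {x : DualA ⊤} (hx : x ∈ monSpan m d)
    (hi : m = 0 ∨ m + 1 ≤ i) : ta ⊤ i * x ∈ monSpan m (d + 2 ^ i) :=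
  mul_mem_monSpan (fun _ hp => ta_mul_mon_mem hi hp) hx

theorem mon_zero : mon (0, ∅) = 1 := by simp [mon]

theorem adm_zero (m : ℕ) : Adm m (0, ∅) := Or.inr ⟨by simp, by simp, by simp⟩

theorem one_mem_monSpan (m d : ℕ) : 1 ∈ monSpan m d := by
  rw [← mon_zero]
  exact mon_mem (adm_zero m) (by simp [monWt])

theorem exists_mem_monSpan (x : DualA ⊤) : ∃ d, x ∈ monSpan 0 d := by
  obtain ⟨p, rfl⟩ := Ideal.Quotient.mk_surjective x
  change ∃ d, DualA.mk ⊤ p ∈ _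
  induction p using MvPolynomial.induction_on with
  | C a =>
    have e : DualA.mk ⊤ (MvPolynomial.C a) = (MvPolynomial.C a : M2) • (1 : DualA ⊤) := by
      rw [Algebra.smul_def, algebraMap_A, mul_one]
      simp [etaL]
    rw [e]
    exact ⟨0, Submodule.smul_mem _ _ (one_mem_monSpan 0 0)⟩
  | add p q hp hq =>
    obtain ⟨d, hd⟩ := hp
    obtain ⟨d', hd'⟩ := hq
    rw [map_add]
    exact ⟨d + d', add_mem (monSpan_mono (by omega) hd) (monSpan_mono (by omega) hd')⟩
  | mul_X p i hp =>
    obtain ⟨d, hd⟩ := hp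
    rw [map_mul, mul_comm]
    cases i with
    | rho =>
      refine ⟨d, ?_⟩
      have e : DualA.mk ⊤ (MvPolynomial.X Gen.rho) * DualA.mk ⊤ p =
          (MvPolynomial.X 0 : M2) • DualA.mk ⊤ p := by
        rw [Algebra.smul_def, algebraMap_A, etaL_rho]; rfl
      rw [e]
      exact Submodule.smul_mem _ _ hd
    | tau =>
      refine ⟨d, ?_⟩
      have e : DualA.mk ⊤ (MvPolynomial.X Gen.tau) * DualA.mk ⊤ p =
          (MvPolynomial.X 1 : M2) • DualA.mk ⊤ p := by
        rw [Algebra.smul_def, algebraMap_A, etaL_tau]; rfl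
      rw [e]
      exact Submodule.smul_mem _ _ hd
    | xi j => exact ⟨_, xi_mul_mem_monSpan hd (Or.inl rfl)⟩
    | ta j => exact ⟨_, ta_mul_mem_monSpan hd (Or.inl rfl)⟩

/-- The monomials `∏ ξ_{i+1} ^ a_i ∏_{i ∈ e} τ_i` form a basis of the dual Steenrod algebra. -/
noncomputable def monBasis : Module.Basis MonIdx M2 (DualA ⊤) :=
  Module.Basis.mk linearIndependent_mon (by
    intro x _
    obtain ⟨d, hd⟩ := exists_mem_monSpan x
    refine Submodule.span_mono ?_ hd
    rintro _ ⟨p, _, _, rfl⟩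
    exact ⟨p, rfl⟩)

theorem monBasis_apply (p : MonIdx) : monBasis p = mon p := Module.Basis.mk_apply _ _ _

theorem quotGen_mul_mem {d : ℕ} {x : DualA ⊤} (g : ℕ ⊕ ℕ) (hx : x ∈ monSpan 1 d) :
    quotGen 1 g * x ∈ monSpan 1 (d + quotWt 1 g) := by
  rcases g with i | i
  · rcases i with _ | i
    · exact xi_pow_mul_mem_monSpan (j := 0) (n := 2) hx (by decide)
    · have h := xi_mul_mem_monSpan (m := 1) (j := i + 1) hx (by omega)
      have e : 1 - (i + 1) = 0 := by omega
      simpa only [quotGen, quotWt, e, pow_zero, pow_one, mul_one] using h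
  · exact ta_mul_mem_monSpan hx (by omega)

/-- The left side allows arbitrary powers of the τ_i, the right side only squarefree ones. Carrying
does not raise the weight, which gives one inclusion; each basis monomial is itself a product of
generators, which gives the other. -/
theorem wtLE_eq_monSpan (d : ℕ) : wtLE 1 d = monSpan 1 d := by
  apply le_antisymm
  · refine Submodule.span_le.mpr ?_
    rintro _ ⟨e, he, rfl⟩
    have hpow : ∀ (g : ℕ ⊕ ℕ) (n d : ℕ) (x : DualA ⊤), x ∈ monSpan 1 d →
        quotGen 1 g ^ n * x ∈ monSpan 1 (d + n * quotWt 1 g) := by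
      intro g n
      induction n with
      | zero => intro d x hx; simpa using hx
      | succ n ih =>
        intro d x hx
        have h := quotGen_mul_mem g (ih d x hx)
        rw [← mul_assoc, ← pow_succ'] at h
        have e : d + n * quotWt 1 g + quotWt 1 g = d + (n + 1) * quotWt 1 g := by ring
        rwa [e] at h
    refine monSpan_mono he ?_
    unfold Finsupp.prod Finsupp.sum
    induction e.support using Finset.induction_on with
    | empty => simpa using one_mem_monSpan 1 0
    | insert g t hg ih =>
      rw [Finset.prod_insert hg, Finset.sum_insert hg, add_comm]
      exact hpow g _ _ _ ih
  · refine Submodule.span_le.mpr ?_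
    rintro _ ⟨⟨a, e⟩, h | ⟨h1, h2, h3⟩, hd, rfl⟩
    · exact absurd h one_ne_zero
    have hmono : ∀ {c c' : ℕ}, c ≤ c' → wtLE 1 c ≤ wtLE 1 c' := fun h =>
      Submodule.span_mono fun x ⟨e, he, hx⟩ => ⟨e, he.trans h, hx⟩
    refine hmono hd ?_
    have hpow : ∀ {c : ℕ} {x : DualA ⊤} (n : ℕ), x ∈ wtLE 1 c → x ^ n ∈ wtLE 1 (n * c) := by
      intro c x n hx
      induction n with
      | zero => rw [pow_zero]; exact one_mem_wtLE 1 _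
      | succ n ih => rw [pow_succ, add_mul, one_mul]; exact wtLE_mul ih hx
    refine wtLE_mul ?_ ?_
    · have key : ∀ i ∈ a.support, xi ⊤ (i + 1) ^ a i ∈ wtLE 1 (a i * 2 ^ (i + 1)) := by
        intro i hi
        rcases i with _ | i
        · obtain ⟨n, hn⟩ := h1
          have h := hpow n (quotGen_mem 1 (.inl 0))
          simp only [quotGen, quotWt, ← pow_mul] at h
          simp only at hn
          rw [hn]
          convert h using 2 <;> ring
        · have h := hpow (a (i + 1)) (quotGen_mem 1 (.inl (i + 1)))
          have e : 1 - (i + 1) = 0 := by omega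
          simpa only [quotGen, quotWt, e, pow_zero, pow_one, mul_one] using h
      simp only [Finsupp.prod, Finsupp.sum]
      revert key
      generalize a.support = t
      induction t using Finset.induction_on with
      | empty => intro _; simpa using one_mem_wtLE 1 0
      | insert i t hi ih =>
        intro key
        rw [Finset.prod_insert hi, Finset.sum_insert hi]
        exact wtLE_mul (key i (Finset.mem_insert_self i t))
          (ih fun j hj => key j (Finset.mem_insert_of_mem hj))
    · simp only at h2 ⊢
      clear hd h1 h3
      induction e using Finset.induction_on with
      | empty => simpa using one_mem_wtLE 1 0
      | insert i t hi ih =>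
        rw [Finset.prod_insert hi, Finset.sum_insert hi]
        refine wtLE_mul ?_ (ih fun j hj => h2 j (Finset.mem_insert_of_mem hj))
        obtain ⟨j, rfl⟩ := Nat.exists_eq_add_of_le (h2 i (Finset.mem_insert_self i t))
        exact quotGen_mem 1 (.inr j)

end MonomialBasis

/-! ### The operator β on the dual Steenrod algebra. -/

section SteenrodBockstein

/-- The dual Steenrod algebra as a comodule over `A(0)^∨`. -/
noncomputable def steenrodCoaction : GradedCoaction 0 where
  X := DualA ⊤
  coact := coactA
  piece := DualA.piece ⊤

/-- The part of the coaction of `A(0)^∨` on the dual Steenrod algebra along `τ_0`. -/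
noncomputable def bockA : DualA ⊤ →+ DualA ⊤ :=
  (Ten.coordT (DualA ⊤)).comp coactA.toAddMonoidHom

theorem tenMul_eq (a b c d : DualA ⊤) :
    tenMul (Ten.tmul 0 1 a + Ten.tmul 0 tZero b) (Ten.tmul 0 1 c + Ten.tmul 0 tZero d) =
      Ten.tmul 0 1 (a * c) + Ten.tmul 0 tZero (a * d + b * c) := by
  have h : Ten.tmul 0 (0 : AR 0) (b * d) = 0 := TensorProduct.zero_tmul _ _
  rw [map_add, map_add, AddMonoidHom.add_apply, AddMonoidHom.add_apply]
  simp only [tenMul_tmul, one_mul, mul_one, tZero_mul_self, h, Ten.tmul_add]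
  abel

theorem coordOne_tenMul (z w : Ten 0 (DualA ⊤)) : Ten.coordOne _ (tenMul z w) =
    Ten.coordOne _ z * Ten.coordOne _ w := by
  conv_lhs => rw [Ten.eq_add z, Ten.eq_add w, tenMul_eq]
  rw [map_add, Ten.coordOne_one, Ten.coordOne_t, add_zero]

/-- Since τ_0² = 0, the τ_0-coordinate of a product obeys the Leibniz rule. The coaction is
multiplicative, so β is a derivation. -/
theorem coordT_tenMul (z w : Ten 0 (DualA ⊤)) : Ten.coordT _ (tenMul z w) =
    Ten.coordOne _ z * Ten.coordT _ w + Ten.coordT _ z * Ten.coordOne _ w := by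
  conv_lhs => rw [Ten.eq_add z, Ten.eq_add w, tenMul_eq]
  rw [map_add, Ten.coordT_one, Ten.coordT_t, zero_add]

theorem coactA_one : coactA 1 = Ten.tmul 0 1 1 := map_one (coprod 0 ⊤ le_top)

theorem coactA_xi (k : ℕ) : coactA (xi ⊤ k) = Ten.tmul 0 1 (xi ⊤ k) := coprod0_xi k

theorem coactA_ta (k : ℕ) : coactA (ta ⊤ k) =
    Ten.tmul 0 1 (ta ⊤ k) + Ten.tmul 0 tZero (xi ⊤ k) :=
  (coprod0_ta k).trans (add_comm _ _)

/-- Counitality: the 1-coordinate of the coaction is a ring endomorphism, so the generators suffice.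
-/
theorem coordOne_coactA (x : DualA ⊤) : Ten.coordOne _ (coactA x) = x := by
  let f : DualA ⊤ →+* DualA ⊤ :=
    { toFun := fun x => Ten.coordOne _ (coactA x)
      map_one' := by rw [coactA_one, Ten.coordOne_one]
      map_zero' := by rw [map_zero, map_zero]
      map_add' := fun x y => by rw [map_add, map_add]
      map_mul' := fun x y => by rw [coactA_mul, coordOne_tenMul] }
  have hsmul : ∀ r : M2, f (etaL ⊤ r) = etaL ⊤ r := by
    intro r
    have e : etaL ⊤ r = r • (1 : DualA ⊤) := by rw [Algebra.smul_def, algebraMap_A, mul_one]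
    change Ten.coordOne _ (coactA (etaL ⊤ r)) = _
    rw [e, map_smul, coactA_one, Ten.smul_one, map_add, Ten.coordOne_one, Ten.coordOne_t, add_zero]
  have hf : f = RingHom.id _ := by
    apply DualA.ringHom_ext
    intro i
    cases i with
    | rho => have := hsmul (MvPolynomial.X 0); rw [etaL_rho] at this; exact this
    | tau => have := hsmul (MvPolynomial.X 1); rw [etaL_tau] at this; exact this
    | xi i =>
      change Ten.coordOne _ (coactA (xi ⊤ (i + 1))) = xi ⊤ (i + 1)
      rw [coactA_xi, Ten.coordOne_one]
    | ta i =>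
      change Ten.coordOne _ (coactA (ta ⊤ i)) = ta ⊤ i
      rw [coactA_ta, map_add, Ten.coordOne_one, Ten.coordOne_t, add_zero]
  exact DFunLike.congr_fun hf x

theorem bockA_mul (x y : DualA ⊤) : bockA (x * y) = x * bockA y + bockA x * y := by
  change Ten.coordT _ (coactA (x * y)) = _
  rw [coactA_mul, coordT_tenMul, coordOne_coactA, coordOne_coactA]
  rfl

theorem bockA_smul (r : M2) (x : DualA ⊤) : bockA (r • x) = bockstein r • x + r • bockA x :=
  GradedCoaction.Counital.bock_smul (N := steenrodCoaction) coordOne_coactA r x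

theorem bockA_one : bockA 1 = 0 := by
  change Ten.coordT _ (coactA 1) = _
  rw [coactA_one, Ten.coordT_one]

theorem bockA_xi (k : ℕ) : bockA (xi ⊤ k) = 0 := by
  change Ten.coordT _ (coactA (xi ⊤ k)) = _
  rw [coactA_xi, Ten.coordT_one]

theorem bockA_ta (k : ℕ) : bockA (ta ⊤ k) = xi ⊤ k := by
  change Ten.coordT _ (coactA (ta ⊤ k)) = _
  rw [coactA_ta, map_add, Ten.coordT_one, Ten.coordT_t, zero_add]

theorem bockA_xi_pow (k n : ℕ) : bockA (xi ⊤ k ^ n) = 0 := by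
  induction n with
  | zero => rw [pow_zero, bockA_one]
  | succ n ih => rw [pow_succ, bockA_mul, ih, bockA_xi, mul_zero, zero_mul, add_zero]

theorem bockA_xi_pow_mul (k n : ℕ) (x : DualA ⊤) :
    bockA (xi ⊤ k ^ n * x) = xi ⊤ k ^ n * bockA x := by
  rw [bockA_mul, bockA_xi_pow, zero_mul, add_zero]

theorem bockA_ta_mul (k : ℕ) (x : DualA ⊤) :
    bockA (ta ⊤ k * x) = ta ⊤ k * bockA x + xi ⊤ k * x := by
  rw [bockA_mul, bockA_ta]

theorem bockA_prod_xi (a : ℕ →₀ ℕ) : bockA (a.prod fun i n => xi ⊤ (i + 1) ^ n) = 0 := by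
  unfold Finsupp.prod
  induction a.support using Finset.induction_on with
  | empty => rw [Finset.prod_empty, bockA_one]
  | insert i t hi ih => rw [Finset.prod_insert hi, bockA_xi_pow_mul, ih, mul_zero]

/-- β replaces some τ_i by ξ_i, which has the same weight and the same index. For m ≠ 0 every τ_i
that occurs has i ≥ 2, so ξ_i is an allowed generator rather than ξ_0 = 1 or an odd power of ξ_1. -/
theorem bockA_mon_mem {m : ℕ} (hm : m ≠ 0) {p : MonIdx} (hp : Adm m p) :
    bockA (mon p) ∈ monSpan m (monWt p) := by
  obtain ⟨a, e⟩ := p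
  induction e using Finset.induction_on with
  | empty =>
    have : bockA (mon (a, ∅)) = 0 := by
      simp only [mon, Finset.prod_empty, mul_one]
      exact bockA_prod_xi a
    rw [this]
    exact zero_mem _
  | insert i e hi ih =>
    have hp' : Adm m (a, e) := by
      have := adm_erase (i := i) hp
      rwa [Finset.erase_insert hi] at this
    have him : m + 1 ≤ i := (hp.resolve_left hm).2.1 i (Finset.mem_insert_self i e)
    rw [mon_insert a hi, bockA_ta_mul, monWt_insert a hi]
    refine add_mem (ta_mul_mem_monSpan (ih hp') (Or.inr him)) ?_
    obtain ⟨j, rfl⟩ := Nat.exists_eq_add_of_le' (show 1 ≤ i by omega)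
    exact xi_mul_mem_monSpan (mon_mem hp' le_rfl) (Or.inr ⟨by omega, by omega⟩)

theorem bockA_mem {m d : ℕ} (hm : m ≠ 0) {x : DualA ⊤} (hx : x ∈ monSpan m d) :
    bockA x ∈ monSpan m d := by
  unfold monSpan at hx
  induction hx using Submodule.span_induction with
  | mem x hx =>
    obtain ⟨p, hp, hd, rfl⟩ := hx
    exact monSpan_mono hd (bockA_mon_mem hm hp)
  | zero => rw [map_zero]; exact zero_mem _
  | add x y _ _ hx hy => rw [map_add]; exact add_mem hx hy
  | smul r x hx' hx =>
    rw [bockA_smul]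
    exact add_mem (Submodule.smul_mem _ _ hx') (Submodule.smul_mem _ _ hx)

end SteenrodBockstein

/-! ### The contracting homotopy on monomials. -/

section Contraction

/-- The monomial involves `ξ_{j+1}` or `τ_{j+1}`. -/
def Involves (p : MonIdx) (j : ℕ) : Prop := p.1 j ≠ 0 ∨ j + 1 ∈ p.2

open Classical in
/-- On monomials, the map `ξ_j^{n+1} x ↦ ξ_j^n τ_j x`, `ξ_j^n τ_j x ↦ 0` for the least `j ≥ 2` for which
`ξ_j` or `τ_j` occurs. -/
noncomputable def contractMon (p : MonIdx) : DualA ⊤ :=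
  if h : ∃ j, j ≠ 0 ∧ Involves p j then
    if Nat.find h + 1 ∈ p.2 then 0
    else mon (p.1 - Finsupp.single (Nat.find h) 1, insert (Nat.find h + 1) p.2)
  else 0

/-- The contracting homotopy. -/
noncomputable def contract : DualA ⊤ →ₗ[M2] DualA ⊤ := monBasis.constr M2 contractMon

theorem contract_mon (p : MonIdx) : contract (mon p) = contractMon p := by
  rw [contract, ← monBasis_apply, Module.Basis.constr_basis]

theorem contractMon_eq {p : MonIdx} {j : ℕ} (hj : j ≠ 0) (hp : Involves p j)
    (hmin : ∀ i, i ≠ 0 → i < j → ¬ Involves p i) : contractMon p =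
      if j + 1 ∈ p.2 then 0 else mon (p.1 - Finsupp.single j 1, insert (j + 1) p.2) := by
  classical
  have h : ∃ j, j ≠ 0 ∧ Involves p j := ⟨j, hj, hp⟩
  have e : Nat.find h = j := (Nat.find_eq_iff h).mpr ⟨⟨hj, hp⟩, fun i hi hi' => hmin i hi'.1 hi hi'.2⟩
  rw [contractMon, dif_pos h, e]

/-- The rest of an admissible monomial that involves only `ξ_i`, `τ_i` with `i > j + 1`. -/
theorem Adm.not_involves {j : ℕ} {q : MonIdx} (hq : Adm (j + 1) q) {i : ℕ} (hi : i ≠ 0)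
    (hij : i ≤ j) : ¬ Involves q i := by
  rcases hq with h | ⟨_, h2, h3⟩
  · omega
  rintro (h | h)
  · rcases h3 i h with h | h <;> omega
  · have := h2 _ h; omega

/-- The remaining factor q involves, besides ξ_1², only indices above j + 1, so the contraction acts
on the pair ξ_{j+1}, τ_{j+1}. -/
theorem contract_xi_pow_mul_mon {j n : ℕ} (hj : j ≠ 0) {q : MonIdx} (hq : Adm (j + 1) q) :
    contract (xi ⊤ (j + 1) ^ (n + 1) * mon q) = xi ⊤ (j + 1) ^ n * (ta ⊤ (j + 1) * mon q) := by
  obtain ⟨a, e⟩ := q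
  have hnot : j + 1 ∉ e := fun h => hq.not_involves hj le_rfl (Or.inr h)
  rw [← mon_add_single, contract_mon, contractMon_eq hj (Or.inl (by simp)), if_neg hnot,
    ← mon_insert a hnot, ← mon_add_single]
  · congr 2
    ext i
    by_cases h : j = i
    · subst h; simp
    · simp [h]
  · intro i hi hij h
    refine hq.not_involves hi hij.le ?_
    simpa [Involves, Finsupp.single_apply, hij.ne'] using h

theorem contract_xi_pow_mul_ta_mul_mon {j n : ℕ} (hj : j ≠ 0) {q : MonIdx} (hq : Adm (j + 1) q) :
    contract (xi ⊤ (j + 1) ^ n * (ta ⊤ (j + 1) * mon q)) = 0 := by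
  obtain ⟨a, e⟩ := q
  have hnot : j + 1 ∉ e := fun h => hq.not_involves hj le_rfl (Or.inr h)
  rw [← mon_insert a hnot, ← mon_add_single, contract_mon, contractMon_eq hj (Or.inr (by simp)),
    if_pos (by simp)]
  intro i hi hij h
  refine hq.not_involves hi hij.le ?_
  simpa [Involves, Finsupp.single_apply, hij.ne', hij.ne] using h

/-- The extension from monomials to their span is needed because the homotopy formula applies the
contraction to β of the remaining factor, which is a combination of monomials. -/
theorem contract_xi_pow_mul {j n d : ℕ} (hj : j ≠ 0) {x : DualA ⊤} (hx : x ∈ monSpan (j + 1) d) :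
    contract (xi ⊤ (j + 1) ^ (n + 1) * x) = xi ⊤ (j + 1) ^ n * (ta ⊤ (j + 1) * x) := by
  unfold monSpan at hx
  induction hx using Submodule.span_induction with
  | mem x hx =>
    obtain ⟨p, hp, hd, rfl⟩ := hx
    exact contract_xi_pow_mul_mon hj hp
  | zero => simp only [mul_zero, map_zero]
  | add x y _ _ hx hy => simp only [mul_add, map_add, hx, hy]
  | smul r x _ hx => simp only [mul_smul_comm, map_smul, hx]

theorem contract_xi_pow_mul_ta_mul {j n d : ℕ} (hj : j ≠ 0) {x : DualA ⊤}
    (hx : x ∈ monSpan (j + 1) d) : contract (xi ⊤ (j + 1) ^ n * (ta ⊤ (j + 1) * x)) = 0 := by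
  unfold monSpan at hx
  induction hx using Submodule.span_induction with
  | mem x hx =>
    obtain ⟨p, hp, hd, rfl⟩ := hx
    exact contract_xi_pow_mul_ta_mul_mon hj hp
  | zero => simp only [mul_zero, map_zero]
  | add x y _ _ hx hy => simp only [mul_add, map_add, hx, hy, add_zero]
  | smul r x _ hx => simp only [mul_smul_comm, map_smul, hx, smul_zero]

theorem DualA.add_self (x : DualA ⊤) : x + x = 0 := add_self_M2 x

/-- The homotopy formula on multiples of `ξ_{j+1}` or `τ_{j+1}`. -/
theorem homotopy_of_involves {j n : ℕ} (hj : j ≠ 0) {q : MonIdx} (hq : Adm (j + 1) q) :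
    (bockA (contract (xi ⊤ (j + 1) ^ (n + 1) * mon q)) +
      contract (bockA (xi ⊤ (j + 1) ^ (n + 1) * mon q)) = xi ⊤ (j + 1) ^ (n + 1) * mon q) ∧
    (bockA (contract (xi ⊤ (j + 1) ^ n * (ta ⊤ (j + 1) * mon q))) +
      contract (bockA (xi ⊤ (j + 1) ^ n * (ta ⊤ (j + 1) * mon q))) =
        xi ⊤ (j + 1) ^ n * (ta ⊤ (j + 1) * mon q)) := by
  have h0 : mon q ∈ monSpan (j + 1) (monWt q) := mon_mem hq le_rfl
  have h1 := bockA_mem (Nat.succ_ne_zero j) h0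
  constructor
  -- With x the remaining factor, ξ^n τ βx arises from both composites and cancels in characteristic
  -- two; βτ = ξ leaves ξ^{n+1} x.
  · rw [contract_xi_pow_mul hj h0, bockA_xi_pow_mul, bockA_xi_pow_mul, contract_xi_pow_mul hj h1,
      bockA_ta_mul, mul_add, add_right_comm, DualA.add_self, zero_add, pow_succ, mul_assoc]
  -- Here only the contraction of β survives: it kills ξ^n τ βx and sends ξ^{n+1} x back to ξ^n τ x.
  · rw [contract_xi_pow_mul_ta_mul hj h0, map_zero, zero_add, bockA_xi_pow_mul, bockA_ta_mul, mul_add,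
      map_add, contract_xi_pow_mul_ta_mul hj h1, zero_add, ← mul_assoc, ← pow_succ,
      contract_xi_pow_mul hj h0]

/-- An admissible monomial is a power of `ξ_1²`, or a least `ξ_j` or `τ_j`, `j ≥ 2`, occurs in it. -/
theorem mon_cases {p : MonIdx} (hp : Adm 1 p) : (∃ n, monWt p = 4 * n ∧ mon p = xi ⊤ 1 ^ (2 * n)) ∨
    ∃ j n q, j ≠ 0 ∧ Adm (j + 1) q ∧ (mon p = xi ⊤ (j + 1) ^ (n + 1) * mon q ∨
      mon p = xi ⊤ (j + 1) ^ n * (ta ⊤ (j + 1) * mon q)) := by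
  classical
  obtain ⟨a, e⟩ := p
  obtain ⟨h1, h2, h3⟩ := hp.resolve_left one_ne_zero
  by_cases h : ∃ j, j ≠ 0 ∧ Involves (a, e) j
  · right
    obtain ⟨hj, hinv⟩ := Nat.find_spec h
    have hmin : ∀ i, i ≠ 0 → i < Nat.find h → ¬ Involves (a, e) i :=
      fun i hi hij hi' => Nat.find_min h hij ⟨hi, hi'⟩
    generalize Nat.find h = j at hj hinv hmin
    have hq : Adm (j + 1) (a.erase j, e.erase (j + 1)) := by
      refine Or.inr ⟨?_, fun i hi => ?_, fun i hi => ?_⟩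
      · simpa [Finsupp.erase_ne (Ne.symm hj)] using h1
      · obtain ⟨hij, hie⟩ := Finset.mem_erase.mp hi
        have h4 := h2 i hie
        obtain ⟨i, rfl⟩ := Nat.exists_eq_add_of_le' (show 1 ≤ i by omega)
        have h5 : ¬ i < j := fun hlt => hmin i (by omega) hlt (Or.inr hie)
        omega
      · rcases eq_or_ne i j with rfl | hij
        · simp at hi
        · by_contra! hcon
          exact hmin i hcon.1 (by omega) (Or.inl (by simpa [Finsupp.erase_ne hij] using hi))
    have ha : a = a.erase j + Finsupp.single j (a j) := (Finsupp.erase_add_single j a).symm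
    have hmon : ∀ e, mon (a, e) = xi ⊤ (j + 1) ^ a j * mon (a.erase j, e) := fun e => by
      rw [← mon_add_single, ← ha]
    by_cases hje : j + 1 ∈ e
    · refine ⟨j, a j, _, hj, hq, Or.inr ?_⟩
      rw [hmon, ← mon_insert _ (Finset.notMem_erase _ _), Finset.insert_erase hje]
    · have haj : a j ≠ 0 := hinv.resolve_right hje
      refine ⟨j, a j - 1, _, hj, hq, Or.inl ?_⟩
      rw [Finset.erase_eq_of_notMem hje, hmon, Nat.sub_add_cancel (Nat.pos_of_ne_zero haj)]
  · left
    push Not at h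
    obtain ⟨n, hn⟩ := h1
    have he : e = ∅ := by
      rw [Finset.eq_empty_iff_forall_notMem]
      intro i hi
      have h4 := h2 i hi
      obtain ⟨i, rfl⟩ := Nat.exists_eq_add_of_le' (show 1 ≤ i by omega)
      exact h i (by omega) (Or.inr hi)
    have ha : a = Finsupp.single 0 (a 0) := by
      ext i
      rcases eq_or_ne i 0 with rfl | hi
      · simp
      · have : a i = 0 := by
          by_contra hc
          exact h i hi (Or.inl hc)
        simp [this, hi.symm]
    simp only at hn
    have hp' : ((a, e) : MonIdx) = (0 + Finsupp.single 0 (2 * n), ∅) := by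
      rw [he, zero_add, two_mul, ← hn, ← ha]
    refine ⟨n, ?_, ?_⟩
    · rw [hp', monWt_add_single]
      simp [monWt]
      ring
    · rw [hp', mon_add_single, mon_zero, mul_one, zero_add]

/-- ξ_j and τ_j have equal weight, so the exchange preserves the weight and the contraction
restricts to each Brown-Gitler comodule. -/
theorem contractMon_mem {p : MonIdx} (hp : Adm 1 p) : contractMon p ∈ monSpan 1 (monWt p) := by
  classical
  by_cases h : ∃ j, j ≠ 0 ∧ Involves p j
  · rw [contractMon, dif_pos h]
    obtain ⟨hj, hinv⟩ := Nat.find_spec h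
    generalize Nat.find h = j at hj hinv
    split_ifs with hje
    · exact zero_mem _
    · obtain ⟨a, e⟩ := p
      have haj : a j ≠ 0 := hinv.resolve_right hje
      have ha : a = a - Finsupp.single j 1 + Finsupp.single j 1 := by
        ext i
        by_cases h : j = i
        · subst h; simp; omega
        · simp [h]
      obtain ⟨h1, h2, h3⟩ := hp.resolve_left one_ne_zero
      have hq : Adm 1 (a - Finsupp.single j 1, e) := by
        refine Or.inr ⟨?_, h2, fun i _ => by omega⟩
        simpa [Finsupp.single_apply, hj] using h1
      have hw := monWt_add_single (a - Finsupp.single j 1) e j 1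
      rw [← ha, one_mul] at hw
      refine mon_mem (adm_insert hq (Or.inr (by omega))) ?_
      rw [monWt_insert _ hje, hw]
  · rw [contractMon, dif_neg h]
    exact zero_mem _

theorem contract_mem {d : ℕ} {x : DualA ⊤} (hx : x ∈ monSpan 1 d) : contract x ∈ monSpan 1 d := by
  unfold monSpan at hx
  induction hx using Submodule.span_induction with
  | mem x hx =>
    obtain ⟨p, hp, hd, rfl⟩ := hx
    rw [contract_mon]
    exact monSpan_mono hd (contractMon_mem hp)
  | zero => rw [map_zero]; exact zero_mem _
  | add x y _ _ hx hy => rw [map_add]; exact add_mem hx hy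
  | smul r x _ hx => rw [map_smul]; exact Submodule.smul_mem _ r hx

theorem contract_xi_one_pow (n : ℕ) : contract (xi ⊤ 1 ^ n) = 0 := by
  have e : xi ⊤ 1 ^ n = mon (0 + Finsupp.single 0 n, ∅) := by
    rw [mon_add_single, mon_zero, mul_one]
  rw [e, contract_mon, contractMon, dif_neg]
  rintro ⟨j, hj, h | h⟩
  · simp [hj.symm] at h
  · simp at h

end Contraction

/-! ### Projection to the powers of ξ_1² and the homotopy formula. -/

section Reduction

/-- The images of the generators in `𝔽₂[ρ, √τ][√ξ_1]`: `τ_0 ↦ √τ √ξ_1`, and all `ξ_i` and `τ_i` other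
than `ξ_1` and `τ_0` go to zero. -/
noncomputable def redGen : Gen → Polynomial M2
  | .rho => Polynomial.C (MvPolynomial.X 0)
  | .tau => Polynomial.C (MvPolynomial.X 1 ^ 2)
  | .xi 0 => Polynomial.X ^ 2
  | .xi (_ + 1) => 0
  | .ta 0 => Polynomial.C (MvPolynomial.X 1) * Polynomial.X
  | .ta (_ + 1) => 0

/-- The ring map from the dual Steenrod algebra to `𝔽₂[ρ, √τ][√ξ_1]`. -/
noncomputable def red : DualA ⊤ →+* Polynomial M2 :=
  Ideal.Quotient.lift _ (MvPolynomial.aeval (R := ZMod 2) redGen :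
      Poly →ₐ[ZMod 2] Polynomial M2).toRingHom (by
    intro a ha
    refine (Ideal.span_le (I := RingHom.ker _)).mpr ?_ ha
    rintro p ((⟨i, rfl⟩ | ⟨N, i, hN, hi, rfl⟩) | ⟨N, i, hN, hi, rfl⟩)
    · rcases i with _ | i
      · simp [RingHom.mem_ker, taPoly, xiPoly, redGen, mul_pow]
      · simp [RingHom.mem_ker, taPoly, xiPoly, redGen]
    · exact absurd hN (WithTop.top_ne_coe)
    · exact absurd hN (WithTop.top_ne_coe))

theorem red_mk (p : Poly) : red (DualA.mk ⊤ p) = MvPolynomial.aeval (R := ZMod 2) redGen p := rfl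

theorem red_xi_one : red (xi ⊤ 1) = Polynomial.X ^ 2 := by
  rw [xi, red_mk]
  simp [xiPoly, redGen]

theorem red_xi {j : ℕ} (hj : j ≠ 0) : red (xi ⊤ (j + 1)) = 0 := by
  obtain ⟨j, rfl⟩ := Nat.exists_eq_succ_of_ne_zero hj
  rw [xi, red_mk]
  simp [xiPoly, redGen]

theorem red_ta (j : ℕ) : red (ta ⊤ (j + 1)) = 0 := by
  rw [ta, red_mk]
  simp [taPoly, redGen]

/-- In the target `X 1` stands for √τ, so `red` is semilinear along `tauSq`; `evenPart` undoes this
twist and makes `xiCoeff` linear. The square roots are what allows τ_0² = τξ_1 + ρτ_1 to hold with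
τ_1 sent to zero. -/
theorem red_etaL (r : M2) : red (etaL ⊤ r) = Polynomial.C (tauSq r) := by
  have : red.comp (etaL ⊤) = Polynomial.C.comp (tauSq : M2 →+* M2) := by
    refine ringHom_M2_ext (S := Polynomial M2) ?_ ?_
    · rw [RingHom.comp_apply, etaL_rho, rho, red_mk, MvPolynomial.aeval_X, RingHom.comp_apply]
      exact congrArg Polynomial.C tauSq_rho.symm
    · rw [RingHom.comp_apply, etaL_tau, tau, red_mk, MvPolynomial.aeval_X, RingHom.comp_apply]
      exact congrArg Polynomial.C tauSq_tau.symm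
  exact DFunLike.congr_fun this r

/-- The coefficient of `ξ_1^{2j}`. -/
noncomputable def xiCoeff (j : ℕ) : DualA ⊤ →ₗ[M2] M2 where
  toFun x := evenPart ((red x).coeff (4 * j))
  map_add' x y := by rw [map_add, Polynomial.coeff_add, map_add]
  map_smul' r x := by
    rw [Algebra.smul_def, algebraMap_A, map_mul, red_etaL, Polynomial.coeff_C_mul,
      evenPart_tauSq_mul, RingHom.id_apply, smul_eq_mul]

theorem xiCoeff_apply (j : ℕ) (x : DualA ⊤) : xiCoeff j x = evenPart ((red x).coeff (4 * j)) := rfl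

theorem xiCoeff_of_red {x : DualA ⊤} (hx : red x = 0) (j : ℕ) : xiCoeff j x = 0 := by
  rw [xiCoeff_apply, hx, Polynomial.coeff_zero, map_zero]

/-- The polynomial variable is √ξ_1, so ξ_1^{2j} sits in polynomial degree 4j. -/
theorem xiCoeff_xi_one_pow (i j : ℕ) : xiCoeff i (xi ⊤ 1 ^ (2 * j)) = if i = j then 1 else 0 := by
  have h : 4 * i = 2 * (2 * j) ↔ i = j := by omega
  rw [xiCoeff_apply, map_pow, red_xi_one, ← pow_mul, Polynomial.coeff_X_pow, apply_ite evenPart,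
    evenPart_one, map_zero]
  simp only [h]

theorem red_mon_eq_zero {j n : ℕ} (hj : j ≠ 0) (x : DualA ⊤) :
    red (xi ⊤ (j + 1) ^ (n + 1) * x) = 0 ∧ red (xi ⊤ (j + 1) ^ n * (ta ⊤ (j + 1) * x)) = 0 := by
  constructor
  · rw [map_mul, map_pow, red_xi hj, zero_pow (Nat.succ_ne_zero n), zero_mul]
  · rw [map_mul, map_mul, red_ta, zero_mul, mul_zero]

theorem red_bockA_mon_eq_zero {j n : ℕ} (hj : j ≠ 0) (x : DualA ⊤) :
    red (bockA (xi ⊤ (j + 1) ^ (n + 1) * x)) = 0 ∧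
      red (bockA (xi ⊤ (j + 1) ^ n * (ta ⊤ (j + 1) * x))) = 0 := by
  constructor
  · rw [bockA_xi_pow_mul]
    exact (red_mon_eq_zero hj _).1
  · rw [bockA_xi_pow_mul, bockA_ta_mul, mul_add, map_add, (red_mon_eq_zero hj _).2, zero_add, ← mul_assoc, ← pow_succ]
    exact (red_mon_eq_zero hj _).1

/-- Powers of ξ_1² are cycles with constant coefficients. Any other admissible monomial contains
some ξ_j or τ_j with j ≥ 2; both it and its image under β are killed by `red`. The twisted Leibniz
rules match under scalars. -/
theorem xiCoeff_bockA {d : ℕ} {x : DualA ⊤} (hx : x ∈ monSpan 1 d) (i : ℕ) :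
    xiCoeff i (bockA x) = bockstein (xiCoeff i x) := by
  unfold monSpan at hx
  induction hx using Submodule.span_induction with
  | mem x hx =>
    obtain ⟨p, hp, -, rfl⟩ := hx
    rcases mon_cases hp with ⟨n, -, hn⟩ | ⟨j, n, q, hj, -, hn | hn⟩
    · rw [hn, bockA_xi_pow, map_zero, xiCoeff_xi_one_pow]
      split_ifs
      · exact bockstein_one.symm
      · exact (map_zero bockstein).symm
    · rw [hn, xiCoeff_of_red (red_bockA_mon_eq_zero hj _).1,
        xiCoeff_of_red (red_mon_eq_zero hj _).1, map_zero]
    · rw [hn, xiCoeff_of_red (red_bockA_mon_eq_zero hj _).2,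
        xiCoeff_of_red (red_mon_eq_zero hj _).2, map_zero]
  | zero => simp only [map_zero]
  | add x y _ _ hx hy => simp only [map_add, hx, hy]
  | smul r x _ hx =>
    rw [bockA_smul, map_add, map_smul, map_smul, hx, map_smul, smul_eq_mul, smul_eq_mul, smul_eq_mul,
      Derivation.leibniz, smul_eq_mul, smul_eq_mul]
    ring

/-- The contraction is a homotopy between the identity and the projection to the powers of `ξ_1²`. -/
theorem homotopy {k : ℕ} {x : DualA ⊤} (hx : x ∈ monSpan 1 (4 * k)) :
    bockA (contract x) + contract (bockA x) +
      ∑ i : Fin (k + 1), xiCoeff i x • xi ⊤ 1 ^ (2 * (i : ℕ)) = x := by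
  unfold monSpan at hx
  induction hx using Submodule.span_induction with
  | mem x hx =>
    obtain ⟨p, hp, hd, rfl⟩ := hx
    rcases mon_cases hp with ⟨n, hw, hn⟩ | ⟨j, n, q, hj, hq, hn⟩
    · rw [hn, contract_xi_one_pow, bockA_xi_pow, map_zero, map_zero, zero_add, zero_add,
        -- The weight of ξ_1^{2n} is 4n ≤ 4k, so n is a valid index; this bound yields exactly k + 1
        -- summands.
        Finset.sum_eq_single ⟨n, by omega⟩]
      · rw [xiCoeff_xi_one_pow, if_pos rfl, one_smul]
      · intro i _ hi
        rw [xiCoeff_xi_one_pow, if_neg (fun h => hi (Fin.ext h)), zero_smul]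
      · exact fun h => absurd (Finset.mem_univ _) h
    · have hred : red (mon p) = 0 := by
        rcases hn with hn | hn <;> rw [hn]
        exacts [(red_mon_eq_zero hj _).1, (red_mon_eq_zero hj _).2]
      rw [Finset.sum_eq_zero fun i _ => by rw [xiCoeff_of_red hred, zero_smul], add_zero]
      rcases hn with hn | hn <;> rw [hn]
      exacts [(homotopy_of_involves hj hq).1, (homotopy_of_involves hj hq).2]
  | zero => simp
  | add x y _ _ hx hy =>
    conv_rhs => rw [← hx, ← hy]
    simp only [map_add, add_smul, Finset.sum_add_distrib]
    abel
  | smul r x _ hx =>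
    conv_rhs => rw [← hx]
    simp only [map_smul, bockA_smul, map_add, smul_add, Finset.smul_sum, smul_assoc]
    -- β is not linear, but its twist contributes the same term to both composites and cancels in
    -- characteristic two.
    have h := DualA.add_self (bockstein r • contract x)
    generalize bockstein r • contract x = y at h
    rw [add_add_add_comm, h, zero_add]

/-- The degrees of `ρ` and `√τ`, doubled. -/
def halfDeg : Fin 2 → ℤ × ℤ := ![(-2, -2), (0, -1)]

theorem halfDeg_weight (d : Fin 2 →₀ ℕ) :
    Finsupp.weight halfDeg d = (-2 * (d 0 : ℤ), -2 * (d 0 : ℤ) - d 1) := by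
  rw [Finsupp.weight_apply, Finsupp.sum_fintype _ _ (by simp), Fin.sum_univ_two]
  ext <;> (simp [halfDeg]; try ring)

/-- The elements of `𝔽₂[ρ, √τ]` of a given doubled degree. -/
noncomputable def halfPiece (c : ℤ × ℤ) : AddSubgroup M2 :=
  (MvPolynomial.weightedHomogeneousSubmodule (ZMod 2) halfDeg c).toAddSubgroup

/-- The homogeneous elements of `𝔽₂[ρ, √τ][√ξ_1]`. -/
noncomputable def redPiece (c : ℤ × ℤ) : AddSubgroup (Polynomial M2) where
  -- Degrees are doubled to stay integral: √ξ_1 has doubled degree (2, 1), the degree of ξ_1.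
  carrier := {p | ∀ n : ℕ, p.coeff n ∈ halfPiece (2 • c - n • (2, 1))}
  zero_mem' n := by rw [Polynomial.coeff_zero]; exact zero_mem _
  add_mem' hp hq n := by rw [Polynomial.coeff_add]; exact add_mem (hp n) (hq n)
  neg_mem' hp n := by rw [Polynomial.coeff_neg]; exact neg_mem (hp n)

theorem redPiece_mul (a b : ℤ × ℤ) (x y : Polynomial M2) (hx : x ∈ redPiece a)
    (hy : y ∈ redPiece b) : x * y ∈ redPiece (a + b) := by
  intro n
  rw [Polynomial.coeff_mul]
  refine sum_mem fun ij hij => ?_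
  rw [Finset.HasAntidiagonal.mem_antidiagonal] at hij
  have e : 2 • (a + b) - n • ((2, 1) : ℤ × ℤ) =
      2 • a - ij.1 • ((2, 1) : ℤ × ℤ) + (2 • b - ij.2 • ((2, 1) : ℤ × ℤ)) := by
    rw [← hij, add_smul, smul_add]; abel
  rw [e]
  exact MvPolynomial.IsWeightedHomogeneous.mul (hx _) (hy _)

theorem C_mul_X_pow_mem_redPiece {c : ℤ × ℤ} {r : M2} {n : ℕ}
    (hr : r ∈ halfPiece (2 • c - n • (2, 1))) : Polynomial.C r * Polynomial.X ^ n ∈ redPiece c := by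
  intro m
  rw [Polynomial.coeff_C_mul_X_pow]
  split_ifs with h
  · rwa [h]
  · exact zero_mem _

theorem red_mem {c : ℤ × ℤ} {x : DualA ⊤} (hx : x ∈ DualA.piece ⊤ c) : red x ∈ redPiece c := by
  obtain ⟨p, hp, rfl⟩ := hx
  have hone : (1 : M2) ∈ halfPiece 0 := MvPolynomial.isWeightedHomogeneous_one _ _
  have h0 : (MvPolynomial.X 0 : M2) ∈ halfPiece (-2, -2) := MvPolynomial.isWeightedHomogeneous_X _ _ _
  have h1 : (MvPolynomial.X 1 : M2) ∈ halfPiece (0, -1) := MvPolynomial.isWeightedHomogeneous_X _ _ _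
  have h2 : (MvPolynomial.X 1 ^ 2 : M2) ∈ halfPiece (0, -2) := by
    rw [pow_two]
    exact MvPolynomial.IsWeightedHomogeneous.mul h1 h1
  refine map_mem_of_graded redPiece ?_ redPiece_mul (red.comp (DualA.mk ⊤)) (fun g => ?_) hp
  · have h := C_mul_X_pow_mem_redPiece (c := 0) (n := 0) (r := 1) (by simpa using hone)
    simpa using h
  · rw [RingHom.comp_apply, red_mk, MvPolynomial.aeval_X]
    rcases g with _ | _ | i | i
    · have h := C_mul_X_pow_mem_redPiece (c := degGen .rho) (n := 0) (by simpa [degGen] using h0)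
      simpa [redGen] using h
    · have h := C_mul_X_pow_mem_redPiece (c := degGen .tau) (n := 0) (by simpa [degGen] using h2)
      simpa [redGen] using h
    · rcases i with _ | i
      · have h := C_mul_X_pow_mem_redPiece (c := degGen (.xi 0)) (n := 2) (r := 1)
          (by convert hone using 2; ext <;> simp [degGen])
        simpa [redGen] using h
      · exact zero_mem _
    · rcases i with _ | i
      · have h := C_mul_X_pow_mem_redPiece (c := degGen (.ta 0)) (n := 1) (r := MvPolynomial.X 1)
          (by convert h1 using 2; ext <;> simp [degGen])
        simpa [redGen] using h
      · exact zero_mem _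

/-- `evenPart` turns (√τ)^{2b} into τ^b, so the doubled degree of the source is twice the true
degree of the result. -/
theorem evenPart_mem {c : ℤ × ℤ} {r : M2} (hr : r ∈ halfPiece (2 • c)) : evenPart r ∈ M2.piece c := by
  refine map_mem_of_isWeightedHomogeneous _ evenPart.toAddMonoidHom (fun d hd a => ?_) hr
  rw [halfDeg_weight] at hd
  change evenPart _ ∈ _
  rw [← expo_eta d, evenPart_monomial]
  split_ifs with h
  · refine monomial_mem_M2_piece ?_ a
    obtain ⟨b, hb⟩ := h
    obtain ⟨c1, c2⟩ := c
    simp only [Prod.smul_mk, Prod.mk.injEq, nsmul_eq_mul] at hd ⊢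
    push_cast at hd
    omega
  · exact zero_mem _

theorem xiCoeff_mem {c : ℤ × ℤ} {x : DualA ⊤} (hx : x ∈ DualA.piece ⊤ c) (j : ℕ) :
    xiCoeff j x ∈ M2.piece (c - ((4 * (j : ℤ), 2 * (j : ℤ)) : ℤ × ℤ)) := by
  refine evenPart_mem ?_
  have h := red_mem hx (4 * j)
  convert h using 2
  ext <;> (simp; ring)

theorem xi_one_pow_mem_piece (n : ℕ) :
    xi ⊤ 1 ^ (2 * n) ∈ DualA.piece ⊤ ((4 * (n : ℤ), 2 * (n : ℤ)) : ℤ × ℤ) := by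
  have h : xi ⊤ 1 ∈ DualA.piece ⊤ (2, 1) := DualA.mk_X_mem_piece ⊤ (.xi 0)
  induction n with
  | zero => exact DualA.one_mem_piece ⊤
  | succ n ih =>
    have e : ((4 * ((n + 1 : ℕ) : ℤ), 2 * ((n + 1 : ℕ) : ℤ)) : ℤ × ℤ) =
        (4 * (n : ℤ), 2 * (n : ℤ)) + (2, 1) + (2, 1) := by
      ext <;> (simp; ring)
    rw [e, mul_add, pow_add, mul_one, pow_two, ← mul_assoc]
    exact DualA.mul_mem_piece ⊤ _ _ _ _ (DualA.mul_mem_piece ⊤ _ _ _ _ ih h) h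

end Reduction

/-! ### The splitting of the Brown-Gitler comodules. -/

section BrownGitler

theorem brownGitler_eq (k : ℕ) : brownGitler 1 k = monSpan 1 (4 * k) := by
  rw [brownGitler, wtLE_eq_monSpan]
  norm_num

/-- Naturality of the coordinates: the counit law and the operator β of the Brown-Gitler comodule
are inherited from the dual Steenrod algebra. -/
theorem Ten.coordOne_map {N N' : Type} [AddCommGroup N] [Module M2 N] [AddCommGroup N'] [Module M2 N']
    (f : N →ₗ[M2] N') (z : Ten 0 N) :
    Ten.coordOne N' (Ten.map 0 0 le_rfl f z) = f (Ten.coordOne N z) := by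
  conv_lhs => rw [Ten.eq_add z, map_add, Ten.map_tmul, Ten.map_tmul, projR_self, projR_self]
  rw [map_add, Ten.coordOne_one, Ten.coordOne_t, add_zero]

theorem Ten.coordT_map {N N' : Type} [AddCommGroup N] [Module M2 N] [AddCommGroup N'] [Module M2 N']
    (f : N →ₗ[M2] N') (z : Ten 0 N) :
    Ten.coordT N' (Ten.map 0 0 le_rfl f z) = f (Ten.coordT N z) := by
  conv_lhs => rw [Ten.eq_add z, map_add, Ten.map_tmul, Ten.map_tmul, projR_self, projR_self]
  rw [map_add, Ten.coordT_one, Ten.coordT_t, zero_add]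

theorem brownGitler_counital (k : ℕ) : (brownGitlerCoaction 1 k).Counital := by
  intro x
  refine Subtype.ext ?_
  have h := Ten.coordOne_map (brownGitler 1 k).subtype (brownGitlerCoact 1 k x)
  exact h.symm.trans ((congrArg (Ten.coordOne (DualA ⊤)) (map_brownGitlerCoact 1 k x)).trans
    (coordOne_coactA _))

/-- The inclusion of the Brown-Gitler comodule into the dual Steenrod algebra. -/
noncomputable def brownGitlerIncl (k : ℕ) : (brownGitlerCoaction 1 k).X →ₗ[M2] DualA ⊤ :=
  (brownGitler 1 k).subtype

theorem brownGitlerIncl_injective (k : ℕ) : Function.Injective (brownGitlerIncl k) :=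
  Subtype.val_injective

theorem brownGitlerIncl_mem (k : ℕ) (x : (brownGitlerCoaction 1 k).X) :
    brownGitlerIncl k x ∈ monSpan 1 (4 * k) :=
  brownGitler_eq k ▸ (x : brownGitler 1 k).2

theorem exists_brownGitlerIncl {k : ℕ} {x : DualA ⊤} (hx : x ∈ monSpan 1 (4 * k)) :
    ∃ y, brownGitlerIncl k y = x :=
  ⟨(⟨x, (brownGitler_eq k).symm ▸ hx⟩ : brownGitler 1 k), rfl⟩

theorem brownGitlerIncl_bock (k : ℕ) (x : (brownGitlerCoaction 1 k).X) :
    brownGitlerIncl k ((brownGitlerCoaction 1 k).bock x) = bockA (brownGitlerIncl k x) := by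
  have h := Ten.coordT_map (brownGitler 1 k).subtype (brownGitlerCoact 1 k x)
  exact h.symm.trans (congrArg (Ten.coordT (DualA ⊤)) (map_brownGitlerCoact 1 k x))

theorem xi_one_pow_mem {k : ℕ} (j : Fin (k + 1)) : xi ⊤ 1 ^ (2 * (j : ℕ)) ∈ monSpan 1 (4 * k) := by
  have h := xi_pow_mul_mem_monSpan (m := 1) (d := 0) (j := 0) (n := 2 * j) (one_mem_monSpan 1 0)
    (by simp)
  rw [mul_one] at h
  exact monSpan_mono (by have := j.2; omega) h

/-- The power `ξ_1^{2j}` as an element of the Brown-Gitler comodule. -/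
noncomputable def brownGitlerGen (k : ℕ) (j : Fin (k + 1)) : (brownGitlerCoaction 1 k).X :=
  (exists_brownGitlerIncl (xi_one_pow_mem j)).choose

theorem brownGitlerIncl_gen (k : ℕ) (j : Fin (k + 1)) :
    brownGitlerIncl k (brownGitlerGen k j) = xi ⊤ 1 ^ (2 * (j : ℕ)) :=
  (exists_brownGitlerIncl (xi_one_pow_mem j)).choose_spec

theorem mem_brownGitler_piece {k : ℕ} {c : ℤ × ℤ} {x : (brownGitlerCoaction 1 k).X} :
    x ∈ (brownGitlerCoaction 1 k).piece c ↔ brownGitlerIncl k x ∈ DualA.piece ⊤ c := Iff.rfl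

/-- The Brown-Gitler comodule splits as a sum of copies of the coefficients, generated by the powers
of `ξ_1²`, and an acyclic summand. -/
noncomputable def brownGitlerSplitting (k : ℕ) : Splitting (brownGitlerCoaction 1 k) (Fin (k + 1)) where
  counital := brownGitler_counital k
  gradedModule := fun a b r x hr hx => by
    rw [mem_brownGitler_piece, map_smul, Algebra.smul_def, algebraMap_A]
    exact DualA.mul_mem_piece ⊤ _ _ _ _ (etaL_mem_piece ⊤ hr) hx
  proj := fun j => xiCoeff j ∘ₗ brownGitlerIncl k
  gen := brownGitlerGen k
  deg := fun j => (4 * (j : ℕ), 2 * (j : ℕ))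
  proj_gen := fun i j => by
    rw [LinearMap.comp_apply, brownGitlerIncl_gen, xiCoeff_xi_one_pow]
    simp only [Fin.ext_iff]
  bock_gen := fun i => brownGitlerIncl_injective k (by
    rw [brownGitlerIncl_bock, brownGitlerIncl_gen, bockA_xi_pow, map_zero])
  proj_bock := fun i x => by
    rw [LinearMap.comp_apply, brownGitlerIncl_bock, xiCoeff_bockA (brownGitlerIncl_mem k x)]
    rfl
  exact := fun x hx h => by
    have hx' : bockA (brownGitlerIncl k x) = 0 := by
      rw [← brownGitlerIncl_bock, hx, map_zero]
    have h' := homotopy (brownGitlerIncl_mem k x)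
    -- For a cycle with zero projections the homotopy formula reads β(contract x) = x, and this
    -- primitive stays within the weight bound.
    obtain ⟨w, hw⟩ := exists_brownGitlerIncl (contract_mem (brownGitlerIncl_mem k x))
    refine ⟨w, brownGitlerIncl_injective k ?_⟩
    rw [hx', map_zero, add_zero, Finset.sum_eq_zero, add_zero] at h'
    · rw [brownGitlerIncl_bock, hw, h']
    · intro i _
      have hi : xiCoeff i (brownGitlerIncl k x) = 0 := h i
      rw [hi, zero_smul]
  proj_mem := fun i c x hx => xiCoeff_mem hx i
  gen_mem := fun i => by
    rw [mem_brownGitler_piece, brownGitlerIncl_gen]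
    exact xi_one_pow_mem_piece i

end BrownGitler

end MotivicExt

/-! ### Assembly of the lemma. -/

theorem mainTheorem7 (k : ℕ) :
    ∃ α : TotalExt (unitCoaction 0) ≃+ HRing,
      α (Ext.of _ 0 rhoClass) = HRing.gen 0 ∧
      α (Ext.of _ 0 tauSqClass) = HRing.gen 1 ∧
      α (Ext.of _ 1 hZero) = HRing.gen 2 ∧
      (∀ (a b : ℕ) (x : Ext (unitCoaction 0) a) (y : Ext (unitCoaction 0) b),
        α (Ext.of _ (b + a) (Ext.mul _ a b x y)) = α (Ext.of _ a x) * α (Ext.of _ b y)) ∧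
      (∀ (s : ℤ) (f : ℕ) (w : ℤ),
        (Ext.piece (unitCoaction 0) s f w).map (α.toAddMonoidHom.comp (Ext.of _ f)) =
          HRing.piece s f w) ∧
      ∃ (T : AddSubgroup (TotalExt (brownGitlerCoaction 1 k)))
        (φ : TotalExt (brownGitlerCoaction 1 k) ⧸ T ≃+ (Fin (k + 1) → HRing)),
        (∀ z ∈ T, ∃ y : Ext (brownGitlerCoaction 1 k) 0, z = Ext.of _ 0 y ∧
          ∀ f : ℕ, 0 < f → ∀ x : Ext (unitCoaction 1) f, Ext.act _ f 0 x y = 0) ∧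
        (∀ (a b : ℕ) (x : Ext (unitCoaction 1) a) (y : Ext (brownGitlerCoaction 1 k) b),
          Ext.of _ b y ∈ T → Ext.of _ (b + a) (Ext.act _ a b x y) ∈ T) ∧
        (∀ (a b : ℕ) (x : Ext (unitCoaction 1) a) (y : Ext (brownGitlerCoaction 1 k) b),
          φ (QuotientAddGroup.mk (Ext.of _ (b + a) (Ext.act _ a b x y))) =
            α (Ext.of _ a (Ext.res 0 1 zero_le_one a x)) •
              φ (QuotientAddGroup.mk (Ext.of _ b y))) ∧
        (∀ (s : ℤ) (f : ℕ) (w : ℤ),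
          (Ext.piece (brownGitlerCoaction 1 k) s f w).map
              ((φ.toAddMonoidHom.comp (QuotientAddGroup.mk' T)).comp (Ext.of _ f)) =
            AddSubgroup.pi Set.univ
              (fun j : Fin (k + 1) => HRing.piece (s - 4 * (j : ℤ)) f (w - 2 * (j : ℤ)))) := by
  let S := brownGitlerSplitting k
  have hact : ∀ (a b : ℕ) (x : Ext (unitCoaction 1) a) (y : Ext (brownGitlerCoaction 1 k) b),
      S.extToRing (b + a) (Ext.act _ a b x y) =
        unitEquiv (Ext.of _ a (Ext.res 0 1 zero_le_one a x)) • S.extToRing b y := by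
    intro a b x y
    funext i
    rw [unitEquiv_of, Pi.smul_apply, smul_eq_mul]
    exact S.extToRing_mul a b _ y unitSplitting (fun _ => rfl) i
  -- T is the kernel of the surjection given by the splitting: the filtration-0 classes of cycles in
  -- the acyclic complement.
  let φ := QuotientAddGroup.quotientKerEquivOfSurjective S.toRing S.toRing_surjective
  have hφ : ∀ z, φ (QuotientAddGroup.mk z) = S.toRing z := fun _ => rfl
  refine ⟨unitEquiv, unitEquiv_rho, unitEquiv_tauSq, unitEquiv_hZero, unitEquiv_mul,
    unitEquiv_map_piece, S.toRing.ker, φ, fun z hz => ?_, fun a b x y hy => ?_, fun a b x y => ?_,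
    fun s f w => ?_⟩
  · refine ⟨z 0, S.eq_of_of_toRing_eq_zero hz, fun f hf x => ?_⟩
    have h0 : S.extToRing 0 (z 0) = 0 := by
      rw [← S.toRing_of, ← S.eq_of_of_toRing_eq_zero hz]
      exact hz
    -- The product has positive filtration f and maps to zero, and the comparison map is injective
    -- in positive filtration.
    exact S.extToRing_eq_zero (by omega) ((hact f 0 x (z 0)).trans (by rw [h0, smul_zero]))
  · have hy' : S.extToRing b y = 0 := (S.toRing_of b y).symm.trans hy
    change S.toRing _ = 0
    rw [S.toRing_of, hact, hy', smul_zero]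
  · rw [hφ, hφ, S.toRing_of, S.toRing_of, hact]
  · have e : (φ.toAddMonoidHom.comp (QuotientAddGroup.mk' S.toRing.ker)).comp (Ext.of _ f) =
        S.extToRing f := AddMonoidHom.ext fun x => S.toRing_of f x
    rw [e, S.map_piece]
    rfl
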